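/- Let $\mathbb D$ be the open unit disc, $dA=\frac{dx\,dy}{\pi}$, and let $\omega\ge 0$ be an integrable function on $[0,1)$ whose tail integral $\widehat\omega(r)=\int_r^1\omega(s)\,ds$ is positive for all $0\le r<1$; put $\omega(z)=\omega(|z|)$ for $z\in\mathbb D$ (a radial weight). For $p\in\{1,2\}$ let $A^p_\omega$ be the space of analytic functions $f$ in $\mathbb D$ with $\|f\|_{A^p_\omega}^p=\int_{\mathbb D}|f|^p\omega\,dA<\infty$, let $B^\omega_z$ be the reproducing kernel of $A^2_\omega$ at $z\in\mathbb D$, and let $P_\omega(f)(z)=\int_{\mathbb D}f(\zeta)\overline{B^\omega_z(\zeta)}\,\omega(\zeta)\,dA(\zeta)$. Let $\mathcal B$ be the Bloch space of analytic functions $f$ in $\mathbb D$ with $\|f\|_{\mathcal B}=\sup_{z\in\mathbb D}|f'(z)|(1-|z|^2)+|f(0)|<\infty$, and let $\mathcal B_0$ be its subspace of those $f$ with $f'(z)(1-|z|^2)\to0$ as $|z|\to1^-$. Write $\langle f,g\rangle_{A^2_\omega}=\lim_{r\to1^-}\int_{\mathbb D}f(rz)\overline{g(z)}\,\omega(z)\,dA(z)$;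 an identity $L(f)=\langle f,g\rangle_{A^2_\omega}$ includes the claim that these integrals (for $0<r<1$) and the limit exist. Then the following statements are equivalent: (i) $P_\omega:L^\infty(\mathbb D)\to\mathcal B$ is bounded; (ii) there is a constant $C=C(\omega)>0$ such that for each $L\in(A^1_\omega)^\star$ there is a unique $g\in\mathcal B$ such that $L(f)=\langle f,g\rangle_{A^2_\omega}$ for all $f\in A^1_\omega$, and this $g$ satisfies $\|g\|_{\mathcal B}\le C\|L\|$; (iii) there is a constant $C=C(\omega)>0$ such that for each $L\in\mathcal B_0^\star$ there is a unique $g\in A^1_\omega$ such that $L(f)=\langle f,g\rangle_{A^2_\omega}$ for all $f\in\mathcal B_0$, and this $g$ satisfies $\|g\|_{A^1_\omega}\le C\|L\|$; (iv) $\omega\in\widehat{\mathcal D}$, that is, there is a constant $C=C(\omega)\ge1$ such that $\widehat\omega(r)\le C\,\widehat\omega\left(\frac{1+r}{2}\right)$ for all $0\le r<1$. -/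

import Mathlib

open MeasureTheory Filter Topology Complex
open scoped ENNReal ComplexConjugate

namespace Bergman

noncomputable section

/-- The open unit disc of the complex plane. -/
def disc : Set ℂ := Metric.ball 0 1

/-- Normalized area measure `dA = dx dy / π` on the unit disc. -/
def area : Measure ℂ := (ENNReal.ofReal Real.pi)⁻¹ • volume.restrict disc

/-- The tail integral `∫_r^1 ω(s) ds`. -/
def tail (ω : ℝ → ℝ) (r : ℝ) : ℝ := ∫ s in r..1, ω s

/-- `ω` is a nonnegative integrable function on `[0,1)` all of whose tail integrals are positive;
it induces the radial weight `z ↦ ω |z|` on the disc. The values of `ω` outside `[0,1)` play no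
role. -/
structure IsRadialWeight (ω : ℝ → ℝ) : Prop where
  nonneg : ∀ r ∈ Set.Ico (0 : ℝ) 1, 0 ≤ ω r
  integrable : IntegrableOn ω (Set.Ico 0 1)
  tail_pos : ∀ r ∈ Set.Ico (0 : ℝ) 1, 0 < tail ω r

/-- The doubling condition on the tail integral. -/
def TailDoubling (ω : ℝ → ℝ) : Prop :=
  ∃ C : ℝ, 1 ≤ C ∧ ∀ r ∈ Set.Ico (0 : ℝ) 1, tail ω r ≤ C * tail ω ((1 + r) / 2)

/-- The measure `ω(|z|) dA(z)` on the disc. -/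
def weightMeasure (ω : ℝ → ℝ) : Measure ℂ :=
  area.withDensity fun z => ENNReal.ofReal (ω ‖z‖)

/-- The space of holomorphic functions in the unit disc. A function on the disc is represented by
its extension by zero to the plane, so that two elements are equal if and only if they agree on the
disc. -/
def holo : Submodule ℂ (ℂ → ℂ) where
  carrier := {f | DifferentiableOn ℂ f disc ∧ ∀ z ∉ disc, f z = 0}
  add_mem' := fun {f g} hf hg =>
    ⟨hf.1.add hg.1, fun z hz => by simp [hf.2 z hz, hg.2 z hz]⟩
  zero_mem' := ⟨differentiableOn_const 0, fun _ _ => rfl⟩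
  smul_mem' := fun c f hf => ⟨hf.1.const_smul c, fun z hz => by simp [hf.2 z hz]⟩

/-! ### Weighted Bergman spaces -/

/-- The Bergman space `A^p_ω`, as a subspace of the holomorphic functions. -/
def bergmanSubmodule (p : ℝ≥0∞) (ω : ℝ → ℝ) : Submodule ℂ holo where
  carrier := {f | MemLp (f : ℂ → ℂ) p (weightMeasure ω)}
  add_mem' := fun hf hg => MemLp.add hf hg
  zero_mem' := MemLp.zero
  smul_mem' := fun c _ hf => MemLp.const_smul hf c

/-- The Bergman space `A^p_ω`. -/
def BergmanSpace (p : ℝ≥0∞) (ω : ℝ → ℝ) : Type := bergmanSubmodule p ω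

instance (p : ℝ≥0∞) (ω : ℝ → ℝ) : AddCommGroup (BergmanSpace p ω) :=
  inferInstanceAs (AddCommGroup (bergmanSubmodule p ω))

instance (p : ℝ≥0∞) (ω : ℝ → ℝ) : Module ℂ (BergmanSpace p ω) :=
  inferInstanceAs (Module ℂ (bergmanSubmodule p ω))

instance (p : ℝ≥0∞) (ω : ℝ → ℝ) : CoeFun (BergmanSpace p ω) (fun _ => ℂ → ℂ) :=
  ⟨fun f => f.1.1⟩

/-- The inclusion of `A^p_ω` into `L^p_ω`. -/
def BergmanSpace.toLp (p : ℝ≥0∞) (ω : ℝ → ℝ) :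
    BergmanSpace p ω →ₗ[ℂ] Lp ℂ p (weightMeasure ω) where
  toFun f := MemLp.toLp (f : ℂ → ℂ) f.2
  map_add' f g := MemLp.toLp_add f.2 g.2
  map_smul' c f := MemLp.toLp_const_smul c f.2

/-- `A^p_ω` carries the norm of `L^p_ω`. (It is registered as a seminorm only because `ω` is
arbitrary here; it separates points as soon as `ω` has positive tail integrals.) -/
instance (p : ℝ≥0∞) [Fact (1 ≤ p)] (ω : ℝ → ℝ) : SeminormedAddCommGroup (BergmanSpace p ω) :=
  SeminormedAddCommGroup.induced _ _ (BergmanSpace.toLp p ω)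

instance (p : ℝ≥0∞) [Fact (1 ≤ p)] (ω : ℝ → ℝ) : NormedSpace ℂ (BergmanSpace p ω) :=
  NormedSpace.induced ℂ _ _ (BergmanSpace.toLp p ω)

/-! ### The Bergman projection -/

/-- `k` is the reproducing kernel of `A^2_ω` at the point `z`. -/
def IsReproducingKernel (ω : ℝ → ℝ) (z : ℂ) (k : BergmanSpace 2 ω) : Prop :=
  ∀ f : BergmanSpace 2 ω, f z = ∫ ζ, f ζ * conj (k ζ) ∂(weightMeasure ω)

open Classical in
/-- The reproducing kernel `B^ω_z` of `A^2_ω` at `z` (zero if there is none). -/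
def kernel (ω : ℝ → ℝ) (z : ℂ) : BergmanSpace 2 ω :=
  if h : ∃ k, IsReproducingKernel ω z k then h.choose else 0

/-- The Bergman projection `P_ω f (z) = ∫ f(ζ) conj (B^ω_z(ζ)) ω(ζ) dA(ζ)`. -/
def projection (ω : ℝ → ℝ) (f : ℂ → ℂ) (z : ℂ) : ℂ :=
  ∫ ζ, f ζ * conj (kernel ω z ζ) ∂(weightMeasure ω)

/-! ### The Bloch space and the little Bloch space -/

/-- The quantity `|f'(z)| (1 - |z|^2)`. -/
def blochQuantity (f : ℂ → ℂ) (z : ℂ) : ℝ := ‖deriv f z‖ * (1 - ‖z‖ ^ 2)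

lemma blochQuantity_nonneg (f : ℂ → ℂ) (z : disc) : 0 ≤ blochQuantity f z := by
  have hz : ‖(z : ℂ)‖ < 1 := by simpa [disc] using z.2
  have := norm_nonneg (z : ℂ)
  exact mul_nonneg (norm_nonneg _) (by nlinarith)

lemma differentiableAt_of_mem (f : holo) (z : disc) : DifferentiableAt ℂ (f : ℂ → ℂ) z :=
  f.2.1.differentiableAt (Metric.isOpen_ball.mem_nhds z.2)

lemma blochQuantity_add (f g : holo) (z : disc) :
    blochQuantity ((f + g : holo) : ℂ → ℂ) z ≤ blochQuantity f z + blochQuantity g z := by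
  have hz : ‖(z : ℂ)‖ < 1 := by simpa [disc] using z.2
  have h0 := norm_nonneg (z : ℂ)
  have h1 : deriv ((f + g : holo) : ℂ → ℂ) z = deriv (f : ℂ → ℂ) z + deriv (g : ℂ → ℂ) z :=
    deriv_add (differentiableAt_of_mem f z) (differentiableAt_of_mem g z)
  unfold blochQuantity
  rw [h1, ← add_mul]
  exact mul_le_mul_of_nonneg_right (norm_add_le _ _) (by nlinarith)

lemma blochQuantity_smul (c : ℂ) (f : holo) (z : disc) :
    blochQuantity ((c • f : holo) : ℂ → ℂ) z = ‖c‖ * blochQuantity f z := by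
  have h1 : deriv ((c • f : holo) : ℂ → ℂ) z = c • deriv (f : ℂ → ℂ) z :=
    deriv_const_smul c (differentiableAt_of_mem f z)
  unfold blochQuantity
  rw [h1, norm_smul, mul_assoc]

lemma blochQuantity_zero (z : ℂ) : blochQuantity ((0 : holo) : ℂ → ℂ) z = 0 := by
  have h : deriv ((0 : holo) : ℂ → ℂ) z = 0 := deriv_const z (0 : ℂ)
  unfold blochQuantity
  rw [h, norm_zero, zero_mul]

/-- The Bloch space, as a subspace of the holomorphic functions. -/
def blochSubmodule : Submodule ℂ holo where
  carrier := {f | BddAbove (Set.range fun z : disc => blochQuantity (f : ℂ → ℂ) z)}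
  add_mem' := by
    rintro f g ⟨a, ha⟩ ⟨b, hb⟩
    refine ⟨a + b, ?_⟩
    rintro _ ⟨z, rfl⟩
    exact (blochQuantity_add f g z).trans (add_le_add (ha ⟨z, rfl⟩) (hb ⟨z, rfl⟩))
  zero_mem' := by
    refine ⟨0, ?_⟩
    rintro _ ⟨z, rfl⟩
    exact (blochQuantity_zero z).le
  smul_mem' := by
    rintro c f ⟨a, ha⟩
    refine ⟨‖c‖ * a, ?_⟩
    rintro _ ⟨z, rfl⟩
    exact (blochQuantity_smul c f z).le.trans
      (mul_le_mul_of_nonneg_left (ha ⟨z, rfl⟩) (norm_nonneg c))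

/-- The Bloch space. -/
def Bloch : Type := blochSubmodule

instance : AddCommGroup Bloch := inferInstanceAs (AddCommGroup blochSubmodule)

instance : Module ℂ Bloch := inferInstanceAs (Module ℂ blochSubmodule)

instance : CoeFun Bloch (fun _ => ℂ → ℂ) := ⟨fun f => f.1.1⟩

/-- The Bloch norm `sup_{|z|<1} |f'(z)| (1 - |z|^2) + |f(0)|`. -/
def blochNorm (f : Bloch) : ℝ := (⨆ z : disc, blochQuantity f z) + ‖f 0‖

instance : Nonempty disc := ⟨⟨0, by simp [disc]⟩⟩

/-- The Bloch norm as a seminorm. -/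
def blochSeminorm : Seminorm ℂ Bloch :=
  Seminorm.of blochNorm
    (fun f g => by
      have h1 : (⨆ z : disc, blochQuantity (f + g : Bloch) z) ≤
          (⨆ z : disc, blochQuantity f z) + ⨆ z : disc, blochQuantity g z :=
        ciSup_le fun z => (blochQuantity_add f.1 g.1 z).trans
          (add_le_add (le_ciSup f.2 z) (le_ciSup g.2 z))
      have h2 : ‖(f + g : Bloch) 0‖ ≤ ‖f 0‖ + ‖g 0‖ := norm_add_le (f 0) (g 0)
      unfold blochNorm
      linarith)
    (fun c f => by
      have h1 : (⨆ z : disc, blochQuantity (c • f : Bloch) z) =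
          ‖c‖ * ⨆ z : disc, blochQuantity f z := by
        rw [Real.mul_iSup_of_nonneg (norm_nonneg c)]
        exact iSup_congr fun z => blochQuantity_smul c f.1 z
      have h2 : ‖(c • f : Bloch) 0‖ = ‖c‖ * ‖f 0‖ := norm_smul c (f 0)
      unfold blochNorm
      rw [h1, h2, mul_add])

lemma blochNorm_eq_zero (f : Bloch) (hf : blochNorm f = 0) : f = 0 := by
  have hsup : 0 ≤ ⨆ z : disc, blochQuantity f z :=
    Real.iSup_nonneg fun z => blochQuantity_nonneg f z
  have h0 := norm_nonneg (f 0)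
  unfold blochNorm at hf
  have hs : (⨆ z : disc, blochQuantity f z) = 0 := by linarith
  have hz0 : f 0 = 0 := norm_eq_zero.1 (by linarith)
  have hd : Set.EqOn (deriv (f : ℂ → ℂ)) 0 disc := by
    intro z hz
    have hz' : ‖z‖ < 1 := by simpa [disc] using hz
    have hq : blochQuantity f z ≤ 0 := hs ▸ le_ciSup f.2 (⟨z, hz⟩ : disc)
    have hp : 0 < 1 - ‖z‖ ^ 2 := by nlinarith [norm_nonneg z]
    unfold blochQuantity at hq
    have : ‖deriv (f : ℂ → ℂ) z‖ ≤ 0 := by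
      by_contra hc
      exact absurd hq (not_le.2 (mul_pos (not_le.1 hc) hp))
    exact norm_le_zero_iff.1 this
  have hz : ∀ z, f z = 0 := by
    intro z
    by_cases h : z ∈ disc
    · rw [← hz0]
      exact Metric.isOpen_ball.is_const_of_deriv_eq_zero
        (convex_ball (0 : ℂ) 1).isPreconnected f.1.2.1 hd h (by simp)
    · exact f.1.2.2 z h
  exact Subtype.ext (Subtype.ext (funext hz))

instance : NormedAddCommGroup Bloch :=
  AddGroupNorm.toNormedAddCommGroup
    { blochSeminorm.toAddGroupSeminorm with
      eq_zero_of_map_eq_zero' := blochNorm_eq_zero }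

instance : NormedSpace ℂ Bloch where
  norm_smul_le c f := (blochSeminorm.smul' c f).le

/-- The little Bloch space, with the norm of the Bloch space: `|f'(z)| (1 - |z|^2) → 0` as
`|z| → 1` from below (which for holomorphic `f` implies that `f` is a Bloch function). -/
def LittleBloch : Submodule ℂ Bloch where
  carrier := {f | Tendsto (blochQuantity f) (comap (fun z : ℂ => ‖z‖) (𝓝[<] 1)) (𝓝 0)}
  add_mem' := by
    intro f g hf hg
    have hmem : ∀ᶠ z in comap (fun z : ℂ => ‖z‖) (𝓝[<] 1), z ∈ disc :=
      (eventually_mem_nhdsWithin.comap _).mono fun z hz => by simpa [disc] using hz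
    have h := Tendsto.add hf hg
    rw [add_zero] at h
    exact squeeze_zero' (hmem.mono fun z hz => blochQuantity_nonneg _ ⟨z, hz⟩)
      (hmem.mono fun z hz => blochQuantity_add f.1 g.1 ⟨z, hz⟩) h
  zero_mem' := tendsto_const_nhds.congr fun z => (blochQuantity_zero z).symm
  smul_mem' := by
    intro c f hf
    have hmem : ∀ᶠ z in comap (fun z : ℂ => ‖z‖) (𝓝[<] 1), z ∈ disc :=
      (eventually_mem_nhdsWithin.comap _).mono fun z hz => by simpa [disc] using hz
    have h := Tendsto.const_mul ‖c‖ hf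
    rw [mul_zero] at h
    exact h.congr' (hmem.mono fun z hz => (blochQuantity_smul c f.1 ⟨z, hz⟩).symm)

/-! ### The `A^2_ω` pairing -/

/-- The pairing `⟨f, g⟩ = lim_{r → 1⁻} ∫ f(rz) conj(g(z)) ω(z) dA(z)` is defined (the integrals
exist and converge to a limit) and has the value `a`. -/
def HasPairing (ω : ℝ → ℝ) (f g : ℂ → ℂ) (a : ℂ) : Prop :=
  (∀ r ∈ Set.Ioo (0 : ℝ) 1, Integrable (fun z : ℂ => f (r * z) * conj (g z)) (weightMeasure ω)) ∧
  Tendsto (fun r : ℝ => ∫ z, f (r * z) * conj (g z) ∂(weightMeasure ω)) (𝓝[<] 1) (𝓝 a)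

end

end Bergman

open Bergman

namespace Bergman

noncomputable section

variable {ω : ℝ → ℝ}

/-! ### The measure `ω dA` -/

/-! Write m_n for the moment ∫|z|^n ω dA. The measure is rotation invariant, so monomials are
orthogonal and everything is read off Taylor coefficients: the kernel at z has coefficients
conj(z)^n / m_{2n}, and a functional L paired with g = Σ b_n z^n must satisfy conj(b_n) m_{2n} =
L(z^n), which already gives uniqueness of g. The condition through which all four statements pass is
`MomentDoubling`, m_n ≤ K m_{2n}.

Moments and tails. `TailDoubling.momentDoubling` uses the layer cake formula and 2x - 1 ≤ x^2.
`MomentDoubling.tailDoubling` iterates moment doubling until the mass inside radius (1+r)/2 is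
negligible and can be absorbed.

Necessity. Both the projection and the duality of A^1 are tested on the unimodular function
(z/|z|)^n, which produces a Bloch function with n-th coefficient m_n / m_{2n}; Bloch coefficients
are bounded by the norm (`Bloch.norm_coeff_le`). For the little Bloch space the test is the n-th
coefficient functional: its representative has n-th coefficient of modulus 1 / m_{2n}, and
coefficients in A^1 satisfy |a_n| m_n ≤ ‖g‖ (`HasCoeffs.norm_mul_moment_le`).

Sufficiency. The core is `MomentDoubling.exists_kernelDeriv_le`: H(ζ) = Σ (n+1)(wζ)^n / m_{2n+2} has
A^1 norm O(1/(1-|w|)). On a dyadic annulus at distance about 1/N from the circle, H is the product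
of (1-wζ)H and 1/(1-wζ). The first factor has coefficients of size at most a constant times |w|^n /
m_{2n+2}, so Cauchy–Schwarz and Parseval bound the contribution by a constant times N; the annuli
add up geometrically. Since g'(z) is the conjugate of L applied to ζH(ζ) with w = conj z, the
representative of L on A^1 is a Bloch function (`MomentDoubling.exists_bloch`). The projection of f
represents q ↦ ∫ q conj(f) ω dA, which gives its boundedness. The dual of the little Bloch space
follows by duality: the L^1 norm of a dilation of g is L evaluated, up to conjugation, at a dilated
Bloch function of controlled norm (`MomentDoubling.exists_integral_dilate_le`).

That the limit defining the pairing exists and equals L(f) is handled once for both spaces by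
`DilationSpace`: a dilation f_r is the norm sum of its power series, so its pairing is computed
termwise, and f_r → f in norm. For A^1 this convergence rests on the monotonicity of L^1 means under
dilation, a maximum principle argument. -/

lemma mem_disc {z : ℂ} : z ∈ disc ↔ ‖z‖ < 1 := by simp [disc]

lemma measurableSet_disc : MeasurableSet disc := Metric.isOpen_ball.measurableSet

lemma isOpen_disc : IsOpen disc := Metric.isOpen_ball

lemma area_ae_mem_disc : ∀ᵐ z ∂area, z ∈ disc :=
  Measure.smul_absolutelyContinuous.ae_le (ae_restrict_mem measurableSet_disc)

lemma weightMeasure_absolutelyContinuous (ω : ℝ → ℝ) : weightMeasure ω ≪ area :=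
  withDensity_absolutelyContinuous _ _

lemma ae_mem_disc (ω : ℝ → ℝ) : ∀ᵐ z ∂(weightMeasure ω), z ∈ disc :=
  (weightMeasure_absolutelyContinuous ω).ae_le area_ae_mem_disc

lemma ae_norm_lt_one (ω : ℝ → ℝ) : ∀ᵐ z ∂(weightMeasure ω), ‖z‖ < 1 :=
  (ae_mem_disc ω).mono fun _ hz => mem_disc.1 hz

lemma inv_ofReal_pi_ne_top : (ENNReal.ofReal Real.pi)⁻¹ ≠ ∞ := by
  simp [Real.pi_pos]

lemma IsRadialWeight.integrableOn_Ioo (hω : IsRadialWeight ω) :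
    IntegrableOn ω (Set.Ioo 0 1) :=
  hω.integrable.mono_set Set.Ioo_subset_Ico_self

lemma IsRadialWeight.integrableOn_bdd_mul (hω : IsRadialWeight ω) {f : ℝ → ℝ}
    (hf : Continuous f) : IntegrableOn (fun t => f t * ω t) (Set.Ioo 0 1) := by
  obtain ⟨C, hC⟩ := (isCompact_Icc (a := (0 : ℝ)) (b := 1)).exists_bound_of_continuousOn
    hf.continuousOn
  refine Integrable.bdd_mul (c := C) hω.integrableOn_Ioo hf.aestronglyMeasurable ?_
  filter_upwards [ae_restrict_mem measurableSet_Ioo] with t ht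
  exact hC t ⟨ht.1.le, ht.2.le⟩

lemma IsRadialWeight.integrable_area (hω : IsRadialWeight ω) :
    Integrable (fun z : ℂ => ω ‖z‖) area := by
  refine Integrable.smul_measure ?_ inv_ofReal_pi_ne_top
  refine (integrableOn_fun_norm_addHaar (volume : Measure ℂ) (f := ω) (r := 1)).2 ?_
  simpa using hω.integrableOn_bdd_mul continuous_id

lemma IsRadialWeight.isFiniteMeasure (hω : IsRadialWeight ω) :
    IsFiniteMeasure (weightMeasure ω) :=
  isFiniteMeasure_withDensity_ofReal hω.integrable_area.2

/-- Polar coordinates; the factor 2 is 2π divided by the normalisation π of the area. -/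
lemma IsRadialWeight.integral_norm (hω : IsRadialWeight ω) (f : ℝ → ℝ) :
    ∫ z, f ‖z‖ ∂(weightMeasure ω) = 2 * ∫ t in Set.Ioo 0 1, t * (ω t * f t) := by
  unfold weightMeasure
  rw [integral_withDensity_eq_integral_toReal_smul₀
    hω.integrable_area.aestronglyMeasurable.aemeasurable.ennreal_ofReal
    (ae_of_all _ fun _ => ENNReal.ofReal_lt_top)]
  unfold area
  rw [integral_smul_measure, disc, ← integral_indicator Metric.isOpen_ball.measurableSet]
  have h1 : ((Metric.ball (0 : ℂ) 1).indicator fun z => (ENNReal.ofReal (ω ‖z‖)).toReal • f ‖z‖) =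
      fun z : ℂ => (Set.Iio (1 : ℝ)).indicator
        (fun t => (ENNReal.ofReal (ω t)).toReal • f t) ‖z‖ := by
    ext z
    simp [Set.indicator]
  rw [h1, integral_fun_norm_addHaar]
  have h2 : ∀ t : ℝ, t ^ (Module.finrank ℝ ℂ - 1) • (Set.Iio (1 : ℝ)).indicator
        (fun t => (ENNReal.ofReal (ω t)).toReal • f t) t =
      (Set.Iio (1 : ℝ)).indicator (fun t => t * ((ENNReal.ofReal (ω t)).toReal * f t)) t := by
    intro t
    by_cases h : t < 1 <;> simp [h]
  rw [setIntegral_congr_fun measurableSet_Ioi fun t _ => h2 t]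
  rw [integral_indicator measurableSet_Iio, Measure.restrict_restrict measurableSet_Iio]
  have h3 : Set.Iio (1 : ℝ) ∩ Set.Ioi 0 = Set.Ioo 0 1 := by
    ext; simp [and_comm]
  rw [h3]
  have h4 : ∫ t in Set.Ioo (0 : ℝ) 1, t * ((ENNReal.ofReal (ω t)).toReal * f t) =
      ∫ t in Set.Ioo 0 1, t * (ω t * f t) := by
    refine setIntegral_congr_fun measurableSet_Ioo fun t ht => ?_
    rw [ENNReal.toReal_ofReal (hω.nonneg t ⟨ht.1.le, ht.2⟩)]
  rw [h4]
  have h5 : (volume : Measure ℂ).real (Metric.ball 0 1) = Real.pi := by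
    simp [Measure.real, Complex.volume_ball]
  rw [h5]
  simp only [Complex.finrank_real_complex, ENNReal.toReal_inv,
    ENNReal.toReal_ofReal Real.pi_pos.le, smul_eq_mul, nsmul_eq_mul]
  have := Real.pi_pos
  push_cast
  field_simp

/-- This invariance is the source of all orthogonality relations below and of the maximum principle
argument for dilations. -/
lemma weightMeasure_measurePreserving (ω : ℝ → ℝ) {u : ℂ} (hu : ‖u‖ = 1) :
    MeasurePreserving (fun z => u * z) (weightMeasure ω) (weightMeasure ω) := by
  let a : Circle := ⟨u, mem_sphere_zero_iff_norm.2 hu⟩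
  have h0 : MeasurePreserving (fun z => u * z) (volume : Measure ℂ) volume :=
    (rotation a).measurePreserving
  have hemb : MeasurableEmbedding (fun z : ℂ => u * z) :=
    measurableEmbedding_mulLeft₀ (norm_ne_zero_iff.1 (by rw [hu]; exact one_ne_zero))
  have hpre : (fun z => u * z) ⁻¹' disc = disc := by
    ext z; simp [disc, hu]
  have h1 : MeasurePreserving (fun z => u * z) area area := by
    have := (h0.restrict_preimage measurableSet_disc).smul_measure (ENNReal.ofReal Real.pi)⁻¹
    rwa [hpre] at this
  refine ⟨h0.measurable, ?_⟩
  ext s hs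
  rw [Measure.map_apply h0.measurable hs]
  unfold weightMeasure
  rw [withDensity_apply _ hs, withDensity_apply _ (h0.measurable hs),
    ← h1.setLIntegral_comp_preimage_emb hemb (fun z => ENNReal.ofReal (ω ‖z‖)) s]
  simp [hu]

lemma integral_rotate (ω : ℝ → ℝ) {u : ℂ} (hu : ‖u‖ = 1) (F : ℂ → ℂ) :
    ∫ z, F (u * z) ∂(weightMeasure ω) = ∫ z, F z ∂(weightMeasure ω) :=
  (weightMeasure_measurePreserving ω hu).integral_comp
    (measurableEmbedding_mulLeft₀ (norm_ne_zero_iff.1 (by rw [hu]; exact one_ne_zero))) F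

lemma integral_rotate_real (ω : ℝ → ℝ) {u : ℂ} (hu : ‖u‖ = 1) (F : ℂ → ℝ) :
    ∫ z, F (u * z) ∂(weightMeasure ω) = ∫ z, F z ∂(weightMeasure ω) :=
  (weightMeasure_measurePreserving ω hu).integral_comp
    (measurableEmbedding_mulLeft₀ (norm_ne_zero_iff.1 (by rw [hu]; exact one_ne_zero))) F

/-- The moments `∫ |z|^n ω dA`. -/
def moment (ω : ℝ → ℝ) (n : ℕ) : ℝ := ∫ z, ‖z‖ ^ n ∂(weightMeasure ω)

lemma IsRadialWeight.moment_eq (hω : IsRadialWeight ω) (n : ℕ) :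
    moment ω n = 2 * ∫ t in Set.Ioo 0 1, t ^ (n + 1) * ω t := by
  unfold moment
  rw [hω.integral_norm (fun t => t ^ n)]
  congr 2
  ext t
  ring

lemma IsRadialWeight.integrable_of_bound (hω : IsRadialWeight ω) {E : Type*}
    [NormedAddCommGroup E] {f : ℂ → E} (hf : AEStronglyMeasurable f (weightMeasure ω)) (C : ℝ)
    (hC : ∀ z ∈ disc, ‖f z‖ ≤ C) : Integrable f (weightMeasure ω) := by
  have := hω.isFiniteMeasure
  exact Integrable.of_bound hf C ((ae_mem_disc ω).mono hC)

lemma IsRadialWeight.integrable_norm_pow (hω : IsRadialWeight ω) (n : ℕ) :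
    Integrable (fun z : ℂ => ‖z‖ ^ n) (weightMeasure ω) := by
  refine hω.integrable_of_bound (by fun_prop) 1 fun z hz => ?_
  simpa using pow_le_one₀ (norm_nonneg z) (mem_disc.1 hz).le

lemma IsRadialWeight.moment_anti (hω : IsRadialWeight ω) : Antitone (moment ω) := by
  intro m n hmn
  refine integral_mono_ae (hω.integrable_norm_pow n) (hω.integrable_norm_pow m) ?_
  filter_upwards [ae_norm_lt_one ω] with z hz
  exact pow_le_pow_of_le_one (norm_nonneg z) hz.le hmn

lemma moment_zero (ω : ℝ → ℝ) : moment ω 0 = (weightMeasure ω).real Set.univ := by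
  simp [moment]

lemma tail_eq_integral_Ioo (ω : ℝ → ℝ) {r : ℝ} (hr : r ≤ 1) :
    tail ω r = ∫ t in Set.Ioo r 1, ω t := by
  rw [tail, intervalIntegral.integral_of_le hr, integral_Ioc_eq_integral_Ioo]

lemma IsRadialWeight.tail_anti (hω : IsRadialWeight ω) {r s : ℝ} (hr : 0 ≤ r) (hrs : r ≤ s)
    (hs : s ≤ 1) : tail ω s ≤ tail ω r := by
  rw [tail_eq_integral_Ioo ω hs, tail_eq_integral_Ioo ω (hrs.trans hs)]
  refine setIntegral_mono_set ?_ ?_ (LE.le.eventuallyLE (Set.Ioo_subset_Ioo_left hrs))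
  · exact hω.integrable.mono_set fun t ht => ⟨hr.trans ht.1.le, ht.2⟩
  · filter_upwards [ae_restrict_mem measurableSet_Ioo] with t ht
    exact hω.nonneg t ⟨hr.trans ht.1.le, ht.2⟩

lemma IsRadialWeight.tail_le_moment (hω : IsRadialWeight ω) {r : ℝ} (hr : r ∈ Set.Ico (0 : ℝ) 1)
    (n : ℕ) : 2 * r ^ (n + 1) * tail ω r ≤ moment ω n := by
  rw [hω.moment_eq, tail_eq_integral_Ioo ω hr.2.le, mul_assoc, ← integral_const_mul]
  have hpos : ∀ t ∈ Set.Ioo (0 : ℝ) 1, 0 ≤ t ^ (n + 1) * ω t := fun t ht =>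
    mul_nonneg (pow_nonneg ht.1.le _) (hω.nonneg t ⟨ht.1.le, ht.2⟩)
  have hsub : Set.Ioo r 1 ⊆ Set.Ioo 0 1 := Set.Ioo_subset_Ioo_left hr.1
  have hint := hω.integrableOn_bdd_mul (f := fun t => t ^ (n + 1)) (by fun_prop)
  refine mul_le_mul_of_nonneg_left ?_ zero_le_two
  calc ∫ t in Set.Ioo r 1, r ^ (n + 1) * ω t
      ≤ ∫ t in Set.Ioo r 1, t ^ (n + 1) * ω t := by
        refine setIntegral_mono_on ((hω.integrableOn_Ioo.mono_set hsub).const_mul _)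
          (hint.mono_set hsub) measurableSet_Ioo fun t ht => ?_
        exact mul_le_mul_of_nonneg_right (pow_le_pow_left₀ hr.1 ht.1.le _)
          (hω.nonneg t ⟨hr.1.trans ht.1.le, ht.2⟩)
    _ ≤ ∫ t in Set.Ioo 0 1, t ^ (n + 1) * ω t := by
        refine setIntegral_mono_set hint ?_ (LE.le.eventuallyLE hsub)
        filter_upwards [ae_restrict_mem measurableSet_Ioo] with t ht using hpos t ht

lemma IsRadialWeight.moment_pos (hω : IsRadialWeight ω) (n : ℕ) : 0 < moment ω n := by
  have h := hω.tail_le_moment (r := 1 / 2) (by norm_num) n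
  have := hω.tail_pos (1 / 2) (by norm_num)
  exact lt_of_lt_of_le (by positivity) h

/-- Any number below `1` bounds the exponential decay of the moments from below. -/
lemma IsRadialWeight.exists_pow_le_moment (hω : IsRadialWeight ω) {r : ℝ}
    (hr : r ∈ Set.Ioo (0 : ℝ) 1) : ∃ c, 0 < c ∧ ∀ n, c * r ^ n ≤ moment ω n := by
  have := hω.tail_pos r ⟨hr.1.le, hr.2⟩
  have h0 := hr.1
  refine ⟨2 * r * tail ω r, by positivity, fun n => ?_⟩
  refine le_trans (le_of_eq ?_) (hω.tail_le_moment ⟨hr.1.le, hr.2⟩ n)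
  ring

/-- The part of the measure near the boundary is controlled by a moment. -/
lemma IsRadialWeight.measureReal_le_moment (hω : IsRadialWeight ω) {r : ℝ} (hr : 0 ≤ r) (n : ℕ) :
    r ^ n * (weightMeasure ω).real {z | r ≤ ‖z‖} ≤ moment ω n := by
  have := hω.isFiniteMeasure
  have hm : MeasurableSet {z : ℂ | r ≤ ‖z‖} := measurableSet_le measurable_const measurable_norm
  have h1 : ∫ z in {z : ℂ | r ≤ ‖z‖}, r ^ n ∂(weightMeasure ω) =
      r ^ n * (weightMeasure ω).real {z | r ≤ ‖z‖} := by
    rw [setIntegral_const, smul_eq_mul, mul_comm]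
  rw [← h1]
  calc _ ≤ ∫ z in {z : ℂ | r ≤ ‖z‖}, ‖z‖ ^ n ∂(weightMeasure ω) := by
        refine setIntegral_mono_on (integrable_const _).integrableOn
          (hω.integrable_norm_pow n).integrableOn hm fun z hz => ?_
        exact pow_le_pow_left₀ hr hz n
    _ ≤ moment ω n := by
        refine setIntegral_le_integral (hω.integrable_norm_pow n) (ae_of_all _ fun z => ?_)
        exact pow_nonneg (norm_nonneg z) n

/-! ### Power series in the disc -/

/-- `f` is the sum of the power series with coefficients `a` in the disc. -/
def HasCoeffs (a : ℕ → ℂ) (f : ℂ → ℂ) : Prop :=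
  ∀ z ∈ disc, HasSum (fun n => a n * z ^ n) (f z)

/-- The sum of a power series in the disc, extended by zero. -/
def sumSeries (a : ℕ → ℂ) (z : ℂ) : ℂ :=
  open Classical in if z ∈ disc then ∑' n, a n * z ^ n else 0

/-- The power series with coefficients `a` converges absolutely in the disc. -/
def Converges (a : ℕ → ℂ) : Prop :=
  ∀ r ∈ Set.Ico (0 : ℝ) 1, Summable fun n => ‖a n‖ * r ^ n

/-- The Taylor coefficients at the origin. -/
def coeff (f : ℂ → ℂ) (n : ℕ) : ℂ := (n.factorial : ℂ)⁻¹ * iteratedDeriv n f 0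

lemma HasCoeffs.converges {a : ℕ → ℂ} {f : ℂ → ℂ} (h : HasCoeffs a f) : Converges a := by
  intro r hr
  have := (h r (by simp [mem_disc, abs_of_nonneg hr.1, hr.2])).summable.norm
  simpa [abs_of_nonneg hr.1] using this

lemma Converges.summable {a : ℕ → ℂ} (h : Converges a) {z : ℂ} (hz : z ∈ disc) :
    Summable fun n => a n * z ^ n := by
  refine Summable.of_norm ?_
  simpa using h ‖z‖ ⟨norm_nonneg z, mem_disc.1 hz⟩

lemma Converges.hasCoeffs {a : ℕ → ℂ} (h : Converges a) : HasCoeffs a (sumSeries a) := by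
  intro z hz
  rw [sumSeries, if_pos hz]
  exact (h.summable hz).hasSum

lemma sumSeries_of_notMem {a : ℕ → ℂ} {z : ℂ} (hz : z ∉ disc) : sumSeries a z = 0 := by
  simp [sumSeries, hz]

lemma hasCoeffs_coeff {f : ℂ → ℂ} (hf : DifferentiableOn ℂ f disc) : HasCoeffs (coeff f) f := by
  intro z hz
  refine (hasSum_taylorSeries_on_ball hf hz).congr_fun fun n => ?_
  simp only [coeff, smul_eq_mul, sub_zero]
  ring

lemma Converges.exists_bound {a : ℕ → ℂ} (h : Converges a) {r : ℝ} (hr : r ∈ Set.Ico (0 : ℝ) 1) :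
    ∃ C, ∀ n, ‖a n‖ * r ^ n ≤ C := by
  obtain ⟨C, hC⟩ := (h r hr).tendsto_atTop_zero.bddAbove_range
  exact ⟨C, fun n => hC ⟨n, rfl⟩⟩

lemma summable_succ_mul_pow {q : ℝ} (hq : q ∈ Set.Ico (0 : ℝ) 1) :
    Summable fun n : ℕ => ((n : ℝ) + 1) * q ^ n := by
  have h1 := summable_pow_mul_geometric_of_norm_lt_one 1 (r := q)
    (by rw [Real.norm_eq_abs, abs_of_nonneg hq.1]; exact hq.2)
  have h2 := summable_geometric_of_lt_one hq.1 hq.2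
  refine (h1.add h2).congr fun n => ?_
  ring

lemma Converges.succ_mul {a : ℕ → ℂ} (h : Converges a) {r : ℝ} (hr : r ∈ Set.Ico (0 : ℝ) 1) :
    Summable fun n : ℕ => ((n : ℝ) + 1) * (‖a n‖ * r ^ n) := by
  obtain ⟨s, hrs, hs⟩ := exists_between hr.2
  have hs0 : 0 < s := hr.1.trans_lt hrs
  obtain ⟨C, hC⟩ := h.exists_bound ⟨hs0.le, hs⟩
  have hq : r / s ∈ Set.Ico (0 : ℝ) 1 := ⟨div_nonneg hr.1 hs0.le, (div_lt_one hs0).2 hrs⟩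
  refine Summable.of_nonneg_of_le (fun n => ?_) (fun n => ?_)
    ((summable_succ_mul_pow hq).mul_left C)
  · have := hr.1
    positivity
  · have h1 : ‖a n‖ * r ^ n = (‖a n‖ * s ^ n) * (r / s) ^ n := by
      rw [div_pow]; field_simp
    rw [h1]
    have := mul_le_mul_of_nonneg_right (hC n)
      (mul_nonneg (by positivity : (0 : ℝ) ≤ (n : ℝ) + 1) (pow_nonneg hq.1 n))
    linarith

/-- The coefficients of the derivative. -/
def derivCoeff (a : ℕ → ℂ) (n : ℕ) : ℂ := (n + 1) * a (n + 1)

lemma HasCoeffs.differentiableOn_and_deriv {a : ℕ → ℂ} {f : ℂ → ℂ} (h : HasCoeffs a f) :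
    DifferentiableOn ℂ f disc ∧ HasCoeffs (derivCoeff a) (deriv f) := by
  have key : ∀ z ∈ disc, DifferentiableAt ℂ f z ∧
      HasSum (fun n => derivCoeff a n * z ^ n) (deriv f z) := by
    intro z hz
    obtain ⟨r, hzr, hr⟩ := exists_between (mem_disc.1 hz)
    have hr0 : 0 < r := (norm_nonneg z).trans_lt hzr
    have hsum := h.converges r ⟨hr0.le, hr⟩
    have hU : IsOpen (Metric.ball (0 : ℂ) r) := Metric.isOpen_ball
    have hzU : z ∈ Metric.ball (0 : ℂ) r := by simpa using hzr
    have hd : ∀ n, DifferentiableOn ℂ (fun w => a n * w ^ n) (Metric.ball (0 : ℂ) r) :=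
      fun n => by fun_prop
    have hb : ∀ (n : ℕ), ∀ w ∈ Metric.ball (0 : ℂ) r, ‖a n * w ^ n‖ ≤ ‖a n‖ * r ^ n := by
      intro n w hw
      rw [norm_mul, norm_pow]
      gcongr
      exact (by simpa using hw : ‖w‖ < r).le
    have heq : (fun w => ∑' n, a n * w ^ n) =ᶠ[𝓝 z] f := by
      filter_upwards [hU.mem_nhds hzU] with w hw
      refine (h w ?_).tsum_eq
      exact mem_disc.2 ((by simpa using hw : ‖w‖ < r).trans hr)
    refine ⟨((differentiableOn_tsum_of_summable_norm hsum hd hU hb).differentiableAt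
      (hU.mem_nhds hzU)).congr_of_eventuallyEq heq.symm, ?_⟩
    have h2 := hasSum_deriv_of_summable_norm hsum hd hU hb hzU
    rw [heq.deriv_eq] at h2
    rw [← hasSum_nat_add_iff' 1] at h2
    have e1 : ∑ i ∈ Finset.range 1, deriv (fun w => a i * w ^ i) z = 0 := by simp
    have e2 : ∀ n : ℕ, deriv (fun w => a (n + 1) * w ^ (n + 1)) z = derivCoeff a n * z ^ n := by
      intro n
      rw [deriv_const_mul_field, deriv_pow_field, derivCoeff, Nat.add_sub_cancel]
      push_cast
      ring
    rw [e1, sub_zero] at h2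
    simpa only [e2] using h2
  exact ⟨fun z hz => (key z hz).1.differentiableWithinAt, fun z hz => (key z hz).2⟩

lemma HasCoeffs.differentiableOn {a : ℕ → ℂ} {f : ℂ → ℂ} (h : HasCoeffs a f) :
    DifferentiableOn ℂ f disc := h.differentiableOn_and_deriv.1

lemma HasCoeffs.deriv {a : ℕ → ℂ} {f : ℂ → ℂ} (h : HasCoeffs a f) :
    HasCoeffs (derivCoeff a) (deriv f) := h.differentiableOn_and_deriv.2

lemma HasCoeffs.apply_zero {a : ℕ → ℂ} {f : ℂ → ℂ} (h : HasCoeffs a f) : f 0 = a 0 := by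
  have h1 := h 0 (by simp [disc])
  have h2 := hasSum_single (f := fun n => a n * (0 : ℂ) ^ n) 0 fun n hn => by simp [hn]
  simpa using h1.unique h2

/-- The constant term is the value at 0, and differentiation shifts the coefficients, so induction
over all pairs (a, f) gives uniqueness. -/
lemma HasCoeffs.eq_coeff {a : ℕ → ℂ} {f : ℂ → ℂ} (h : HasCoeffs a f) (n : ℕ) :
    a n = coeff f n := by
  induction n generalizing a f with
  | zero => simp [coeff, h.apply_zero]
  | succ n ih =>
    have h1 := ih h.deriv
    have h2 : ((n : ℂ) + 1) ≠ 0 := by exact_mod_cast n.succ_ne_zero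
    have h3 : ((n.factorial : ℕ) : ℂ) ≠ 0 := by exact_mod_cast n.factorial_ne_zero
    simp only [coeff, derivCoeff] at h1
    simp only [coeff]
    rw [iteratedDeriv_succ', Nat.factorial_succ]
    push_cast
    rw [mul_inv, mul_assoc, ← h1]
    field_simp

/-- Cauchy's estimate. -/
lemma HasCoeffs.norm_le {a : ℕ → ℂ} {f : ℂ → ℂ} (h : HasCoeffs a f) {r : ℝ}
    (hr : r ∈ Set.Ioo (0 : ℝ) 1) {C : ℝ} (hC : ∀ z, ‖z‖ = r → ‖f z‖ ≤ C) (n : ℕ) :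
    ‖a n‖ * r ^ n ≤ C := by
  have hsub : closure (Metric.ball (0 : ℂ) r) ⊆ disc := by
    refine Metric.closure_ball_subset_closedBall.trans fun z hz => ?_
    exact mem_disc.2 ((by simpa using hz : ‖z‖ ≤ r).trans_lt hr.2)
  have h1 := norm_iteratedDeriv_le_of_forall_mem_sphere_norm_le n hr.1
    (h.differentiableOn.mono hsub).diffContOnCl fun z hz => hC z (by simpa using hz)
  have hn : (0 : ℝ) < n.factorial := by exact_mod_cast n.factorial_pos
  rw [le_div_iff₀ (pow_pos hr.1 n)] at h1
  rw [h.eq_coeff n, coeff, norm_mul, norm_inv, Complex.norm_natCast, mul_assoc,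
    inv_mul_le_iff₀ hn]
  exact h1

lemma HasCoeffs.dilate {a : ℕ → ℂ} {f : ℂ → ℂ} (h : HasCoeffs a f) {r : ℝ}
    (hr : r ∈ Set.Icc (0 : ℝ) 1) : HasCoeffs (fun n => a n * (r : ℂ) ^ n) fun z => f (r * z) := by
  intro z hz
  have hz' : (r : ℂ) * z ∈ disc := by
    rw [mem_disc] at hz ⊢
    rw [norm_mul, Complex.norm_real, Real.norm_of_nonneg hr.1]
    exact (mul_le_of_le_one_left (norm_nonneg z) hr.2).trans_lt hz
  refine (h _ hz').congr_fun ?_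
  intro n
  simp only [mul_pow, mul_assoc]

/-- The holomorphic function with given coefficients. -/
def ofSeries (a : ℕ → ℂ) (h : Converges a) : holo :=
  ⟨sumSeries a, h.hasCoeffs.differentiableOn, fun _ hz => sumSeries_of_notMem hz⟩

lemma holo.hasCoeffs (f : holo) : HasCoeffs (coeff f) f := hasCoeffs_coeff f.2.1

lemma holo.ext_of_hasCoeffs {f g : holo} {a : ℕ → ℂ} (hf : HasCoeffs a f) (hg : HasCoeffs a g) :
    f = g := by
  refine Subtype.ext (funext fun z => ?_)
  by_cases hz : z ∈ disc
  · exact (hf z hz).unique (hg z hz)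
  · rw [f.2.2 z hz, g.2.2 z hz]

lemma hasCoeffs_monomial (k : ℕ) : HasCoeffs (Pi.single k 1) fun z => z ^ k := by
  intro z _
  have := hasSum_single (f := fun n => (Pi.single k 1 : ℕ → ℂ) n * z ^ n) k fun n hn => by
    simp [hn]
  simpa using this

lemma HasCoeffs.congr {a : ℕ → ℂ} {f g : ℂ → ℂ} (h : HasCoeffs a f) (hfg : ∀ z ∈ disc, f z = g z) :
    HasCoeffs a g := fun z hz => hfg z hz ▸ h z hz

/-- The monomials as holomorphic functions in the disc. -/
def monomial (k : ℕ) : holo :=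
  ofSeries (Pi.single k 1) (hasCoeffs_monomial k).converges

lemma monomial_apply (k : ℕ) {z : ℂ} (hz : z ∈ disc) : (monomial k : ℂ → ℂ) z = z ^ k :=
  ((hasCoeffs_monomial k).converges.hasCoeffs z hz).unique (hasCoeffs_monomial k z hz)

lemma aestronglyMeasurable_of_continuousOn {f : ℂ → ℂ} (hf : ContinuousOn f disc) :
    AEStronglyMeasurable f (weightMeasure ω) := by
  have h1 : AEStronglyMeasurable f area :=
    (hf.aestronglyMeasurable measurableSet_disc).mono_ac Measure.smul_absolutelyContinuous
  exact h1.mono_ac (weightMeasure_absolutelyContinuous ω)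

lemma HasCoeffs.aestronglyMeasurable {a : ℕ → ℂ} {f : ℂ → ℂ} (h : HasCoeffs a f) :
    AEStronglyMeasurable f (weightMeasure ω) :=
  aestronglyMeasurable_of_continuousOn h.differentiableOn.continuousOn

/-- Positivity of every tail keeps the moments from decaying geometrically, so 1 / m_{2n} grows more
slowly than any geometric sequence of ratio above 1. Doubling is not needed. -/
lemma IsRadialWeight.converges_div_moment (hω : IsRadialWeight ω) {b : ℕ → ℂ} {B : ℝ}
    (hb : ∀ n, ‖b n‖ ≤ B) : Converges fun n => b n / (moment ω (2 * n) : ℂ) := by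
  intro r hr
  obtain ⟨s, hrs, hs⟩ := exists_between hr.2
  have hs0 : 0 < s := hr.1.trans_lt hrs
  obtain ⟨q, hsq, hq⟩ := exists_between hs
  have hq0 : 0 < q := hs0.trans hsq
  -- The moments have index 2n, and t^(2n) = q^n.
  set t := Real.sqrt q with ht
  have ht0 : 0 < t := Real.sqrt_pos.2 hq0
  have htq : t ^ 2 = q := Real.sq_sqrt hq0.le
  have ht1 : t < 1 := by nlinarith
  obtain ⟨c, hc, hcm⟩ := hω.exists_pow_le_moment ⟨ht0, ht1⟩
  have hB : 0 ≤ B := (norm_nonneg _).trans (hb 0)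
  have hrq : r < q := hrs.trans hsq
  have hgeo := summable_geometric_of_lt_one (div_nonneg hr.1 hq0.le) ((div_lt_one hq0).2 hrq)
  refine Summable.of_nonneg_of_le (fun n => by have := hr.1; positivity) (fun n => ?_)
    (hgeo.mul_left (B / c))
  have hm := hω.moment_pos (2 * n)
  have h1 := hcm (2 * n)
  rw [pow_mul, htq] at h1
  rw [norm_div, Complex.norm_real, Real.norm_of_nonneg hm.le]
  calc ‖b n‖ / moment ω (2 * n) * r ^ n ≤ B / (c * q ^ n) * r ^ n := by
        gcongr
        · exact pow_nonneg hr.1 n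
        · exact hb n
    _ = B / c * (r / q) ^ n := by rw [div_pow]; field_simp

/-! ### Orthogonality -/

/-- `φ` is homogeneous of degree `k` under rotations. -/
def RotationHomogeneous (k : ℕ) (φ : ℂ → ℂ) : Prop :=
  ∀ u z : ℂ, ‖u‖ = 1 → φ (u * z) = u ^ k * φ z

lemma rotationHomogeneous_pow (k : ℕ) : RotationHomogeneous k fun z => z ^ k :=
  fun _ _ _ => mul_pow _ _ _

lemma RotationHomogeneous.indicator {k : ℕ} {φ : ℂ → ℂ} (hφ : RotationHomogeneous k φ)
    (S : Set ℝ) : RotationHomogeneous k ({z | ‖z‖ ∈ S}.indicator φ) := by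
  intro u z hu
  by_cases h : ‖z‖ ∈ S
  · rw [Set.indicator_of_mem (by simpa [hu] using h), Set.indicator_of_mem (by simpa using h),
      hφ u z hu]
  · rw [Set.indicator_of_notMem (by simpa [hu] using h),
      Set.indicator_of_notMem (by simpa using h), mul_zero]

lemma measurableSet_norm_mem {S : Set ℝ} (hS : MeasurableSet S) :
    MeasurableSet {z : ℂ | ‖z‖ ∈ S} := measurable_norm hS

/-- A rotation by π/(k-n) multiplies the integrand by -1, so the integral equals its own negative.
Integrability is not required. -/
lemma RotationHomogeneous.integral_eq_zero {k n : ℕ} {φ : ℂ → ℂ} (hφ : RotationHomogeneous k φ)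
    (hn : n ≠ k) : ∫ z, φ z * conj (z ^ n) ∂(weightMeasure ω) = 0 := by
  set θ : ℝ := Real.pi / ((k : ℝ) - n) with hθ
  set u : ℂ := Complex.exp (θ * I) with hu
  have hu1 : ‖u‖ = 1 := Complex.norm_exp_ofReal_mul_I θ
  have hkn : (k : ℂ) - n ≠ 0 := sub_ne_zero.2 (by exact_mod_cast hn.symm)
  have huk : u ^ k * conj u ^ n = -1 := by
    rw [hu, ← Complex.exp_conj, ← Complex.exp_nat_mul, ← Complex.exp_nat_mul, ← Complex.exp_add,
      ← Complex.exp_pi_mul_I]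
    congr 1
    simp only [map_mul, Complex.conj_ofReal, Complex.conj_I, hθ]
    push_cast
    field_simp
    ring
  have h := integral_rotate ω hu1 fun z => φ z * conj (z ^ n)
  have h2 : ∀ z, φ (u * z) * conj ((u * z) ^ n) = -1 * (φ z * conj (z ^ n)) := by
    intro z
    rw [hφ u z hu1, ← huk, mul_pow, map_mul, map_pow]
    ring
  simp_rw [h2] at h
  rw [integral_const_mul] at h
  have h3 : (2 : ℂ) * ∫ z, φ z * conj (z ^ n) ∂(weightMeasure ω) = 0 := by
    linear_combination -h
  simpa using h3

/-- The radii `1 - 1 / (j + 2)`. -/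
def radius (j : ℕ) : ℝ := 1 - 1 / ((j : ℝ) + 2)

lemma radius_mem (j : ℕ) : radius j ∈ Set.Ioo (0 : ℝ) 1 := by
  have h : (0 : ℝ) < (j : ℝ) + 2 := by positivity
  have h1 : 1 / ((j : ℝ) + 2) < 1 := by
    rw [div_lt_one h]
    have : (0 : ℝ) ≤ j := j.cast_nonneg
    linarith
  have h2 : 0 < 1 / ((j : ℝ) + 2) := by positivity
  unfold radius
  constructor <;> linarith

lemma tendsto_radius : Tendsto radius atTop (𝓝 1) := by
  have h : Tendsto (fun j : ℕ => 1 / ((j : ℝ) + 2)) atTop (𝓝 0) :=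
    tendsto_const_nhds.div_atTop (tendsto_natCast_atTop_atTop.atTop_add tendsto_const_nhds)
  have h1 := h.const_sub 1
  rw [sub_zero] at h1
  exact h1

lemma eventually_le_radius {x : ℝ} (hx : x < 1) : ∀ᶠ j in atTop, x ≤ radius j :=
  (tendsto_radius.eventually (lt_mem_nhds hx)).mono fun _ h => h.le

lemma tendsto_integral_indicator_radius {E : Type*} [NormedAddCommGroup E] [NormedSpace ℝ E]
    {F : ℂ → E} (hF : Integrable F (weightMeasure ω)) :
    Tendsto (fun j => ∫ z, {z : ℂ | ‖z‖ ∈ Set.Iic (radius j)}.indicator F z ∂(weightMeasure ω))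
      atTop (𝓝 (∫ z, F z ∂(weightMeasure ω))) := by
  refine tendsto_integral_of_dominated_convergence (fun z => ‖F z‖)
    (fun j => hF.aestronglyMeasurable.indicator (measurableSet_norm_mem measurableSet_Iic))
    hF.norm (fun j => ae_of_all _ fun z => norm_indicator_le_norm_self F z) ?_
  filter_upwards [ae_norm_lt_one ω] with z hz
  refine tendsto_const_nhds.congr' ?_
  filter_upwards [eventually_le_radius hz] with j hj
  rw [Set.indicator_of_mem (by simpa using hj)]

/-- Integration against a conjugate holomorphic function picks out one coefficient. -/
lemma RotationHomogeneous.integral_mul_conj (hω : IsRadialWeight ω) {k : ℕ} {φ : ℂ → ℂ}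
    (hφ : RotationHomogeneous k φ) (hm : AEStronglyMeasurable φ (weightMeasure ω)) {B : ℝ}
    (hB : ∀ z ∈ disc, ‖φ z‖ ≤ B) {a : ℕ → ℂ} {g : ℂ → ℂ} (hg : HasCoeffs a g)
    (hgi : Integrable g (weightMeasure ω)) :
    Integrable (fun z => φ z * conj (g z)) (weightMeasure ω) ∧
    ∫ z, φ z * conj (g z) ∂(weightMeasure ω) =
      conj (a k) * ∫ z, φ z * conj (z ^ k) ∂(weightMeasure ω) := by
  have hconj : Integrable (fun z => conj (g z)) (weightMeasure ω) :=
    (Complex.conjLIE.integrable_comp_iff).2 hgi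
  have hint : Integrable (fun z => φ z * conj (g z)) (weightMeasure ω) :=
    hconj.bdd_mul (c := B) hm ((ae_mem_disc ω).mono hB)
  refine ⟨hint, ?_⟩
  have hint2 : Integrable (fun z => φ z * conj (z ^ k)) (weightMeasure ω) := by
    refine hω.integrable_of_bound (hm.mul (by fun_prop)) B fun z hz => ?_
    rw [norm_mul, RCLike.norm_conj, norm_pow]
    exact (mul_le_of_le_one_right (norm_nonneg _)
      (pow_le_one₀ (norm_nonneg z) (mem_disc.1 hz).le)).trans (hB z hz)
  -- On |z| ≤ `radius j` < 1 the series of g may be integrated term by term, and the truncated φ is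
  -- still homogeneous, so only the k-th term survives. Then j → ∞.
  refine tendsto_nhds_unique (tendsto_integral_indicator_radius hint) ?_
  refine ((tendsto_integral_indicator_radius hint2).const_mul (conj (a k))).congr fun j => ?_
  have hr := radius_mem j
  set A : Set ℂ := {z : ℂ | ‖z‖ ∈ Set.Iic (radius j)} with hA
  have hAm : MeasurableSet A := measurableSet_norm_mem measurableSet_Iic
  have hφA : RotationHomogeneous k (A.indicator φ) := hφ.indicator _
  have hB0 : 0 ≤ B := (norm_nonneg _).trans (hB 0 (by simp [disc]))
  let F : ℕ → ℂ → ℂ := fun n z => conj (a n) * (A.indicator φ z * conj (z ^ n))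
  have hFb : ∀ n, ∀ z ∈ disc, ‖F n z‖ ≤ B * (‖a n‖ * radius j ^ n) := by
    intro n z hz
    simp only [F]
    rw [norm_mul, norm_mul, RCLike.norm_conj, RCLike.norm_conj, norm_pow]
    by_cases hzA : z ∈ A
    · rw [Set.indicator_of_mem hzA]
      have h1 : ‖z‖ ^ n ≤ radius j ^ n := pow_le_pow_left₀ (norm_nonneg z) (by simpa [hA] using hzA) n
      calc ‖a n‖ * (‖φ z‖ * ‖z‖ ^ n) ≤ ‖a n‖ * (B * radius j ^ n) := by
            gcongr
            exact hB z hz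
        _ = _ := by ring
    · rw [Set.indicator_of_notMem hzA]
      have := pow_nonneg hr.1.le n
      simp only [norm_zero, zero_mul, mul_zero]
      positivity
  have hFm : ∀ n, AEStronglyMeasurable (F n) (weightMeasure ω) := fun n =>
    ((hm.indicator hAm).mul (by fun_prop)).const_mul _
  have hFi : ∀ n, Integrable (F n) (weightMeasure ω) := fun n =>
    hω.integrable_of_bound (hFm n) _ (hFb n)
  have hfin := hω.isFiniteMeasure
  have hsum : Summable fun n => ∫ z, ‖F n z‖ ∂(weightMeasure ω) := by
    refine Summable.of_nonneg_of_le (fun n => integral_nonneg fun z => norm_nonneg _)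
      (fun n => ?_) (((hg.converges _ ⟨hr.1.le, hr.2⟩).mul_left B).mul_right
        ((weightMeasure ω).real Set.univ))
    refine (integral_mono_ae (hFi n).norm (integrable_const (B * (‖a n‖ * radius j ^ n)))
      ((ae_mem_disc ω).mono (hFb n))).trans (le_of_eq ?_)
    rw [integral_const, smul_eq_mul, mul_comm]
  have h1 := hasSum_integral_of_summable_integral_norm hFi hsum
  have h2 : ∫ z, ∑' n, F n z ∂(weightMeasure ω) =
      ∫ z, A.indicator (fun z => φ z * conj (g z)) z ∂(weightMeasure ω) := by
    refine integral_congr_ae ?_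
    filter_upwards [ae_mem_disc ω] with z hz
    have h3 : HasSum (fun n => conj (a n * z ^ n)) (conj (g z)) :=
      (hg z hz).map (starRingEnd ℂ) Complex.continuous_conj
    have h4 := h3.mul_left (A.indicator φ z)
    have h5 : ∑' n, F n z = A.indicator φ z * conj (g z) := by
      rw [← h4.tsum_eq]
      refine tsum_congr fun n => ?_
      simp only [F, map_mul]
      ring
    rw [h5]
    by_cases hzA : z ∈ A <;> simp [hzA]
  rw [h2] at h1
  have h6 : HasSum (fun n => ∫ z, F n z ∂(weightMeasure ω)) (∫ z, F k z ∂(weightMeasure ω)) := by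
    refine hasSum_single k fun n hn => ?_
    simp only [F]
    rw [integral_const_mul, hφA.integral_eq_zero hn, mul_zero]
  rw [h1.unique h6]
  simp only [F]
  rw [integral_const_mul]
  congr 2
  ext z
  by_cases hzA : z ∈ A <;> simp [hzA]

lemma integral_pow_mul_conj_pow (ω : ℝ → ℝ) (k : ℕ) :
    ∫ z, z ^ k * conj (z ^ k) ∂(weightMeasure ω) = (moment ω (2 * k) : ℂ) := by
  rw [moment, ← integral_complex_ofReal]
  refine integral_congr_ae (ae_of_all _ fun z => ?_)
  simp only
  rw [Complex.mul_conj, Complex.normSq_eq_norm_sq, norm_pow, ← pow_mul, mul_comm k 2]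

/-- Integration of a monomial against a conjugate holomorphic function. -/
lemma HasCoeffs.integral_pow_mul_conj (hω : IsRadialWeight ω) {a : ℕ → ℂ} {g : ℂ → ℂ}
    (hg : HasCoeffs a g) (hgi : Integrable g (weightMeasure ω)) (k : ℕ) :
    ∫ z, z ^ k * conj (g z) ∂(weightMeasure ω) = conj (a k) * moment ω (2 * k) := by
  rw [((rotationHomogeneous_pow k).integral_mul_conj hω (by fun_prop) (B := 1) (fun z hz => ?_)
    hg hgi).2, integral_pow_mul_conj_pow]
  rw [norm_pow]
  exact pow_le_one₀ (norm_nonneg z) (mem_disc.1 hz).le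

/-- The unimodular functions `(z / |z|)^k`. -/
def phasePow (k : ℕ) (z : ℂ) : ℂ := (z / ‖z‖) ^ k

lemma rotationHomogeneous_phasePow (k : ℕ) : RotationHomogeneous k (phasePow k) := by
  intro u z hu
  simp only [phasePow, norm_mul, hu, one_mul, mul_div_assoc, mul_pow]

lemma measurable_phasePow (k : ℕ) : Measurable (phasePow k) := by
  unfold phasePow
  fun_prop

lemma norm_phasePow_le (k : ℕ) (z : ℂ) : ‖phasePow k z‖ ≤ 1 := by
  rw [phasePow, norm_pow, norm_div, Complex.norm_real, norm_norm]
  exact pow_le_one₀ (by positivity) (div_self_le_one _)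

lemma integral_phasePow_mul_conj_pow (ω : ℝ → ℝ) (k : ℕ) :
    ∫ z, phasePow k z * conj (z ^ k) ∂(weightMeasure ω) = (moment ω k : ℂ) := by
  rw [moment, ← integral_complex_ofReal]
  refine integral_congr_ae (ae_of_all _ fun z => ?_)
  simp only [phasePow]
  rw [map_pow, ← mul_pow, div_mul_eq_mul_div, Complex.mul_conj, Complex.normSq_eq_norm_sq]
  push_cast
  -- At the origin the quotient 0/0 is 0 by convention, which is the value |z| required there.
  by_cases h : (‖z‖ : ℂ) = 0
  · simp [h]
  · rw [pow_two, mul_div_assoc, div_self h, mul_one]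

lemma HasCoeffs.integral_phasePow_mul_conj (hω : IsRadialWeight ω) {a : ℕ → ℂ} {g : ℂ → ℂ}
    (hg : HasCoeffs a g) (hgi : Integrable g (weightMeasure ω)) (k : ℕ) :
    ∫ z, phasePow k z * conj (g z) ∂(weightMeasure ω) = conj (a k) * moment ω k := by
  rw [((rotationHomogeneous_phasePow k).integral_mul_conj hω
    (measurable_phasePow k).aestronglyMeasurable (B := 1) (fun z _ => norm_phasePow_le k z)
    hg hgi).2, integral_phasePow_mul_conj_pow]

/-- The coefficients of a function in `A^1_ω` are controlled by its norm. -/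
lemma HasCoeffs.norm_mul_moment_le (hω : IsRadialWeight ω) {a : ℕ → ℂ} {g : ℂ → ℂ}
    (hg : HasCoeffs a g) (hgi : Integrable g (weightMeasure ω)) (k : ℕ) :
    ‖a k‖ * moment ω k ≤ ∫ z, ‖g z‖ ∂(weightMeasure ω) := by
  have h := hg.integral_phasePow_mul_conj hω hgi k
  have h1 : ‖a k‖ * moment ω k = ‖∫ z, phasePow k z * conj (g z) ∂(weightMeasure ω)‖ := by
    rw [h, norm_mul, RCLike.norm_conj, Complex.norm_real,
      Real.norm_of_nonneg (hω.moment_pos k).le]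
  rw [h1]
  refine (norm_integral_le_integral_norm _).trans (integral_mono_of_nonneg
    (ae_of_all _ fun z => norm_nonneg _) hgi.norm (ae_of_all _ fun z => ?_))
  simp only [norm_mul, RCLike.norm_conj]
  exact mul_le_of_le_one_left (norm_nonneg _) (norm_phasePow_le k z)

/-- Integration of an absolutely convergent power series term by term. -/
lemma HasCoeffs.hasSum_integral_mul_conj {c : ℕ → ℂ} {F : ℂ → ℂ}
    (hF : HasCoeffs c F) (hc : Summable fun n => ‖c n‖) {g : ℂ → ℂ}
    (hg : Integrable g (weightMeasure ω)) :
    Integrable (fun z => F z * conj (g z)) (weightMeasure ω) ∧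
    HasSum (fun n => c n * ∫ z, z ^ n * conj (g z) ∂(weightMeasure ω))
      (∫ z, F z * conj (g z) ∂(weightMeasure ω)) := by
  have hconj : Integrable (fun z => conj (g z)) (weightMeasure ω) :=
    (Complex.conjLIE.integrable_comp_iff).2 hg
  have hpow : ∀ n : ℕ, ∀ z ∈ disc, ‖z ^ n‖ ≤ 1 := fun n z hz => by
    rw [norm_pow]
    exact pow_le_one₀ (norm_nonneg z) (mem_disc.1 hz).le
  have hFb : ∀ z ∈ disc, ‖F z‖ ≤ ∑' n, ‖c n‖ := by
    intro z hz
    rw [← (hF z hz).tsum_eq]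
    refine tsum_of_norm_bounded hc.hasSum fun n => ?_
    rw [norm_mul]
    exact mul_le_of_le_one_right (norm_nonneg _) (hpow n z hz)
  refine ⟨hconj.bdd_mul hF.aestronglyMeasurable ((ae_mem_disc ω).mono hFb), ?_⟩
  let T : ℕ → ℂ → ℂ := fun n z => c n * (z ^ n * conj (g z))
  have hTi : ∀ n, Integrable (T n) (weightMeasure ω) := fun n =>
    (hconj.bdd_mul (c := 1) (by fun_prop) ((ae_mem_disc ω).mono (hpow n))).const_mul _
  have hsum : Summable fun n => ∫ z, ‖T n z‖ ∂(weightMeasure ω) := by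
    refine Summable.of_nonneg_of_le (fun n => integral_nonneg fun z => norm_nonneg _)
      (fun n => ?_) (hc.mul_right (∫ z, ‖g z‖ ∂(weightMeasure ω)))
    rw [← integral_const_mul]
    refine integral_mono_ae (hTi n).norm (hg.norm.const_mul _) ?_
    filter_upwards [ae_mem_disc ω] with z hz
    simp only [T]
    rw [norm_mul, norm_mul, RCLike.norm_conj]
    gcongr
    exact mul_le_of_le_one_left (norm_nonneg _) (hpow n z hz)
  have h1 := hasSum_integral_of_summable_integral_norm hTi hsum
  have h2 : ∫ z, ∑' n, T n z ∂(weightMeasure ω) = ∫ z, F z * conj (g z) ∂(weightMeasure ω) := by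
    refine integral_congr_ae ?_
    filter_upwards [ae_mem_disc ω] with z hz
    rw [← ((hF z hz).mul_right (conj (g z))).tsum_eq]
    refine tsum_congr fun n => ?_
    simp only [T]
    ring
  rw [h2] at h1
  refine h1.congr_fun fun n => ?_
  simp only [T]
  rw [integral_const_mul]

/-! ### Partial sums -/

/-- The partial sums of a power series. -/
def partialSum (a : ℕ → ℂ) (N : ℕ) (z : ℂ) : ℂ := ∑ n ∈ Finset.range N, a n * z ^ n

lemma hasCoeffs_partialSum (a : ℕ → ℂ) (N : ℕ) :
    HasCoeffs (fun n => if n < N then a n else 0) (partialSum a N) := by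
  intro z _
  have h : HasSum (fun n => (if n < N then a n else 0) * z ^ n)
      (∑ n ∈ Finset.range N, (if n < N then a n else 0) * z ^ n) :=
    hasSum_sum_of_ne_finset_zero fun n hn => by
      rw [Finset.mem_range] at hn
      simp [hn]
  convert h using 1
  refine Finset.sum_congr rfl fun n hn => ?_
  rw [if_pos (Finset.mem_range.1 hn)]

lemma continuous_partialSum (a : ℕ → ℂ) (N : ℕ) : Continuous (partialSum a N) := by
  unfold partialSum
  fun_prop

lemma IsRadialWeight.integrable_of_continuous (hω : IsRadialWeight ω) {E : Type*}
    [NormedAddCommGroup E] [SecondCountableTopologyEither ℂ E] {f : ℂ → E} (hf : Continuous f) :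
    Integrable f (weightMeasure ω) := by
  obtain ⟨C, hC⟩ := (isCompact_closedBall (0 : ℂ) 1).exists_bound_of_continuousOn hf.continuousOn
  exact hω.integrable_of_bound hf.aestronglyMeasurable C
    fun z hz => hC z (Metric.ball_subset_closedBall hz)

/-- Pythagoras for the partial sums of a power series on a rotation invariant set. -/
lemma IsRadialWeight.setIntegral_norm_sq_partialSum (hω : IsRadialWeight ω) (a : ℕ → ℂ) (N : ℕ)
    {S : Set ℝ} (hS : MeasurableSet S) :
    ∫ z in {z : ℂ | ‖z‖ ∈ S}, ‖partialSum a N z‖ ^ 2 ∂(weightMeasure ω) =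
      ∑ n ∈ Finset.range N,
        ‖a n‖ ^ 2 * ∫ z in {z : ℂ | ‖z‖ ∈ S}, ‖z‖ ^ (2 * n) ∂(weightMeasure ω) := by
  set A : Set ℂ := {z : ℂ | ‖z‖ ∈ S} with hA
  have hAm : MeasurableSet A := measurableSet_norm_mem hS
  have hsq : ∀ w : ℂ, ((‖w‖ ^ 2 : ℝ) : ℂ) = w * conj w := fun w => by
    rw [Complex.mul_conj, Complex.normSq_eq_norm_sq]
  have hint : Integrable (partialSum a N) (weightMeasure ω) :=
    hω.integrable_of_continuous (continuous_partialSum a N)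
  have hφ : ∀ n, RotationHomogeneous n (A.indicator fun z => z ^ n) := fun n =>
    (rotationHomogeneous_pow n).indicator S
  have hcoef : ∀ n ∈ Finset.range N,
      ∫ z, A.indicator (fun z => z ^ n) z * conj (partialSum a N z) ∂(weightMeasure ω) =
        conj (a n) * ((∫ z in A, ‖z‖ ^ (2 * n) ∂(weightMeasure ω) : ℝ) : ℂ) := by
    intro n hn
    rw [((hφ n).integral_mul_conj hω
      ((by fun_prop : AEStronglyMeasurable (fun z : ℂ => z ^ n) (weightMeasure ω)).indicator hAm)
      (B := 1) (fun z hz => ?_) (hasCoeffs_partialSum a N) hint).2]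
    · rw [if_pos (Finset.mem_range.1 hn), ← integral_complex_ofReal, ← integral_indicator hAm]
      congr 2
      ext z
      by_cases hz : z ∈ A
      · simp only [Set.indicator_of_mem hz]
        rw [Complex.mul_conj, Complex.normSq_eq_norm_sq, norm_pow, ← pow_mul, mul_comm n 2]
      · simp [hz]
    · refine (norm_indicator_le_norm_self _ _).trans ?_
      rw [norm_pow]
      exact pow_le_one₀ (norm_nonneg z) (mem_disc.1 hz).le
  have hi : ∀ n ∈ Finset.range N, Integrable
      (fun z => a n * (A.indicator (fun z => z ^ n) z * conj (partialSum a N z)))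
      (weightMeasure ω) := by
    intro n _
    refine (((hφ n).integral_mul_conj hω
      ((by fun_prop : AEStronglyMeasurable (fun z : ℂ => z ^ n) (weightMeasure ω)).indicator hAm)
      (B := 1) (fun z hz => ?_) (hasCoeffs_partialSum a N) hint).1).const_mul _
    refine (norm_indicator_le_norm_self _ _).trans ?_
    rw [norm_pow]
    exact pow_le_one₀ (norm_nonneg z) (mem_disc.1 hz).le
  apply Complex.ofReal_injective
  rw [← integral_complex_ofReal, ← integral_indicator hAm]
  have h1 : ∀ z, A.indicator (fun z => ((‖partialSum a N z‖ ^ 2 : ℝ) : ℂ)) z =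
      ∑ n ∈ Finset.range N,
        a n * (A.indicator (fun z => z ^ n) z * conj (partialSum a N z)) := by
    intro z
    by_cases hz : z ∈ A
    · simp only [Set.indicator_of_mem hz]
      rw [hsq]
      -- Only the unconjugated factor is expanded; each monomial then selects one coefficient of the
      -- conjugated factor.
      nth_rewrite 1 [partialSum]
      rw [Finset.sum_mul]
      exact Finset.sum_congr rfl fun n _ => mul_assoc _ _ _
    · simp [hz]
  simp_rw [h1]
  rw [integral_finsetSum _ hi]
  push_cast
  refine Finset.sum_congr rfl fun n hn => ?_
  rw [integral_const_mul, hcoef n hn, ← mul_assoc, ← hsq]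
  push_cast
  rfl

/-! ### Doubling of the moments -/

/-- The doubling condition on the moments. -/
def MomentDoubling (ω : ℝ → ℝ) (K : ℝ) : Prop := ∀ n, moment ω n ≤ K * moment ω (2 * n)

lemma MomentDoubling.one_le (hω : IsRadialWeight ω) {K : ℝ} (hK : MomentDoubling ω K) :
    1 ≤ K := by
  have h := hK 0
  have h0 := hω.moment_pos 0
  simp only [mul_zero] at h
  by_contra hc
  nlinarith

lemma MomentDoubling.iterate (hω : IsRadialWeight ω) {K : ℝ} (hK : MomentDoubling ω K)
    (N i : ℕ) : moment ω N ≤ K ^ i * moment ω (2 ^ i * N) := by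
  have h1 := hK.one_le hω
  induction i with
  | zero => simp
  | succ i ih =>
    calc moment ω N ≤ K ^ i * moment ω (2 ^ i * N) := ih
      _ ≤ K ^ i * (K * moment ω (2 * (2 ^ i * N))) := by
        gcongr
        exact hK _
      _ = K ^ (i + 1) * moment ω (2 ^ (i + 1) * N) := by
        rw [← mul_assoc 2, ← pow_succ' 2 i]
        ring

/-- Iterated doubling loses at most a power of n/N + 1, which a slow exponential absorbs. The rate
1/8 is chosen for `MomentDoubling.exists_sum_le`: at index 2(n+1) and squared it becomes
exp((n+1)/(2N)), half the rate of the decay exp(-n/N) available there. -/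
lemma MomentDoubling.exists_le_exp (hω : IsRadialWeight ω) {K : ℝ} (hK : MomentDoubling ω K) :
    ∃ A, 0 < A ∧ ∀ N n : ℕ, 0 < N →
      moment ω N ≤ A * Real.exp ((n : ℝ) / (8 * N)) * moment ω n := by
  have h1 := hK.one_le hω
  -- With K < 2^β the loss K^i is at most (2^i)^β, a polynomial of degree β in 2^i ≤ 2q + 2.
  obtain ⟨β, hβ⟩ := pow_unbounded_of_one_lt K (one_lt_two)
  refine ⟨16 ^ β * β.factorial * Real.exp (1 / 8), by positivity, fun N n hN => ?_⟩
  set q := n / N with hq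
  set i := Nat.log 2 q + 1 with hi
  have hN' : (0 : ℝ) < N := by exact_mod_cast hN
  have hqi : n ≤ 2 ^ i * N := by
    have h2 : q < 2 ^ i := Nat.lt_pow_succ_log_self one_lt_two q
    have h3 : n < (q + 1) * N := by
      rw [hq, mul_comm]
      exact Nat.lt_mul_div_succ n hN
    exact h3.le.trans (Nat.mul_le_mul_right N h2)
  have h2i : (2 : ℝ) ^ i ≤ 2 * q + 2 := by
    have : 2 ^ i ≤ 2 * q + 2 := by
      rw [hi, pow_succ]
      rcases eq_or_ne q 0 with h0 | h0
      · simp [h0]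
      · have := Nat.pow_log_le_self 2 h0
        omega
    exact_mod_cast this
  have hqn : (q : ℝ) ≤ n / N := Nat.cast_div_le
  -- Scaled so that 2q + 2 = 16y while y ≤ 1/8 + n/(8N); then y^β ≤ β! e^y.
  set y : ℝ := ((q : ℝ) + 1) / 8 with hy
  have hy0 : 0 ≤ y := by positivity
  have hyx := Real.pow_div_factorial_le_exp y hy0 β
  have hf : (0 : ℝ) < β.factorial := by exact_mod_cast β.factorial_pos
  rw [div_le_iff₀ hf] at hyx
  have hKi : K ^ i ≤ 16 ^ β * β.factorial * Real.exp (1 / 8) * Real.exp ((n : ℝ) / (8 * N)) := by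
    calc K ^ i ≤ (2 ^ β) ^ i := pow_le_pow_left₀ (by linarith) hβ.le i
      _ = (2 ^ i) ^ β := by rw [← pow_mul, ← pow_mul, mul_comm]
      _ ≤ (2 * q + 2) ^ β := pow_le_pow_left₀ (by positivity) h2i β
      _ = 16 ^ β * y ^ β := by
        rw [← mul_pow, hy]
        congr 1
        ring
      _ ≤ 16 ^ β * (Real.exp y * β.factorial) := by gcongr
      _ ≤ 16 ^ β * (Real.exp (1 / 8 + (n : ℝ) / (8 * N)) * β.factorial) := by
        gcongr
        rw [hy]
        have : (n : ℝ) / (8 * N) = n / N / 8 := by field_simp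
        rw [this]
        linarith
      _ = _ := by rw [Real.exp_add]; ring
  calc moment ω N ≤ K ^ i * moment ω (2 ^ i * N) := hK.iterate hω N i
    _ ≤ K ^ i * moment ω n :=
      mul_le_mul_of_nonneg_left (hω.moment_anti hqi) (pow_nonneg (by linarith) i)
    _ ≤ _ := mul_le_mul_of_nonneg_right hKi (hω.moment_pos n).le

/-- For N ≥ 2 the power (1 - 1/N)^N is at least e^(-2), so |z|^N is bounded below on the annulus.
For N = 1 the radius is 0, the annulus is the whole plane, and a separate constant m_0/m_1 is used.
-/
lemma IsRadialWeight.exists_measureReal_le_moment (hω : IsRadialWeight ω) :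
    ∃ C, 0 < C ∧ ∀ N : ℕ, 0 < N →
      (weightMeasure ω).real {z | 1 - 1 / (N : ℝ) ≤ ‖z‖} ≤ C * moment ω N := by
  have hfin := hω.isFiniteMeasure
  have h0 := hω.moment_pos 0
  have h1 := hω.moment_pos 1
  refine ⟨max (Real.exp 2) (moment ω 0 / moment ω 1), by positivity, fun N hN => ?_⟩
  rcases Nat.lt_or_ge 1 N with h | h
  · obtain ⟨M, rfl⟩ : ∃ M, N = M + 2 := ⟨N - 2, by omega⟩
    have hr : (0 : ℝ) < 1 - 1 / ((M + 2 : ℕ) : ℝ) := by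
      push_cast
      rw [sub_pos, div_lt_one (by positivity)]
      linarith [M.cast_nonneg (α := ℝ)]
    have h2 := hω.measureReal_le_moment hr.le (M + 2)
    refine le_trans ?_ (mul_le_mul_of_nonneg_right (le_max_left _ _) (hω.moment_pos _).le)
    have h3 : 1 ≤ Real.exp 2 * (1 - 1 / ((M + 2 : ℕ) : ℝ)) ^ (M + 2) := by
      have h4 : 1 ≤ Real.exp (1 / ((M : ℝ) + 1)) * (1 - 1 / ((M + 2 : ℕ) : ℝ)) := by
        have h5 := Real.add_one_le_exp (1 / ((M : ℝ) + 1))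
        have h6 : 1 = (1 / ((M : ℝ) + 1) + 1) * (1 - 1 / ((M + 2 : ℕ) : ℝ)) := by
          push_cast
          field_simp
          ring
        exact h6.le.trans (mul_le_mul_of_nonneg_right h5 hr.le)
      have h7 := one_le_pow₀ (n := M + 2) h4
      rw [mul_pow, ← Real.exp_nat_mul] at h7
      refine h7.trans (mul_le_mul_of_nonneg_right (Real.exp_le_exp.2 ?_) (by positivity))
      push_cast
      rw [mul_one_div, div_le_iff₀ (by positivity)]
      linarith [M.cast_nonneg (α := ℝ)]
    calc _ ≤ (Real.exp 2 * (1 - 1 / ((M + 2 : ℕ) : ℝ)) ^ (M + 2)) *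
          (weightMeasure ω).real {z | 1 - 1 / ((M + 2 : ℕ) : ℝ) ≤ ‖z‖} :=
          le_mul_of_one_le_left measureReal_nonneg h3
      _ ≤ _ := by
        rw [mul_assoc]
        exact mul_le_mul_of_nonneg_left h2 (Real.exp_pos _).le
  · obtain rfl : N = 1 := by omega
    refine le_trans ?_ (mul_le_mul_of_nonneg_right (le_max_right _ _) h1.le)
    rw [div_mul_cancel₀ _ h1.ne', moment_zero]
    exact measureReal_mono (Set.subset_univ _)

/-- The increment of n / m_{2n} loses the factor n: it is (1 + n(m_{2n} - m_{2n+2}) / m_{2n}) /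
m_{2n+2}, and n(m_{2n} - m_{2n+2}) ≤ 2 m_n ≤ 2K m_{2n}. These increments are the coefficients of (1
- wz)H. -/
lemma MomentDoubling.increment_le (hω : IsRadialWeight ω) {K : ℝ} (hK : MomentDoubling ω K)
    (n : ℕ) : |((n : ℝ) + 1) / moment ω (2 * (n + 1)) - n / moment ω (2 * n)| ≤
      (1 + 2 * K) / moment ω (2 * (n + 1)) := by
  have h1 := hω.moment_pos (2 * n)
  have h2 := hω.moment_pos (2 * (n + 1))
  have h3 : moment ω (2 * (n + 1)) ≤ moment ω (2 * n) := hω.moment_anti (by omega)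
  have hn : (0 : ℝ) ≤ n := n.cast_nonneg
  -- One factor x^n is spent on n x^n (1-x) ≤ 1, which comes from the geometric sum; the other
  -- remains and yields m_n after integration.
  have hx : ∀ x : ℝ, 0 ≤ x → x ≤ 1 → n * (x ^ (2 * n) - x ^ (2 * (n + 1))) ≤ 2 * x ^ n := by
    intro x hx0 hx1
    have hb : n * (x ^ n * (1 - x)) ≤ 1 := by
      have hs := geom_sum_mul_neg x n
      have hle : n * x ^ n ≤ ∑ i ∈ Finset.range n, x ^ i := by
        have := Finset.card_nsmul_le_sum (Finset.range n) (fun i => x ^ i) (x ^ n)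
          fun i hi => pow_le_pow_of_le_one hx0 hx1 (Finset.mem_range.1 hi).le
        simpa using this
      have := mul_le_mul_of_nonneg_right hle (sub_nonneg.2 hx1)
      have hp := pow_nonneg hx0 n
      nlinarith
    have hp := pow_nonneg hx0 n
    have heq : n * (x ^ (2 * n) - x ^ (2 * (n + 1))) =
        (n * (x ^ n * (1 - x))) * (x ^ n * (1 + x)) := by ring
    rw [heq]
    calc _ ≤ 1 * (x ^ n * (1 + x)) :=
          mul_le_mul_of_nonneg_right hb (mul_nonneg hp (by linarith))
      _ ≤ _ := by nlinarith
  have h4 : n * (moment ω (2 * n) - moment ω (2 * (n + 1))) ≤ 2 * moment ω n := by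
    unfold moment
    rw [← integral_sub (hω.integrable_norm_pow _) (hω.integrable_norm_pow _),
      ← integral_const_mul, ← integral_const_mul]
    refine integral_mono_ae (((hω.integrable_norm_pow _).sub (hω.integrable_norm_pow _)).const_mul _)
      ((hω.integrable_norm_pow _).const_mul _) ?_
    filter_upwards [ae_norm_lt_one ω] with z hz
    exact hx ‖z‖ (norm_nonneg z) hz.le
  have h5 := hK n
  have heq : ((n : ℝ) + 1) / moment ω (2 * (n + 1)) - n / moment ω (2 * n) =
      (1 + n * (moment ω (2 * n) - moment ω (2 * (n + 1))) / moment ω (2 * n)) /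
        moment ω (2 * (n + 1)) := by
    field_simp
    ring
  have h6 : 0 ≤ n * (moment ω (2 * n) - moment ω (2 * (n + 1))) / moment ω (2 * n) :=
    div_nonneg (mul_nonneg hn (sub_nonneg.2 h3)) h1.le
  rw [heq, abs_of_nonneg (by positivity)]
  gcongr
  rw [div_le_iff₀ h1]
  linarith

/-- Geometric series with ratio e^(-x), x = 1/(2N) ≤ 1: since 1 - e^(-x) ≥ x/2, the sum is at most
2/x = 4N. -/
lemma sum_exp_neg_le {N : ℕ} (hN : 0 < N) (M : ℕ) :
    ∑ n ∈ Finset.range M, Real.exp (-((n : ℝ) / (2 * N))) ≤ 4 * N := by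
  have hN' : (1 : ℝ) ≤ N := by exact_mod_cast hN
  set x : ℝ := 1 / (2 * N) with hx
  have hx0 : 0 < x := by positivity
  have hx1 : x ≤ 1 := by
    rw [hx, div_le_one (by positivity)]
    linarith
  have h1 : ∀ n : ℕ, Real.exp (-((n : ℝ) / (2 * N))) = Real.exp (-x) ^ n := by
    intro n
    rw [← Real.exp_nat_mul, hx]
    congr 1
    ring
  simp_rw [h1]
  have hq1 : Real.exp (-x) < 1 := by
    rw [Real.exp_lt_one_iff]
    linarith
  have h2 : ∑ n ∈ Finset.range M, Real.exp (-x) ^ n ≤ (1 - Real.exp (-x))⁻¹ := by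
    rw [← tsum_geometric_of_lt_one (Real.exp_pos _).le hq1]
    exact (summable_geometric_of_lt_one (Real.exp_pos _).le hq1).sum_le_tsum _
      fun n _ => by positivity
  refine h2.trans ?_
  rw [inv_le_comm₀ (by linarith) (by positivity)]
  have h3 : Real.exp (-x) ≤ 1 / (1 + x) := by
    rw [Real.exp_neg, one_div]
    gcongr
    linarith [Real.add_one_le_exp x]
  have h4 : 1 / (1 + x) ≤ 1 - x / 2 := by
    rw [div_le_iff₀ (by linarith)]
    nlinarith
  have h5 : (4 * (N : ℝ))⁻¹ = x / 2 := by
    rw [hx]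
    field_simp
    norm_num
  rw [h5]
  linarith

lemma pow_le_exp_of_le {N : ℕ} (hN : 0 < N) {s : ℝ} (hs0 : 0 ≤ s) (hs : s ≤ 1 - 1 / (2 * (N : ℝ)))
    (n : ℕ) : s ^ (2 * n) ≤ Real.exp (-((n : ℝ) / N)) := by
  have hN' : (0 : ℝ) < N := by exact_mod_cast hN
  have h1 : s ≤ Real.exp (-(1 / (2 * (N : ℝ)))) := by
    have := Real.add_one_le_exp (-(1 / (2 * (N : ℝ))))
    linarith
  refine (pow_le_pow_left₀ hs0 h1 _).trans (le_of_eq ?_)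
  rw [← Real.exp_nat_mul]
  congr 1
  push_cast
  field_simp

lemma sum_pow_le {N : ℕ} (hN : 0 < N) {s : ℝ} (hs0 : 0 ≤ s) (hs : s ≤ 1 - 1 / (2 * (N : ℝ)))
    (M : ℕ) : ∑ n ∈ Finset.range M, s ^ (2 * n) ≤ 4 * N := by
  have hN' : (0 : ℝ) < N := by exact_mod_cast hN
  refine le_trans (Finset.sum_le_sum fun n _ => ?_) (sum_exp_neg_le hN M)
  refine (pow_le_exp_of_le hN hs0 hs n).trans (Real.exp_le_exp.2 (neg_le_neg ?_))
  have : (0 : ℝ) ≤ n := n.cast_nonneg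
  gcongr
  linarith

/-- The decay s^(2n) ≤ exp(-n/N) beats the growth of 1/m_{2n+2}^2, which is at most a constant times
exp((n+1)/(2N)) / m_N^2. What remains is exp(-n/(2N)), with sum at most 4N. -/
lemma MomentDoubling.exists_sum_le (hω : IsRadialWeight ω) {K : ℝ} (hK : MomentDoubling ω K) :
    ∃ C, 0 < C ∧ ∀ N : ℕ, 0 < N → ∀ s : ℝ, 0 ≤ s → s ≤ 1 - 1 / (2 * (N : ℝ)) → ∀ M : ℕ,
      ∑ n ∈ Finset.range M, s ^ (2 * n) / moment ω (2 * (n + 1)) ^ 2 ≤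
        C * N / moment ω N ^ 2 := by
  obtain ⟨A, hA, h⟩ := hK.exists_le_exp hω
  refine ⟨4 * (A ^ 2 * Real.exp 1), by positivity, fun N hN s hs0 hs M => ?_⟩
  have hN' : (1 : ℝ) ≤ N := by exact_mod_cast hN
  have hm := hω.moment_pos N
  have key : ∀ n : ℕ, s ^ (2 * n) / moment ω (2 * (n + 1)) ^ 2 ≤
      A ^ 2 * Real.exp 1 / moment ω N ^ 2 * Real.exp (-((n : ℝ) / (2 * N))) := by
    intro n
    have hm2 := hω.moment_pos (2 * (n + 1))
    have h1 := h N (2 * (n + 1)) hN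
    have h2 : moment ω N ^ 2 ≤
        A ^ 2 * Real.exp (((n : ℝ) + 1) / (2 * N)) * moment ω (2 * (n + 1)) ^ 2 := by
      refine (pow_le_pow_left₀ hm.le h1 2).trans (le_of_eq ?_)
      rw [mul_pow, mul_pow, ← Real.exp_nat_mul]
      congr 3
      push_cast
      field_simp
      norm_num
    have h3 : Real.exp (((n : ℝ) + 1) / (2 * N)) ≤ Real.exp 1 * Real.exp ((n : ℝ) / (2 * N)) := by
      rw [← Real.exp_add]
      refine Real.exp_le_exp.2 ?_
      rw [add_div]
      have : 1 / (2 * (N : ℝ)) ≤ 1 := by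
        rw [div_le_one (by positivity)]
        linarith
      linarith
    have h4 := pow_le_exp_of_le hN hs0 hs n
    rw [div_le_iff₀ (by positivity), div_mul_eq_mul_div, div_mul_eq_mul_div,
      le_div_iff₀ (by positivity)]
    have h5 : Real.exp (-((n : ℝ) / N)) * Real.exp ((n : ℝ) / (2 * N)) =
        Real.exp (-((n : ℝ) / (2 * N))) := by
      rw [← Real.exp_add]
      congr 1
      field_simp
      ring
    calc s ^ (2 * n) * moment ω N ^ 2
        ≤ Real.exp (-((n : ℝ) / N)) * (A ^ 2 * (Real.exp 1 * Real.exp ((n : ℝ) / (2 * N))) *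
            moment ω (2 * (n + 1)) ^ 2) := by
          gcongr
          refine h2.trans ?_
          gcongr
      _ = A ^ 2 * Real.exp 1 * (Real.exp (-((n : ℝ) / N)) * Real.exp ((n : ℝ) / (2 * N))) *
            moment ω (2 * (n + 1)) ^ 2 := by ring
      _ = _ := by rw [h5]
  refine (Finset.sum_le_sum fun n _ => key n).trans ?_
  rw [← Finset.mul_sum]
  refine (mul_le_mul_of_nonneg_left (sum_exp_neg_le hN M) (by positivity)).trans (le_of_eq ?_)
  field_simp

/-! ### The norm of the derivative of the kernel -/

lemma HasCoeffs.lintegral_le_liminf {a : ℕ → ℂ} {F : ℂ → ℂ} (hF : HasCoeffs a F) (p : ℕ)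
    (A : Set ℂ) : ∫⁻ z in A, ‖F z‖ₑ ^ p ∂(weightMeasure ω) ≤
      liminf (fun N => ∫⁻ z in A, ‖partialSum a N z‖ₑ ^ p ∂(weightMeasure ω)) atTop := by
  have h1 : ∫⁻ z in A, ‖F z‖ₑ ^ p ∂(weightMeasure ω) =
      ∫⁻ z in A, liminf (fun N => ‖partialSum a N z‖ₑ ^ p) atTop ∂(weightMeasure ω) := by
    refine lintegral_congr_ae ?_
    filter_upwards [ae_restrict_of_ae (ae_mem_disc ω)] with z hz
    have h2 : Tendsto (fun N => ‖partialSum a N z‖ₑ ^ p) atTop (𝓝 (‖F z‖ₑ ^ p)) :=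
      ((ENNReal.continuous_pow p).comp continuous_enorm).continuousAt.tendsto.comp
        (hF z hz).tendsto_sum_nat
    exact h2.liminf_eq.symm
  rw [h1]
  refine lintegral_liminf_le fun N => ?_
  have := (continuous_partialSum a N).measurable
  fun_prop

/-- Parseval for the partial sums, with |z| replaced by its upper bound t on the set, and Fatou for
the limit. Working with partial sums avoids assuming F square integrable. -/
lemma HasCoeffs.setLIntegral_sq_le (hω : IsRadialWeight ω) {a : ℕ → ℂ} {F : ℂ → ℂ}
    (hF : HasCoeffs a F) {S : Set ℝ} (hS : MeasurableSet S) {t B : ℝ} (ht : ∀ x ∈ S, x ≤ t)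
    (hB : ∀ M, ∑ n ∈ Finset.range M, ‖a n‖ ^ 2 * t ^ (2 * n) ≤ B) :
    ∫⁻ z in {z : ℂ | ‖z‖ ∈ S}, ‖F z‖ₑ ^ 2 ∂(weightMeasure ω) ≤
      ENNReal.ofReal B * weightMeasure ω {z : ℂ | ‖z‖ ∈ S} := by
  have hfin := hω.isFiniteMeasure
  refine (hF.lintegral_le_liminf 2 _).trans ?_
  refine liminf_le_of_frequently_le' (Frequently.of_forall fun M => ?_)
  set A : Set ℂ := {z : ℂ | ‖z‖ ∈ S} with hA
  have hAm : MeasurableSet A := measurableSet_norm_mem hS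
  have hint : Integrable (fun z => ‖partialSum a M z‖ ^ 2) ((weightMeasure ω).restrict A) :=
    (hω.integrable_of_continuous
      ((continuous_partialSum a M).norm.pow 2)).restrict
  have h1 : ∫⁻ z in A, ‖partialSum a M z‖ₑ ^ 2 ∂(weightMeasure ω) =
      ENNReal.ofReal (∫ z in A, ‖partialSum a M z‖ ^ 2 ∂(weightMeasure ω)) := by
    rw [ofReal_integral_eq_lintegral_ofReal hint (ae_of_all _ fun z => by positivity)]
    refine lintegral_congr fun z => ?_
    rw [ENNReal.ofReal_pow (norm_nonneg _), ofReal_norm]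
  rw [h1, hω.setIntegral_norm_sq_partialSum a M hS, ← ofReal_measureReal (measure_ne_top _ _),
    ← ENNReal.ofReal_mul' measureReal_nonneg]
  refine ENNReal.ofReal_le_ofReal ?_
  refine le_trans (Finset.sum_le_sum fun n _ => ?_)
    ((Finset.sum_mul _ _ _).symm.le.trans (mul_le_mul_of_nonneg_right (hB M) measureReal_nonneg))
  rw [mul_assoc]
  refine mul_le_mul_of_nonneg_left ?_ (by positivity)
  calc ∫ z in A, ‖z‖ ^ (2 * n) ∂(weightMeasure ω)
      ≤ ∫ _z in A, t ^ (2 * n) ∂(weightMeasure ω) := by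
        refine setIntegral_mono_on (hω.integrable_norm_pow _).integrableOn
          (integrable_const _).integrableOn hAm fun z hz => ?_
        exact pow_le_pow_left₀ (norm_nonneg z) (ht _ hz) _
    _ = t ^ (2 * n) * (weightMeasure ω).real A := by
        rw [setIntegral_const, smul_eq_mul, mul_comm]

lemma lintegral_mul_le_of_sq_le {μ : Measure ℂ} {f g : ℂ → ℝ≥0∞} (hf : AEMeasurable f μ)
    (hg : AEMeasurable g μ) {x y : ℝ} (hx : 0 ≤ x) (hy : 0 ≤ y) {m : ℝ≥0∞}
    (hfx : ∫⁻ z, f z ^ 2 ∂μ ≤ ENNReal.ofReal (x ^ 2) * m)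
    (hgy : ∫⁻ z, g z ^ 2 ∂μ ≤ ENNReal.ofReal (y ^ 2) * m) :
    ∫⁻ z, f z * g z ∂μ ≤ ENNReal.ofReal (x * y) * m := by
  have h := ENNReal.lintegral_mul_le_Lp_mul_Lq μ Real.HolderConjugate.two_two hf hg
  simp only [Pi.mul_apply, ENNReal.rpow_two] at h
  have hpow : ∀ w : ℝ, 0 ≤ w → (ENNReal.ofReal (w ^ 2) * m) ^ (1 / 2 : ℝ) =
      ENNReal.ofReal w * m ^ (1 / 2 : ℝ) := by
    intro w hw
    rw [ENNReal.mul_rpow_of_nonneg _ _ (by norm_num), ENNReal.ofReal_pow hw, ← ENNReal.rpow_two,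
      ← ENNReal.rpow_mul]
    norm_num
  have hm : m ^ (1 / 2 : ℝ) * m ^ (1 / 2 : ℝ) = m := by
    rw [← ENNReal.rpow_add_of_nonneg _ _ (by norm_num) (by norm_num)]
    norm_num
  calc ∫⁻ z, f z * g z ∂μ ≤ _ := h
    _ ≤ (ENNReal.ofReal (x ^ 2) * m) ^ (1 / 2 : ℝ) * (ENNReal.ofReal (y ^ 2) * m) ^ (1 / 2 : ℝ) := by
      gcongr
    _ = _ := by
      rw [hpow x hx, hpow y hy, ENNReal.ofReal_mul hx]
      nth_rewrite 3 [← hm]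
      ring

/-- The coefficients of the function `ζ ↦ Σ (n + 1) w^n ζ^n / m_{2n+2}`. -/
def kernelDerivCoeff (ω : ℝ → ℝ) (w : ℂ) (n : ℕ) : ℂ :=
  ((n : ℂ) + 1) * w ^ n / (moment ω (2 * (n + 1)) : ℂ)

/-- Factor H = ((1-wz)H) · (1-wz)^(-1) and apply Cauchy–Schwarz. Up to constants the squared L^2
norms are at most N μ(S)/m_N^2 and N μ(S), so the integral is at most N μ(S)/m_N, and μ(S) is
dominated by m_N because S lies beyond 1 - 1/N. -/
lemma MomentDoubling.exists_annulus_le (hω : IsRadialWeight ω) {K : ℝ} (hK : MomentDoubling ω K) :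
    ∃ C, 0 < C ∧ ∀ N : ℕ, 0 < N → ∀ w ∈ disc, ∀ H : ℂ → ℂ, HasCoeffs (kernelDerivCoeff ω w) H →
      ∀ S : Set ℝ, MeasurableSet S → ∀ t : ℝ, 0 ≤ t → (∀ x ∈ S, x ≤ t) →
      (∀ x ∈ S, 1 - 1 / (N : ℝ) ≤ x) → ‖w‖ * t ≤ 1 - 1 / (2 * (N : ℝ)) →
      ∫⁻ z in {z : ℂ | ‖z‖ ∈ S}, ‖H z‖ₑ ∂(weightMeasure ω) ≤ ENNReal.ofReal (C * N) := by
  have hfin := hω.isFiniteMeasure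
  have hK1 := hK.one_le hω
  obtain ⟨C₁, hC₁, hsum⟩ := hK.exists_sum_le hω
  obtain ⟨C₂, hC₂, hmeas⟩ := hω.exists_measureReal_le_moment
  refine ⟨(1 + 2 * K) * √C₁ * 2 * C₂, by positivity,
    fun N hN w hw H hH S hS t ht0 ht hS' hwt => ?_⟩
  have hN' : (0 : ℝ) < N := by exact_mod_cast hN
  have hm := hω.moment_pos N
  have hs0 : 0 ≤ ‖w‖ * t := by positivity
  let E : ℂ → ℂ := fun z => (1 - w * z)⁻¹
  have hwz : ∀ z ∈ disc, ‖w * z‖ < 1 := by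
    intro z hz
    rw [norm_mul]
    exact mul_lt_one_of_nonneg_of_lt_one_left (norm_nonneg _) (mem_disc.1 hw) (mem_disc.1 hz).le
  have hE : HasCoeffs (fun n => w ^ n) E := by
    intro z hz
    have := hasSum_geometric_of_norm_lt_one (hwz z hz)
    simpa only [mul_pow] using this
  let d : ℕ → ℂ := fun n =>
    ((((n : ℝ) + 1) / moment ω (2 * (n + 1)) - n / moment ω (2 * n) : ℝ) : ℂ) * w ^ n
  -- Multiplication by wz shifts the series of H; the shifted coefficient n / m_{2n} vanishes at n =
  -- 0, so subtracting gives the increments d with no boundary term.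
  have hQ : HasCoeffs d fun z => (1 - w * z) * H z := by
    intro z hz
    have h1 := hH z hz
    have h2 : HasSum (fun n : ℕ => ((n : ℂ) / (moment ω (2 * n) : ℂ)) * (w * z) ^ n)
        (w * z * H z) := by
      rw [← hasSum_nat_add_iff' 1]
      simp only [Finset.range_one, Finset.sum_singleton, Nat.cast_zero, zero_div, zero_mul,
        sub_zero]
      refine (h1.mul_left (w * z)).congr_fun fun n => ?_
      simp only [kernelDerivCoeff]
      push_cast
      ring
    have h3 := h1.sub h2
    rw [show H z - w * z * H z = (1 - w * z) * H z by ring] at h3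
    refine h3.congr_fun fun n => ?_
    simp only [kernelDerivCoeff, d]
    push_cast
    ring
  have hEQ : ∀ z ∈ disc, ‖H z‖ₑ = ‖(1 - w * z) * H z‖ₑ * ‖E z‖ₑ := by
    intro z hz
    rw [← enorm_mul]
    congr 1
    have : 1 - w * z ≠ 0 := by
      intro h
      have h1 := hwz z hz
      rw [← sub_eq_zero.1 h] at h1
      simp at h1
    simp only [E]
    field_simp
  have hQ2 := hQ.setLIntegral_sq_le hω hS (t := t) (B := ((1 + 2 * K) * √C₁ * √N / moment ω N) ^ 2)
    ht fun M => by
      have h1 : ∀ n, ‖d n‖ ^ 2 * t ^ (2 * n) ≤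
          (1 + 2 * K) ^ 2 * ((‖w‖ * t) ^ (2 * n) / moment ω (2 * (n + 1)) ^ 2) := by
        intro n
        have h2 := pow_le_pow_left₀ (abs_nonneg _) (hK.increment_le hω n) 2
        simp only [d]
        rw [norm_mul, Complex.norm_real, Real.norm_eq_abs, norm_pow, mul_pow]
        calc _ ≤ ((1 + 2 * K) / moment ω (2 * (n + 1))) ^ 2 * (‖w‖ ^ n) ^ 2 * t ^ (2 * n) := by
              gcongr
          _ = _ := by
              rw [mul_pow, div_pow]
              ring
      refine (Finset.sum_le_sum fun n _ => h1 n).trans ?_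
      rw [← Finset.mul_sum]
      refine (mul_le_mul_of_nonneg_left (hsum N hN _ hs0 hwt M) (by positivity)).trans (le_of_eq ?_)
      rw [div_pow, mul_pow, mul_pow, Real.sq_sqrt hC₁.le, Real.sq_sqrt hN'.le]
      ring
  have hE2 := hE.setLIntegral_sq_le hω hS (t := t) (B := (2 * √N) ^ 2) ht fun M => by
    refine le_trans (le_of_eq ?_) ((sum_pow_le hN hs0 hwt M).trans (le_of_eq ?_))
    · refine Finset.sum_congr rfl fun n _ => ?_
      rw [norm_pow, mul_pow]
      ring
    · rw [mul_pow, Real.sq_sqrt hN'.le]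
      norm_num
  have hmQ : AEMeasurable (fun z => ‖(1 - w * z) * H z‖ₑ)
      ((weightMeasure ω).restrict {z : ℂ | ‖z‖ ∈ S}) :=
    (hQ.aestronglyMeasurable (ω := ω)).restrict.enorm
  have hmE : AEMeasurable (fun z => ‖E z‖ₑ) ((weightMeasure ω).restrict {z : ℂ | ‖z‖ ∈ S}) :=
    (hE.aestronglyMeasurable (ω := ω)).restrict.enorm
  have hprod := lintegral_mul_le_of_sq_le hmQ hmE (by positivity) (by positivity) hQ2 hE2
  have heq : ∫⁻ z in {z : ℂ | ‖z‖ ∈ S}, ‖H z‖ₑ ∂(weightMeasure ω) =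
      ∫⁻ z in {z : ℂ | ‖z‖ ∈ S}, ‖(1 - w * z) * H z‖ₑ * ‖E z‖ₑ ∂(weightMeasure ω) := by
    refine lintegral_congr_ae ?_
    filter_upwards [ae_restrict_of_ae (ae_mem_disc ω)] with z hz using hEQ z hz
  rw [heq]
  refine hprod.trans ?_
  rw [← ofReal_measureReal (measure_ne_top _ _), ← ENNReal.ofReal_mul (by positivity)]
  refine ENNReal.ofReal_le_ofReal ?_
  have h1 : (weightMeasure ω).real {z : ℂ | ‖z‖ ∈ S} ≤ C₂ * moment ω N := by
    have hsub : {z : ℂ | ‖z‖ ∈ S} ⊆ {z | 1 - 1 / (N : ℝ) ≤ ‖z‖} := fun z hz => hS' _ hz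
    exact (measureReal_mono hsub).trans (hmeas N hN)
  refine (mul_le_mul_of_nonneg_left h1 (by positivity)).trans (le_of_eq ?_)
  have h2 : √(N : ℝ) * √N = N := Real.mul_self_sqrt hN'.le
  field_simp
  rw [Real.sq_sqrt hN'.le]

/-- The `A^1_ω` norm of the derivative of the kernel. -/
lemma MomentDoubling.exists_kernelDeriv_le (hω : IsRadialWeight ω) {K : ℝ}
    (hK : MomentDoubling ω K) :
    ∃ C, 0 < C ∧ ∀ w ∈ disc, ∀ H : ℂ → ℂ, HasCoeffs (kernelDerivCoeff ω w) H →
      ∫⁻ z, ‖H z‖ₑ ∂(weightMeasure ω) ≤ ENNReal.ofReal (C / (1 - ‖w‖)) := by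
  obtain ⟨C, hC, h⟩ := hK.exists_annulus_le hω
  refine ⟨2 * C, by positivity, fun w hw H hH => ?_⟩
  have hw1 := mem_disc.1 hw
  have hw0 := norm_nonneg w
  have hp2 : ∀ k : ℕ, ((2 ^ k : ℕ) : ℝ) = 2 ^ k := fun k => by push_cast; rfl
  have hstep : ∀ k : ℕ, ∫⁻ z in {z : ℂ | ‖z‖ ∈ Set.Iio (1 - 1 / (2 : ℝ) ^ k)},
      ‖H z‖ₑ ∂(weightMeasure ω) ≤ ENNReal.ofReal (C * 2 ^ k) := by
    intro k
    induction k with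
    | zero =>
      have : {z : ℂ | ‖z‖ ∈ Set.Iio (1 - 1 / (2 : ℝ) ^ 0)} = ∅ := by
        ext z
        simp
      rw [this]
      simp
    | succ k ih =>
      have hk : (0 : ℝ) < 2 ^ k := by positivity
      -- With N = 2^k this is 1 - 1/(2N), so the hypothesis on ‖w‖ t holds for every w in the disc.
      -- The new annulus costs C·2^k, exactly what turns the bound C·2^k into C·2^(k+1).
      set t : ℝ := 1 - 1 / (2 : ℝ) ^ (k + 1) with ht
      have hone : (1 : ℝ) ≤ 2 ^ k := one_le_pow₀ one_le_two
      have ht0 : 0 ≤ t := by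
        rw [ht, sub_nonneg, div_le_one (by positivity)]
        exact one_le_pow₀ one_le_two
      have h1 := h (2 ^ k) (by positivity) w hw H hH (Set.Ico (1 - 1 / (2 : ℝ) ^ k) t)
        measurableSet_Ico t ht0 (fun x hx => hx.2.le) (fun x hx => by rw [hp2]; exact hx.1) (by
          rw [hp2, ← pow_succ']
          exact mul_le_of_le_one_left ht0 hw1.le)
      rw [hp2] at h1
      have hsub : {z : ℂ | ‖z‖ ∈ Set.Iio t} ⊆ {z : ℂ | ‖z‖ ∈ Set.Iio (1 - 1 / (2 : ℝ) ^ k)} ∪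
          {z : ℂ | ‖z‖ ∈ Set.Ico (1 - 1 / (2 : ℝ) ^ k) t} := by
        intro z hz
        rcases lt_or_ge ‖z‖ (1 - 1 / (2 : ℝ) ^ k) with hlt | hge
        · exact Or.inl hlt
        · exact Or.inr ⟨hge, hz⟩
      refine (lintegral_mono_set hsub).trans ((lintegral_union_le _ _ _).trans
        ((add_le_add ih h1).trans ?_))
      rw [← ENNReal.ofReal_add (by positivity) (by positivity)]
      refine ENNReal.ofReal_le_ofReal (le_of_eq ?_)
      ring
  have hx : 1 ≤ 1 / (1 - ‖w‖) := by
    rw [le_div_iff₀ (by linarith)]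
    linarith
  -- Take 2^k ≤ 1/(1-‖w‖) < 2^(k+1). From here on ‖w‖ itself is at most 1 - 1/(2·2^k), so the
  -- remaining annulus up to the unit circle is handled in one step with t = 1.
  obtain ⟨k, hk1, hk2⟩ := exists_nat_pow_near hx one_lt_two
  have hlast := h (2 ^ k) (by positivity) w hw H hH (Set.Ico (1 - 1 / (2 : ℝ) ^ k) 1)
    measurableSet_Ico 1 zero_le_one (fun x hx => hx.2.le) (fun x hx => by rw [hp2]; exact hx.1) (by
      rw [hp2, ← pow_succ', mul_one, le_sub_comm, div_le_iff₀ (by positivity)]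
      rw [div_lt_iff₀ (by linarith)] at hk2
      linarith)
  rw [hp2] at hlast
  have hdisc : ∫⁻ z, ‖H z‖ₑ ∂(weightMeasure ω) = ∫⁻ z in disc, ‖H z‖ₑ ∂(weightMeasure ω) := by
    rw [Measure.restrict_eq_self_of_ae_mem (ae_mem_disc ω)]
  have hsub : disc ⊆ {z : ℂ | ‖z‖ ∈ Set.Iio (1 - 1 / (2 : ℝ) ^ k)} ∪
      {z : ℂ | ‖z‖ ∈ Set.Ico (1 - 1 / (2 : ℝ) ^ k) 1} := by
    intro z hz
    rcases lt_or_ge ‖z‖ (1 - 1 / (2 : ℝ) ^ k) with hlt | hge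
    · exact Or.inl hlt
    · exact Or.inr ⟨hge, mem_disc.1 hz⟩
  rw [hdisc]
  refine (lintegral_mono_set hsub).trans ((lintegral_union_le _ _ _).trans
    ((add_le_add (hstep k) hlast).trans ?_))
  rw [← ENNReal.ofReal_add (by positivity) (by positivity)]
  refine ENNReal.ofReal_le_ofReal ?_
  calc C * 2 ^ k + C * 2 ^ k = 2 * C * 2 ^ k := by ring
    _ ≤ 2 * C * (1 / (1 - ‖w‖)) := by gcongr
    _ = _ := by ring

/-! ### Doubling of the tail and of the moments -/

/-- The measure `ω(t) dt` on the unit interval. -/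
def radialMeasure (ω : ℝ → ℝ) : Measure ℝ :=
  (volume.restrict (Set.Ioo 0 1)).withDensity fun t => ENNReal.ofReal (ω t)

lemma radialMeasure_ae_mem (ω : ℝ → ℝ) : ∀ᵐ t ∂(radialMeasure ω), t ∈ Set.Ioo (0 : ℝ) 1 :=
  (withDensity_absolutelyContinuous _ _).ae_le (ae_restrict_mem measurableSet_Ioo)

lemma IsRadialWeight.radialMeasure_Ici (hω : IsRadialWeight ω) {u : ℝ} (hu : u ∈ Set.Ioo (0 : ℝ) 1) :
    radialMeasure ω (Set.Ici u) = ENNReal.ofReal (tail ω u) := by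
  have h1 : Set.Ici u ∩ Set.Ioo 0 1 = Set.Ico u 1 := by
    ext x
    simp only [Set.mem_inter_iff, Set.mem_Ici, Set.mem_Ioo, Set.mem_Ico]
    exact ⟨fun h => ⟨h.1, h.2.2⟩, fun h => ⟨h.1, hu.1.trans_le h.1, h.2⟩⟩
  rw [radialMeasure, withDensity_apply _ measurableSet_Ici,
    Measure.restrict_restrict measurableSet_Ici, h1, tail_eq_integral_Ioo ω hu.2.le,
    ← integral_Ico_eq_integral_Ioo]
  refine (ofReal_integral_eq_lintegral_ofReal
    (hω.integrable.mono_set (Set.Ico_subset_Ico_left hu.1.le)) ?_).symm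
  filter_upwards [ae_restrict_mem measurableSet_Ico] with t ht
  exact hω.nonneg t ⟨hu.1.le.trans ht.1, ht.2⟩

lemma IsRadialWeight.lintegral_radialMeasure (hω : IsRadialWeight ω) {f : ℝ → ℝ} (hf : Continuous f)
    (hf0 : ∀ t ∈ Set.Ioo (0 : ℝ) 1, 0 ≤ f t) :
    ∫⁻ t, ENNReal.ofReal (f t) ∂(radialMeasure ω) =
      ENNReal.ofReal (∫ t in Set.Ioo 0 1, f t * ω t) := by
  rw [radialMeasure, lintegral_withDensity_eq_lintegral_mul₀
    hω.integrableOn_Ioo.aestronglyMeasurable.aemeasurable.ennreal_ofReal (by fun_prop),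
    ofReal_integral_eq_lintegral_ofReal (hω.integrableOn_bdd_mul hf)]
  · refine setLIntegral_congr_fun measurableSet_Ioo fun t ht => ?_
    simp only [Pi.mul_apply]
    rw [mul_comm, ENNReal.ofReal_mul (hf0 t ht)]
  · filter_upwards [ae_restrict_mem measurableSet_Ioo] with t ht
    exact mul_nonneg (hf0 t ht) (hω.nonneg t ⟨ht.1.le, ht.2⟩)

/-- Layer cake formula with density (n+1)u^n. It turns inequalities between tails into inequalities
between moments. -/
lemma lintegral_pow_eq_lintegral_meas (μ : Measure ℝ) (n : ℕ) {f : ℝ → ℝ} (hf : Measurable f)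
    (hf0 : 0 ≤ᵐ[μ] f) :
    ∫⁻ x, ENNReal.ofReal (f x ^ (n + 1)) ∂μ =
      ∫⁻ u in Set.Ioi 0, μ {x | u ≤ f x} * ENNReal.ofReal (((n : ℝ) + 1) * u ^ n) := by
  rw [← lintegral_comp_eq_lintegral_meas_le_mul μ hf0 hf.aemeasurable
    (fun t _ => (by fun_prop : Continuous fun u : ℝ => ((n : ℝ) + 1) * u ^ n).intervalIntegrable _ _)]
  · refine lintegral_congr fun x => ?_
    congr 1
    rw [intervalIntegral.integral_const_mul, integral_pow]
    have : (n : ℝ) + 1 ≠ 0 := by positivity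
    field_simp
    simp
  · filter_upwards [ae_restrict_mem measurableSet_Ioi] with u hu
    have : (0 : ℝ) < u := hu
    positivity

/-- Tail doubling says that the distribution function of x is at most C times that of 2x - 1. Hence
the moments of x are at most C times those of the positive part of 2x - 1, and 2x - 1 ≤ x^2 doubles
the exponent. The constant is unchanged. -/
lemma TailDoubling.momentDoubling (hω : IsRadialWeight ω) (h : TailDoubling ω) :
    ∃ K, MomentDoubling ω K := by
  obtain ⟨C, hC1, hC⟩ := h
  refine ⟨C, fun n => ?_⟩
  set μ := radialMeasure ω
  have key : ∫⁻ x, ENNReal.ofReal (x ^ (n + 1)) ∂μ ≤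
      ENNReal.ofReal C * ∫⁻ x, ENNReal.ofReal (x ^ (2 * n + 1)) ∂μ := by
    calc ∫⁻ x, ENNReal.ofReal (x ^ (n + 1)) ∂μ
        = ∫⁻ u in Set.Ioi 0, μ {x | u ≤ x} * ENNReal.ofReal (((n : ℝ) + 1) * u ^ n) :=
          lintegral_pow_eq_lintegral_meas μ n measurable_id
            ((radialMeasure_ae_mem ω).mono fun x hx => hx.1.le)
      _ ≤ ∫⁻ u in Set.Ioi 0, ENNReal.ofReal C *
            (μ {x | u ≤ max (2 * x - 1) 0} * ENNReal.ofReal (((n : ℝ) + 1) * u ^ n)) := by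
          refine setLIntegral_mono' measurableSet_Ioi fun u hu => ?_
          rw [← mul_assoc]
          gcongr
          have hu0 : (0 : ℝ) < u := hu
          rcases lt_or_ge u 1 with h1 | h1
          · have h2 : {x : ℝ | u ≤ max (2 * x - 1) 0} = Set.Ici ((1 + u) / 2) := by
              ext x
              simp only [Set.mem_ofPred_eq, le_max_iff, Set.mem_Ici]
              constructor
              · rintro (h | h) <;> linarith
              · intro h
                left
                linarith
            have h3 : {x : ℝ | u ≤ x} = Set.Ici u := rfl
            rw [h2, h3, hω.radialMeasure_Ici ⟨hu0, h1⟩,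
              hω.radialMeasure_Ici ⟨by linarith, by linarith⟩, ← ENNReal.ofReal_mul (by linarith)]
            exact ENNReal.ofReal_le_ofReal (hC u ⟨hu0.le, h1⟩)
          · have h2 : μ {x | u ≤ x} = 0 := by
              refine measure_mono_null (t := {x | ¬ x ∈ Set.Ioo (0 : ℝ) 1}) (fun x hx => ?_)
                (ae_iff.1 (radialMeasure_ae_mem ω))
              have : u ≤ x := hx
              exact fun hx' => absurd hx'.2 (not_lt.2 (h1.trans this))
            rw [h2]
            exact zero_le
      _ = ENNReal.ofReal C * ∫⁻ x, ENNReal.ofReal (max (2 * x - 1) 0 ^ (n + 1)) ∂μ := by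
          rw [lintegral_const_mul' _ _ ENNReal.ofReal_ne_top,
            lintegral_pow_eq_lintegral_meas μ n (f := fun x => max (2 * x - 1) 0) (by fun_prop) (ae_of_all _ fun x => le_max_right _ _)]
      _ ≤ _ := by
          refine mul_le_mul' le_rfl (lintegral_mono_ae ?_)
          filter_upwards [radialMeasure_ae_mem ω] with x hx
          refine ENNReal.ofReal_le_ofReal ?_
          have h1 : max (2 * x - 1) 0 ≤ x ^ 2 := max_le (by nlinarith [sq_nonneg (x - 1)]) (sq_nonneg x)
          calc max (2 * x - 1) 0 ^ (n + 1) ≤ (x ^ 2) ^ (n + 1) :=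
                pow_le_pow_left₀ (le_max_right _ _) h1 _
            _ = x ^ (2 * (n + 1)) := (pow_mul _ _ _).symm
            _ ≤ x ^ (2 * n + 1) := pow_le_pow_of_le_one hx.1.le hx.2.le (by omega)
  rw [hω.lintegral_radialMeasure (by fun_prop) fun t ht => pow_nonneg ht.1.le _,
    hω.lintegral_radialMeasure (by fun_prop) fun t ht => pow_nonneg ht.1.le _,
    ← ENNReal.ofReal_mul (by linarith)] at key
  have hpos : 0 ≤ C * ∫ t in Set.Ioo 0 1, t ^ (2 * n + 1) * ω t := by
    have := hω.moment_pos (2 * n)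
    rw [hω.moment_eq] at this
    exact mul_nonneg (by linarith) (by linarith)
  have := (ENNReal.ofReal_le_ofReal_iff hpos).1 key
  rw [hω.moment_eq, hω.moment_eq]
  linarith

/-- A moment is bounded by a smaller one and the tail. -/
lemma IsRadialWeight.moment_le (hω : IsRadialWeight ω) {s : ℝ} (hs : s ∈ Set.Ico (0 : ℝ) 1)
    {N M : ℕ} (hNM : N ≤ M) :
    moment ω M ≤ s ^ (M - N) * moment ω N + 2 * tail ω s := by
  rw [hω.moment_eq, hω.moment_eq, tail_eq_integral_Ioo ω hs.2.le]
  have hiM := hω.integrableOn_bdd_mul (f := fun t => t ^ (M + 1)) (by fun_prop)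
  have hiN := hω.integrableOn_bdd_mul (f := fun t => t ^ (N + 1)) (by fun_prop)
  have hind : IntegrableOn ((Set.Ioo s 1).indicator ω) (Set.Ioo 0 1) :=
    hω.integrableOn_Ioo.indicator measurableSet_Ioo
  have h1 : ∫ t in Set.Ioo 0 1, t ^ (M + 1) * ω t ≤
      ∫ t in Set.Ioo 0 1, (s ^ (M - N) * (t ^ (N + 1) * ω t) + (Set.Ioo s 1).indicator ω t) := by
    refine setIntegral_mono_on hiM ((hiN.const_mul _).add hind) measurableSet_Ioo fun t ht => ?_
    have hωt := hω.nonneg t ⟨ht.1.le, ht.2⟩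
    have hpow : t ^ (M + 1) = t ^ (M - N) * t ^ (N + 1) := by
      rw [← pow_add]
      congr 1
      omega
    by_cases hst : s < t
    · rw [Set.indicator_of_mem (show t ∈ Set.Ioo s 1 from ⟨hst, ht.2⟩)]
      have h2 : t ^ (M + 1) * ω t ≤ ω t :=
        mul_le_of_le_one_left hωt (pow_le_one₀ ht.1.le ht.2.le)
      have h3 : 0 ≤ s ^ (M - N) * (t ^ (N + 1) * ω t) :=
        mul_nonneg (pow_nonneg hs.1 _) (mul_nonneg (pow_nonneg ht.1.le _) hωt)
      linarith
    · rw [Set.indicator_of_notMem (fun h => hst h.1), add_zero, hpow, mul_assoc]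
      exact mul_le_mul_of_nonneg_right (pow_le_pow_left₀ ht.1.le (not_lt.1 hst) _)
        (mul_nonneg (pow_nonneg ht.1.le _) hωt)
  rw [integral_add (hiN.const_mul _) hind, integral_const_mul,
    setIntegral_indicator measurableSet_Ioo,
    Set.inter_eq_self_of_subset_right (Set.Ioo_subset_Ioo_left hs.1)] at h1
  linarith

/-- K^k is at most a power of 2^k, and exp(-2^k/2) decays faster than any such power. -/
lemma exists_pow_mul_exp_neg_le (K : ℝ) (hK : 1 ≤ K) :
    ∃ k : ℕ, K ^ k * Real.exp (-((2 ^ k - 1) / 2)) ≤ 1 / 2 := by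
  obtain ⟨β, hβ⟩ := pow_unbounded_of_one_lt K (one_lt_two)
  have h1 := (Real.tendsto_pow_mul_exp_neg_atTop_nhds_zero β).comp
    ((tendsto_pow_atTop_atTop_of_one_lt (one_lt_two (α := ℝ))).atTop_div_const
      (zero_lt_two (α := ℝ)))
  have h2 := h1.const_mul (2 ^ β * Real.exp (1 / 2))
  rw [mul_zero] at h2
  obtain ⟨k, hk⟩ := (h2.eventually (gt_mem_nhds (by norm_num : (0 : ℝ) < 1 / 2))).exists
  refine ⟨k, le_trans ?_ hk.le⟩
  have hKk : K ^ k ≤ (2 ^ k) ^ β := by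
    calc K ^ k ≤ (2 ^ β) ^ k := pow_le_pow_left₀ (by linarith) hβ.le k
      _ = _ := by rw [← pow_mul, ← pow_mul, mul_comm]
  have he : Real.exp (-((2 ^ k - 1) / 2)) = Real.exp (1 / 2) * Real.exp (-(2 ^ k / 2)) := by
    rw [← Real.exp_add]
    congr 1
    ring
  rw [he]
  calc K ^ k * (Real.exp (1 / 2) * Real.exp (-(2 ^ k / 2)))
      ≤ (2 ^ k) ^ β * (Real.exp (1 / 2) * Real.exp (-(2 ^ k / 2))) := by gcongr
    _ = _ := by
      simp only [Function.comp_apply, div_pow]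
      field_simp

/-- For r near 1 put N ≈ 1/(1-r) and s = (1+r)/2. Doubling k times gives m_N ≤ K^k (s^((2^k-1)N) m_N
+ 2 tail(s)); for a fixed large k the first term is at most m_N/2 and is absorbed. Finally tail(r)
is dominated by m_N because r^(N+1) is bounded below. Radii below 1/2 are covered by comparing `tail
ω 0` with `tail ω (3 / 4)`. -/
lemma MomentDoubling.tailDoubling (hω : IsRadialWeight ω) {K : ℝ} (hK : MomentDoubling ω K) :
    TailDoubling ω := by
  have hK1 := hK.one_le hω
  obtain ⟨k, hk⟩ := exists_pow_mul_exp_neg_le K hK1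
  have ht0 := hω.tail_pos 0 (by norm_num)
  have ht1 := hω.tail_pos (3 / 4) (by norm_num)
  set C₁ := tail ω 0 / tail ω (3 / 4) with hC₁
  set C₂ := 2 * K ^ k * Real.exp 6 with hC₂
  refine ⟨max 1 (max C₁ C₂), le_max_left _ _, fun r hr => ?_⟩
  have hs : (1 + r) / 2 ∈ Set.Ico (0 : ℝ) 1 := ⟨by linarith [hr.1], by linarith [hr.2]⟩
  have htail := hω.tail_pos _ hs
  rcases lt_or_ge r (1 / 2) with h | h
  · refine le_trans ?_ (mul_le_mul_of_nonneg_right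
      ((le_max_left C₁ C₂).trans (le_max_right 1 _)) htail.le)
    calc tail ω r ≤ tail ω 0 := hω.tail_anti le_rfl hr.1 hr.2.le
      _ = C₁ * tail ω (3 / 4) := by rw [hC₁, div_mul_cancel₀ _ ht1.ne']
      _ ≤ C₁ * tail ω ((1 + r) / 2) := by
        refine mul_le_mul_of_nonneg_left ?_ (by positivity)
        exact hω.tail_anti hs.1 (by linarith) (by norm_num)
  · refine le_trans ?_ (mul_le_mul_of_nonneg_right
      ((le_max_right C₁ C₂).trans (le_max_right 1 _)) htail.le)
    set s := (1 + r) / 2 with hs_def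
    set x := 1 - r with hx
    have hx0 : 0 < x := by linarith [hr.2]
    set N := ⌈1 / x⌉₊ with hN
    have hN1 : 1 / x ≤ N := Nat.le_ceil _
    have hN2 : (N : ℝ) < 1 / x + 1 := Nat.ceil_lt_add_one (by positivity)
    have hmN := hω.moment_pos N
    have hNM : N ≤ 2 ^ k * N := Nat.le_mul_of_pos_left N (by positivity)
    have h1 := hK.iterate hω N k
    have h2 := hω.moment_le hs hNM
    have h3 : s ^ (2 ^ k * N - N) ≤ Real.exp (-((2 ^ k - 1) / 2)) := by
      have h4 : s ≤ Real.exp (-(x / 2)) := by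
        have := Real.add_one_le_exp (-(x / 2))
        have : s = -(x / 2) + 1 := by rw [hs_def, hx]; ring
        linarith
      refine (pow_le_pow_left₀ hs.1 h4 _).trans ?_
      rw [← Real.exp_nat_mul]
      refine Real.exp_le_exp.2 ?_
      rw [Nat.cast_sub hNM]
      push_cast
      have h5 : 1 ≤ x * N := by
        rw [div_le_iff₀ hx0] at hN1
        linarith
      have h6 : (1 : ℝ) ≤ 2 ^ k := one_le_pow₀ one_le_two
      nlinarith
    have h7 : K ^ k * (s ^ (2 ^ k * N - N) * moment ω N) ≤ 1 / 2 * moment ω N := by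
      rw [← mul_assoc]
      refine mul_le_mul_of_nonneg_right (le_trans ?_ hk) hmN.le
      gcongr
    -- The term at most m_N/2 moves to the left-hand side.
    have h8 : moment ω N ≤ 4 * K ^ k * tail ω s := by
      have := mul_le_mul_of_nonneg_left h2 (pow_nonneg (by linarith : (0 : ℝ) ≤ K) k)
      rw [mul_add] at this
      linarith
    have h9 := hω.tail_le_moment hr N
    -- For x = 1 - r ≤ 1/2 one has e^(2x) r ≥ 1, and 2x(N+1) stays below 6 because Nx ≤ 1 + x.
    have h10 : 1 ≤ Real.exp 6 * r ^ (N + 1) := by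
      have h11 : 1 ≤ Real.exp (2 * x) * r := by
        have := Real.add_one_le_exp (2 * x)
        have h12 : 1 ≤ (2 * x + 1) * r := by
          have : r = 1 - x := by rw [hx]; ring
          rw [this]
          nlinarith
        exact h12.trans (mul_le_mul_of_nonneg_right this hr.1)
      have h13 := one_le_pow₀ (n := N + 1) h11
      rw [mul_pow, ← Real.exp_nat_mul] at h13
      refine h13.trans (mul_le_mul_of_nonneg_right (Real.exp_le_exp.2 ?_) (pow_nonneg hr.1 _))
      push_cast
      have h14 : (N : ℝ) * x ≤ 1 + x := by
        have := mul_le_mul_of_nonneg_right hN2.le hx0.le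
        rw [add_mul, div_mul_cancel₀ _ hx0.ne'] at this
        linarith
      nlinarith
    have htr := hω.tail_pos r hr
    calc tail ω r ≤ Real.exp 6 * r ^ (N + 1) * tail ω r :=
          le_mul_of_one_le_left htr.le h10
      _ = Real.exp 6 / 2 * (2 * r ^ (N + 1) * tail ω r) := by ring
      _ ≤ Real.exp 6 / 2 * (4 * K ^ k * tail ω s) :=
          mul_le_mul_of_nonneg_left (h9.trans h8) (by positivity)
      _ = C₂ * tail ω s := by rw [hC₂]; ring

/-! ### Normed spaces of holomorphic functions with dilations -/

lemma Converges.summable_dilate {c : ℕ → ℂ} (h : Converges c) {r : ℝ}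
    (hr : r ∈ Set.Ioo (0 : ℝ) 1) :
    Summable fun n : ℕ => ((n : ℝ) + 1) * ‖c n * (r : ℂ) ^ n‖ := by
  refine (h.succ_mul (r := r) ⟨hr.1.le, hr.2⟩).congr fun n => ?_
  rw [norm_mul, norm_pow, Complex.norm_real, Real.norm_of_nonneg hr.1.le]

lemma summable_norm_of_succ_mul {c : ℕ → ℂ}
    (h : Summable fun n : ℕ => ((n : ℝ) + 1) * ‖c n‖) : Summable fun n => ‖c n‖ := by
  refine Summable.of_nonneg_of_le (fun n => norm_nonneg _) (fun n => ?_) h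
  exact le_mul_of_one_le_left (norm_nonneg _) (by linarith [n.cast_nonneg (α := ℝ)])

/-- A normed space of holomorphic functions in the disc which contains the absolutely convergent
power series and in which the dilations `f_r` of any element `f` converge to `f`. -/
structure DilationSpace (X : Type*) [SeminormedAddCommGroup X] [NormedSpace ℂ X] where
  /-- The function represented by an element. -/
  eval : X →ₗ[ℂ] (ℂ → ℂ)
  differentiableOn : ∀ x, DifferentiableOn ℂ (eval x) disc
  /-- The monomials. -/
  mono : ℕ → X
  eval_mono : ∀ n, ∀ z ∈ disc, eval (mono n) z = z ^ n
  /-- The norm of the inclusion of the absolutely convergent power series. -/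
  bound : ℝ
  norm_le : ∀ x a, HasCoeffs a (eval x) → Summable (fun n : ℕ => ((n : ℝ) + 1) * ‖a n‖) →
    ‖x‖ ≤ bound * ∑' n : ℕ, ((n : ℝ) + 1) * ‖a n‖
  exists_dilate : ∀ x, ∃ D : ℝ → X,
    (∀ r ∈ Set.Ioo (0 : ℝ) 1, ∀ z ∈ disc, eval (D r) z = eval x (r * z)) ∧
    Tendsto D (𝓝[<] 1) (𝓝 x)

namespace DilationSpace

variable {X : Type*} [SeminormedAddCommGroup X] [NormedSpace ℂ X] (V : DilationSpace X)

lemma hasCoeffs (x : X) : HasCoeffs (coeff (V.eval x)) (V.eval x) :=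
  hasCoeffs_coeff (V.differentiableOn x)

lemma hasCoeffs_mono (n : ℕ) : HasCoeffs (Pi.single n 1) (V.eval (V.mono n)) :=
  (hasCoeffs_monomial n).congr fun z hz => (V.eval_mono n z hz).symm

lemma norm_mono_le (n : ℕ) : ‖V.mono n‖ ≤ V.bound * ((n : ℝ) + 1) := by
  have h : HasSum (fun k : ℕ => ((k : ℝ) + 1) * ‖(Pi.single n 1 : ℕ → ℂ) k‖) ((n : ℝ) + 1) := by
    have := hasSum_single (f := fun k : ℕ => ((k : ℝ) + 1) * ‖(Pi.single n 1 : ℕ → ℂ) k‖) n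
      fun k hk => by simp [hk]
    simpa using this
  have := V.norm_le _ _ (V.hasCoeffs_mono n) h.summable
  rwa [h.tsum_eq] at this

/-- A function with rapidly decreasing coefficients is the sum of its power series. -/
lemma hasSum {x : X} {c : ℕ → ℂ} (hc : HasCoeffs c (V.eval x))
    (hs : Summable fun n : ℕ => ((n : ℝ) + 1) * ‖c n‖) : HasSum (fun n => c n • V.mono n) x := by
  have hnorm : Summable fun n => ‖c n • V.mono n‖ := by
    refine Summable.of_nonneg_of_le (fun n => norm_nonneg _) (fun n => ?_) (hs.mul_left V.bound)
    rw [norm_smul]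
    have := mul_le_mul_of_nonneg_left (V.norm_mono_le n) (norm_nonneg (c n))
    linarith
  -- X is not assumed complete: the sum is identified directly, by applying `norm_le` to the
  -- remainders of x.
  refine hasSum_of_subseq_of_summable hnorm tendsto_finset_range ?_
  rw [tendsto_iff_norm_sub_tendsto_zero]
  have htail : ∀ N : ℕ, HasSum (fun n : ℕ => ((n : ℝ) + 1) * ‖if n < N then (0 : ℂ) else c n‖)
      ((∑' n : ℕ, ((n : ℝ) + 1) * ‖c n‖) - ∑ n ∈ Finset.range N, ((n : ℝ) + 1) * ‖c n‖) := by
    intro N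
    have h1 : HasSum (fun n : ℕ => ((n : ℝ) + 1) * ‖if n < N then c n else 0‖)
        (∑ n ∈ Finset.range N, ((n : ℝ) + 1) * ‖if n < N then c n else 0‖) :=
      hasSum_sum_of_ne_finset_zero fun n hn => by
        rw [Finset.mem_range] at hn
        simp [hn]
    have h2 : ∑ n ∈ Finset.range N, ((n : ℝ) + 1) * ‖if n < N then c n else 0‖ =
        ∑ n ∈ Finset.range N, ((n : ℝ) + 1) * ‖c n‖ :=
      Finset.sum_congr rfl fun n hn => by rw [if_pos (Finset.mem_range.1 hn)]
    rw [h2] at h1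
    refine (hs.hasSum.sub h1).congr_fun fun n => ?_
    by_cases hn : n < N <;> simp [hn]
  have hbound : ∀ N, ‖∑ n ∈ Finset.range N, c n • V.mono n - x‖ ≤
      V.bound * ((∑' n : ℕ, ((n : ℝ) + 1) * ‖c n‖) -
        ∑ n ∈ Finset.range N, ((n : ℝ) + 1) * ‖c n‖) := by
    intro N
    rw [norm_sub_rev, ← (htail N).tsum_eq]
    refine V.norm_le _ _ (fun z hz => ?_) (htail N).summable
    have h1 : HasSum (fun n => (if n < N then c n else 0) * z ^ n)
        (∑ n ∈ Finset.range N, c n * z ^ n) := hasCoeffs_partialSum c N z hz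
    have h2 : V.eval (x - ∑ n ∈ Finset.range N, c n • V.mono n) z =
        V.eval x z - ∑ n ∈ Finset.range N, c n * z ^ n := by
      rw [map_sub, map_sum, Pi.sub_apply, Finset.sum_apply]
      congr 1
      refine Finset.sum_congr rfl fun n _ => ?_
      rw [map_smul, Pi.smul_apply, V.eval_mono n z hz, smul_eq_mul]
    rw [h2]
    refine ((hc z hz).sub h1).congr_fun fun n => ?_
    by_cases hn : n < N <;> simp [hn]
  refine squeeze_zero (fun N => norm_nonneg _) hbound ?_
  have h1 := (hs.hasSum.tendsto_sum_nat.const_sub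
    (∑' n : ℕ, ((n : ℝ) + 1) * ‖c n‖)).const_mul V.bound
  rwa [sub_self, mul_zero] at h1

lemma hasSum_apply {x : X} {c : ℕ → ℂ} (hc : HasCoeffs c (V.eval x))
    (hs : Summable fun n : ℕ => ((n : ℝ) + 1) * ‖c n‖) (L : StrongDual ℂ X) :
    HasSum (fun n => c n * L (V.mono n)) (L x) := by
  have := (V.hasSum hc hs).mapL L
  simpa using this

/-- A functional is represented by the function with matching coefficients. -/
lemma hasPairing (hω : IsRadialWeight ω) (L : StrongDual ℂ X) {b : ℕ → ℂ} {g : ℂ → ℂ}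
    (hg : HasCoeffs b g) (hgi : Integrable g (weightMeasure ω))
    (hb : ∀ n, conj (b n) * moment ω (2 * n) = L (V.mono n)) (x : X) :
    HasPairing ω (V.eval x) g (L x) := by
  obtain ⟨D, hD, hlim⟩ := V.exists_dilate x
  have hx := V.hasCoeffs x
  have key : ∀ r ∈ Set.Ioo (0 : ℝ) 1,
      Integrable (fun z : ℂ => V.eval x (r * z) * conj (g z)) (weightMeasure ω) ∧
      ∫ z, V.eval x (r * z) * conj (g z) ∂(weightMeasure ω) = L (D r) := by
    intro r hr
    have hs := hx.converges.summable_dilate hr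
    have hxr := hx.dilate (r := r) ⟨hr.1.le, hr.2.le⟩
    have h1 := hxr.hasSum_integral_mul_conj (summable_norm_of_succ_mul hs) hgi
    refine ⟨h1.1, h1.2.unique ?_⟩
    have hDr : HasCoeffs (fun n => coeff (V.eval x) n * (r : ℂ) ^ n) (V.eval (D r)) :=
      hxr.congr fun z hz => (hD r hr z hz).symm
    refine (V.hasSum_apply hDr hs L).congr_fun fun n => ?_
    rw [hg.integral_pow_mul_conj hω hgi, hb]
  refine ⟨fun r hr => (key r hr).1, ?_⟩
  refine ((L.continuous.tendsto x).comp hlim).congr' ?_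
  filter_upwards [Ioo_mem_nhdsLT (zero_lt_one' ℝ)] with r hr
  exact (key r hr).2.symm

end DilationSpace

/-- The pairing with the monomials determines the coefficients. -/
lemma HasCoeffs.eq_of_hasPairing (hω : IsRadialWeight ω) {b : ℕ → ℂ} {g : ℂ → ℂ}
    (hg : HasCoeffs b g) {f : ℕ → ℂ → ℂ} (hf : ∀ n, ∀ z ∈ disc, f n z = z ^ n) {ℓ : ℕ → ℂ}
    (h : ∀ n, HasPairing ω (f n) g (ℓ n)) :
    Integrable g (weightMeasure ω) ∧ ∀ n, ℓ n = conj (b n) * moment ω (2 * n) := by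
  have hmem : ∀ r ∈ Set.Ioo (0 : ℝ) 1, ∀ z ∈ disc, (r : ℂ) * z ∈ disc := by
    intro r hr z hz
    rw [mem_disc] at hz ⊢
    rw [norm_mul, Complex.norm_real, Real.norm_of_nonneg hr.1.le]
    exact mul_lt_one_of_nonneg_of_lt_one_left hr.1.le hr.2 hz.le
  -- The pairing with the constant monomial is already the integrability of conj g.
  have hgi : Integrable g (weightMeasure ω) := by
    have h1 := (h 0).1 (1 / 2) (by norm_num)
    refine (Complex.conjLIE.integrable_comp_iff).1 (h1.congr ?_)
    filter_upwards [ae_mem_disc ω] with z hz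
    rw [hf 0 _ (hmem (1 / 2) (by norm_num) z hz), pow_zero, one_mul]
    rfl
  refine ⟨hgi, fun n => ?_⟩
  refine tendsto_nhds_unique (h n).2 ?_
  have h1 : Tendsto (fun r : ℝ => (r : ℂ) ^ n * (conj (b n) * moment ω (2 * n))) (𝓝[<] 1)
      (𝓝 (((1 : ℝ) : ℂ) ^ n * (conj (b n) * moment ω (2 * n)))) :=
    ((by fun_prop : Continuous fun r : ℝ => (r : ℂ) ^ n * (conj (b n) * moment ω (2 * n))).tendsto
      1).mono_left nhdsWithin_le_nhds
  rw [Complex.ofReal_one, one_pow, one_mul] at h1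
  refine h1.congr' ?_
  filter_upwards [Ioo_mem_nhdsLT (zero_lt_one' ℝ)] with r hr
  rw [← hg.integral_pow_mul_conj hω hgi, ← integral_const_mul]
  refine integral_congr_ae ?_
  filter_upwards [ae_mem_disc ω] with z hz
  rw [hf n _ (hmem r hr z hz), mul_pow, mul_assoc]

/-! ### Dilations of holomorphic functions -/

lemma HasCoeffs.norm_le_tsum {c : ℕ → ℂ} {f : ℂ → ℂ} (h : HasCoeffs c f) {R : ℝ}
    (hR : R ∈ Set.Ico (0 : ℝ) 1) {z : ℂ} (hz : ‖z‖ ≤ R) : ‖f z‖ ≤ ∑' n, ‖c n‖ * R ^ n := by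
  rw [← (h z (mem_disc.2 (hz.trans_lt hR.2))).tsum_eq]
  refine tsum_of_norm_bounded (h.converges R hR).hasSum fun n => ?_
  rw [norm_mul, norm_pow]
  gcongr

lemma one_sub_pow_le {r : ℝ} (hr : r ∈ Set.Icc (0 : ℝ) 1) (n : ℕ) :
    1 - r ^ n ≤ ((n : ℝ) + 1) * (1 - r) := by
  have h := one_add_mul_le_pow (a := r - 1) (by linarith [hr.1]) n
  have h1 : 1 + (r - 1) = r := by ring
  rw [h1] at h
  nlinarith [hr.2]

lemma HasCoeffs.exists_norm_dilate_sub_le {c : ℕ → ℂ} {f : ℂ → ℂ} (h : HasCoeffs c f) {R : ℝ}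
    (hR : R ∈ Set.Ico (0 : ℝ) 1) :
    ∃ M, 0 ≤ M ∧ ∀ r ∈ Set.Icc (0 : ℝ) 1, ∀ z : ℂ, ‖z‖ ≤ R →
      ‖f (r * z) - f z‖ ≤ M * (1 - r) := by
  have hs := h.converges.succ_mul hR
  have hR0 := hR.1
  refine ⟨∑' n : ℕ, ((n : ℝ) + 1) * (‖c n‖ * R ^ n), tsum_nonneg fun n => by positivity,
    fun r hr z hz => ?_⟩
  have hzd : z ∈ disc := mem_disc.2 (hz.trans_lt hR.2)
  have h1 := (h.dilate hr z hzd).sub (h z hzd)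
  rw [← h1.tsum_eq]
  refine tsum_of_norm_bounded (hs.hasSum.mul_right (1 - r)) fun n => ?_
  have h2 : c n * (r : ℂ) ^ n * z ^ n - c n * z ^ n = c n * z ^ n * (((r ^ n - 1 : ℝ)) : ℂ) := by
    push_cast
    ring
  have hrn : r ^ n ≤ 1 := pow_le_one₀ hr.1 hr.2
  rw [h2, norm_mul, norm_mul, norm_pow, Complex.norm_real, Real.norm_eq_abs, abs_sub_comm,
    abs_of_nonneg (by linarith)]
  have h3 := one_sub_pow_le hr n
  calc ‖c n‖ * ‖z‖ ^ n * (1 - r ^ n) ≤ ‖c n‖ * R ^ n * (((n : ℝ) + 1) * (1 - r)) := by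
        gcongr
    _ = _ := by ring

/-- The `L^1` means over rotation invariant sets increase with the radius. -/
lemma HasCoeffs.setIntegral_dilate_le_of_subset (hω : IsRadialWeight ω) {c : ℕ → ℂ} {f : ℂ → ℂ}
    (h : HasCoeffs c f) {S : Set ℝ} (hS : MeasurableSet S) {R : ℝ} (hR : R ∈ Set.Ioo (0 : ℝ) 1)
    (hSR : ∀ x ∈ S, x ≤ R) {r : ℝ} (hr : r ∈ Set.Ioo (0 : ℝ) 1) :
    ∫ z in {z : ℂ | ‖z‖ ∈ S}, ‖f (r * z)‖ ∂(weightMeasure ω) ≤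
      ∫ z in {z : ℂ | ‖z‖ ∈ S}, ‖f z‖ ∂(weightMeasure ω) := by
  have hfin := hω.isFiniteMeasure
  set A : Set ℂ := {z : ℂ | ‖z‖ ∈ S} with hA
  have hAm : MeasurableSet A := measurableSet_norm_mem hS
  set μ := (weightMeasure ω).restrict A with hμ
  have hAR : ∀ᵐ z ∂μ, ‖z‖ ≤ R := by
    filter_upwards [ae_restrict_mem hAm] with z hz using hSR _ hz
  -- Since ρ > 1 and ρR < 1, the function w ↦ ∫ f(wz) s(z) over the set is holomorphic in a
  -- neighbourhood of the closed unit disc.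
  obtain ⟨ρ, hρ1, hρ2⟩ := exists_between (one_lt_one_div hR.1 hR.2)
  have hρ0 : 0 < ρ := zero_lt_one.trans hρ1
  have hρR : ρ * R ∈ Set.Ico (0 : ℝ) 1 :=
    ⟨by have := hR.1; positivity, by rwa [lt_div_iff₀ hR.1] at hρ2⟩
  have hr' : r ∈ Set.Icc (0 : ℝ) 1 := ⟨hr.1.le, hr.2.le⟩
  have hfr := h.dilate hr'
  -- The sign is frozen at w = r, so that the value there is exactly the mean of |f(rz)|. At zeros
  -- of f(rz) division by zero gives 0, which is harmless.
  set s : ℂ → ℂ := fun z => conj (f (r * z)) / (‖f (r * z)‖ : ℂ) with hs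
  have hsm : AEStronglyMeasurable s μ := by
    have h1 : AEStronglyMeasurable (fun z : ℂ => f (r * z)) μ :=
      (hfr.aestronglyMeasurable (ω := ω)).restrict
    have h2 : AEMeasurable (fun z : ℂ => f (r * z)) μ := h1.aemeasurable
    exact AEMeasurable.aestronglyMeasurable (by
      have h3 : AEMeasurable (fun z : ℂ => conj (f (r * z))) μ :=
        Complex.continuous_conj.measurable.comp_aemeasurable h2
      have h4 : AEMeasurable (fun z : ℂ => (‖f (r * z)‖ : ℂ)) μ :=
        Complex.continuous_ofReal.measurable.comp_aemeasurable h2.norm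
      exact h3.div h4)
  have hs1 : ∀ z, ‖s z‖ ≤ 1 := by
    intro z
    simp only [hs]
    rw [norm_div, RCLike.norm_conj, Complex.norm_real, norm_norm]
    exact div_self_le_one _
  have hsf : ∀ z, f (r * z) * s z = (‖f (r * z)‖ : ℂ) := by
    intro z
    simp only [hs]
    rw [← mul_div_assoc, Complex.mul_conj, Complex.normSq_eq_norm_sq]
    push_cast
    by_cases h0 : (‖f (r * z)‖ : ℂ) = 0
    · simp [h0]
    · rw [pow_two, mul_div_assoc, div_self h0, mul_one]
  let T : ℕ → ℂ → ℂ := fun n w => c n * w ^ n * ∫ z, z ^ n * s z ∂μ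
  have hint : ∀ n : ℕ, Integrable (fun z => z ^ n * s z) μ := by
    intro n
    refine Integrable.of_bound (AEStronglyMeasurable.mul (by fun_prop) hsm) (R ^ n) ?_
    filter_upwards [hAR] with z hz
    rw [norm_mul, norm_pow]
    exact (mul_le_of_le_one_right (by positivity) (hs1 z)).trans
      (pow_le_pow_left₀ (norm_nonneg z) hz n)
  have hnint : ∀ n : ℕ, ∫ z, ‖z ^ n * s z‖ ∂μ ≤ R ^ n * μ.real Set.univ := by
    intro n
    refine (integral_mono_ae (hint n).norm (integrable_const (R ^ n)) ?_).trans (le_of_eq ?_)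
    · filter_upwards [hAR] with z hz
      rw [norm_mul, norm_pow]
      exact (mul_le_of_le_one_right (by positivity) (hs1 z)).trans
        (pow_le_pow_left₀ (norm_nonneg z) hz n)
    · rw [integral_const, smul_eq_mul, mul_comm]
  have hsum : Summable fun n => ‖c n‖ * (ρ * R) ^ n * μ.real Set.univ :=
    (h.converges _ hρR).mul_right _
  have hT : ∀ (n : ℕ), ∀ w ∈ Metric.ball (0 : ℂ) ρ,
      ‖T n w‖ ≤ ‖c n‖ * (ρ * R) ^ n * μ.real Set.univ := by
    intro n w hw
    have hw' : ‖w‖ ≤ ρ := (by simpa using hw : ‖w‖ < ρ).le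
    simp only [T]
    rw [norm_mul, norm_mul, norm_pow]
    calc ‖c n‖ * ‖w‖ ^ n * ‖∫ z, z ^ n * s z ∂μ‖
        ≤ ‖c n‖ * ρ ^ n * (R ^ n * μ.real Set.univ) := by
          gcongr
          exact (norm_integral_le_integral_norm _).trans (hnint n)
      _ = _ := by rw [mul_pow]; ring
  have hΦd : DifferentiableOn ℂ (fun w => ∑' n, T n w) (Metric.ball (0 : ℂ) ρ) :=
    differentiableOn_tsum_of_summable_norm hsum (fun n => by simp only [T]; fun_prop)
      Metric.isOpen_ball hT
  have hΦ : ∀ w : ℂ, ‖w‖ ≤ 1 → ∑' n, T n w = ∫ z, f (w * z) * s z ∂μ := by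
    intro w hw
    have h1 : ∀ n, Integrable (fun z => c n * w ^ n * (z ^ n * s z)) μ := fun n =>
      (hint n).const_mul _
    have h2 : Summable fun n => ∫ z, ‖c n * w ^ n * (z ^ n * s z)‖ ∂μ := by
      refine Summable.of_nonneg_of_le (fun n => integral_nonneg fun z => norm_nonneg _)
        (fun n => ?_) ((h.converges R ⟨hR.1.le, hR.2⟩).mul_right (μ.real Set.univ))
      have h3 : ∀ z, ‖c n * w ^ n * (z ^ n * s z)‖ = ‖c n‖ * ‖w‖ ^ n * ‖z ^ n * s z‖ := by
        intro z
        rw [norm_mul, norm_mul, norm_pow]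
      simp_rw [h3]
      rw [integral_const_mul]
      have hR0 := hR.1
      calc _ ≤ ‖c n‖ * 1 * (R ^ n * μ.real Set.univ) := by
            gcongr
            · exact pow_le_one₀ (norm_nonneg _) hw
            · exact hnint n
        _ = _ := by ring
    have h4 := hasSum_integral_of_summable_integral_norm h1 h2
    have h5 : ∫ z, ∑' n, c n * w ^ n * (z ^ n * s z) ∂μ = ∫ z, f (w * z) * s z ∂μ := by
      refine integral_congr_ae ?_
      filter_upwards [hAR] with z hz
      have hwz : w * z ∈ disc := by
        rw [mem_disc, norm_mul]
        exact (mul_le_of_le_one_left (norm_nonneg z) hw).trans_lt (hz.trans_lt hR.2)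
      rw [← ((h _ hwz).mul_right (s z)).tsum_eq]
      refine tsum_congr fun n => ?_
      rw [mul_pow]
      ring
    rw [← h5, ← h4.tsum_eq]
    refine tsum_congr fun n => ?_
    simp only [T]
    rw [integral_const_mul]
  -- On |w| = 1 rotation invariance bounds the value by the mean of |f|; the maximum principle
  -- carries the bound to w = r.
  have hfront : ∀ w ∈ frontier (Metric.ball (0 : ℂ) 1),
      ‖∑' n, T n w‖ ≤ ∫ z in A, ‖f z‖ ∂(weightMeasure ω) := by
    intro w hw
    have hw1 : ‖w‖ = 1 := by
      rw [frontier_ball _ one_ne_zero] at hw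
      simpa using hw
    rw [hΦ w hw1.le]
    have hrot : ∫ z, ‖f (w * z)‖ ∂μ = ∫ z, ‖f z‖ ∂μ := by
      simp only [hμ]
      rw [← integral_indicator hAm, ← integral_indicator hAm,
        ← integral_rotate_real ω hw1 (A.indicator fun z => ‖f z‖)]
      refine integral_congr_ae (ae_of_all _ fun z => ?_)
      have hzA : w * z ∈ A ↔ z ∈ A := by simp [hA, hw1]
      by_cases hz : z ∈ A
      · simp only [Set.indicator_of_mem hz, Set.indicator_of_mem (hzA.2 hz)]
      · simp only [Set.indicator_of_notMem hz, Set.indicator_of_notMem (fun h => hz (hzA.1 h))]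
    rw [← hrot]
    have hfw : Integrable (fun z => f (w * z)) μ := by
      have hcw : HasCoeffs (fun n => c n * w ^ n) fun z => f (w * z) := by
        intro z hz
        have hwz : w * z ∈ disc := by
          rw [mem_disc, norm_mul, hw1, one_mul]
          exact mem_disc.1 hz
        refine (h _ hwz).congr_fun fun n => ?_
        rw [mul_pow]
        ring
      refine Integrable.of_bound (hcw.aestronglyMeasurable (ω := ω)).restrict
        (∑' n, ‖c n‖ * R ^ n) ?_
      filter_upwards [hAR] with z hz
      exact h.norm_le_tsum ⟨hR.1.le, hR.2⟩ (by rwa [norm_mul, hw1, one_mul])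
    refine (norm_integral_le_integral_norm _).trans (integral_mono_of_nonneg
      (ae_of_all _ fun z => norm_nonneg _) hfw.norm (ae_of_all _ fun z => ?_))
    simp only [norm_mul]
    exact mul_le_of_le_one_right (norm_nonneg _) (hs1 z)
  have hcl : closure (Metric.ball (0 : ℂ) 1) ⊆ Metric.ball 0 ρ :=
    Metric.closure_ball_subset_closedBall.trans (Metric.closedBall_subset_ball hρ1)
  have hmax := Complex.norm_le_of_forall_mem_frontier_norm_le Metric.isBounded_ball
    (hΦd.mono hcl).diffContOnCl hfront (z := (r : ℂ)) (subset_closure (by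
      simp [abs_of_pos hr.1, hr.2]))
  rw [hΦ r (by simp [abs_of_pos hr.1, hr.2.le])] at hmax
  simp_rw [hsf] at hmax
  rw [integral_complex_ofReal, Complex.norm_real] at hmax
  exact (le_abs_self _).trans hmax

lemma HasCoeffs.integrable_dilate (hω : IsRadialWeight ω) {c : ℕ → ℂ} {f : ℂ → ℂ}
    (h : HasCoeffs c f) {r : ℝ} (hr : r ∈ Set.Ioo (0 : ℝ) 1) :
    Integrable (fun z : ℂ => f (r * z)) (weightMeasure ω) := by
  refine hω.integrable_of_bound (h.dilate ⟨hr.1.le, hr.2.le⟩).aestronglyMeasurable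
    (∑' n, ‖c n‖ * r ^ n) fun z hz => h.norm_le_tsum ⟨hr.1.le, hr.2⟩ ?_
  rw [norm_mul, Complex.norm_real, Real.norm_of_nonneg hr.1.le]
  exact mul_le_of_le_one_right hr.1.le (mem_disc.1 hz).le

lemma HasCoeffs.setIntegral_dilate_le (hω : IsRadialWeight ω) {c : ℕ → ℂ} {f : ℂ → ℂ}
    (h : HasCoeffs c f) (hf : Integrable f (weightMeasure ω)) {S : Set ℝ} (hS : MeasurableSet S)
    {r : ℝ} (hr : r ∈ Set.Ioo (0 : ℝ) 1) :
    ∫ z in {z : ℂ | ‖z‖ ∈ S}, ‖f (r * z)‖ ∂(weightMeasure ω) ≤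
      ∫ z in {z : ℂ | ‖z‖ ∈ S}, ‖f z‖ ∂(weightMeasure ω) := by
  have hAm : MeasurableSet {z : ℂ | ‖z‖ ∈ S} := measurableSet_norm_mem hS
  rw [← integral_indicator hAm, ← integral_indicator hAm]
  refine le_of_tendsto_of_tendsto'
    (tendsto_integral_indicator_radius ((h.integrable_dilate hω hr).norm.indicator hAm))
    (tendsto_integral_indicator_radius (hf.norm.indicator hAm)) fun j => ?_
  have hj := measurableSet_norm_mem (measurableSet_Iic (a := radius j))
  rw [Set.indicator_indicator, Set.indicator_indicator, integral_indicator (hj.inter hAm),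
    integral_indicator (hj.inter hAm)]
  have heq : {z : ℂ | ‖z‖ ∈ Set.Iic (radius j)} ∩ {z : ℂ | ‖z‖ ∈ S} =
      {z : ℂ | ‖z‖ ∈ Set.Iic (radius j) ∩ S} := rfl
  rw [heq]
  exact h.setIntegral_dilate_le_of_subset hω (measurableSet_Iic.inter hS) (radius_mem j)
    (fun x hx => hx.1) hr

/-- Dilations converge in the norm of `A^1_ω`. -/
lemma HasCoeffs.tendsto_integral_dilate_sub (hω : IsRadialWeight ω) {c : ℕ → ℂ} {f : ℂ → ℂ}
    (h : HasCoeffs c f) (hf : Integrable f (weightMeasure ω)) :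
    Tendsto (fun r : ℝ => ∫ z, ‖f (r * z) - f z‖ ∂(weightMeasure ω)) (𝓝[<] 1) (𝓝 0) := by
  have hfin := hω.isFiniteMeasure
  rw [Metric.tendsto_nhds]
  intro ε hε
  have hlim := tendsto_integral_indicator_radius hf.norm
  -- Less than ε/4 of the mass of f lies outside the disc of this radius. By monotonicity of the
  -- means the same holds for every dilation of f, while inside the disc convergence is uniform.
  obtain ⟨j, hj⟩ := (hlim.eventually (lt_mem_nhds (sub_lt_self _ (by positivity : 0 < ε / 4)))).exists
  have hR := radius_mem j
  set A : Set ℂ := {z : ℂ | ‖z‖ ∈ Set.Iic (radius j)} with hA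
  have hAm : MeasurableSet A := measurableSet_norm_mem measurableSet_Iic
  have hAc : Aᶜ = {z : ℂ | ‖z‖ ∈ (Set.Iic (radius j))ᶜ} := rfl
  rw [integral_indicator hAm, ← integral_add_compl hAm hf.norm] at hj
  obtain ⟨M, hM0, hM⟩ := h.exists_norm_dilate_sub_le ⟨hR.1.le, hR.2⟩
  have hsmall : Tendsto (fun r : ℝ => M * (1 - r) * (weightMeasure ω).real A) (𝓝[<] 1) (𝓝 0) := by
    have h1 : Tendsto (fun r : ℝ => M * (1 - r) * (weightMeasure ω).real A) (𝓝[<] 1)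
        (𝓝 (M * (1 - 1) * (weightMeasure ω).real A)) :=
      ((by fun_prop : Continuous fun r : ℝ => M * (1 - r) * (weightMeasure ω).real A).tendsto
        1).mono_left nhdsWithin_le_nhds
    simpa using h1
  filter_upwards [Ioo_mem_nhdsLT (zero_lt_one' ℝ),
    hsmall.eventually (gt_mem_nhds (by positivity : 0 < ε / 4))] with r hr hrs
  have hfr := h.integrable_dilate hω hr
  have hsub : Integrable (fun z : ℂ => f (r * z) - f z) (weightMeasure ω) := hfr.sub hf
  rw [Real.dist_eq, sub_zero, abs_of_nonneg (integral_nonneg fun z => norm_nonneg _),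
    ← integral_add_compl hAm hsub.norm]
  have h1 : ∫ z in A, ‖f (r * z) - f z‖ ∂(weightMeasure ω) ≤
      M * (1 - r) * (weightMeasure ω).real A := by
    calc _ ≤ ∫ _z in A, M * (1 - r) ∂(weightMeasure ω) :=
          setIntegral_mono_on hsub.norm.integrableOn (integrable_const _).integrableOn hAm
            fun z hz => hM r ⟨hr.1.le, hr.2.le⟩ z hz
      _ = _ := by rw [setIntegral_const, smul_eq_mul, mul_comm]
  have h2 : ∫ z in Aᶜ, ‖f (r * z) - f z‖ ∂(weightMeasure ω) ≤
      ∫ z in Aᶜ, ‖f (r * z)‖ ∂(weightMeasure ω) + ∫ z in Aᶜ, ‖f z‖ ∂(weightMeasure ω) := by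
    rw [← integral_add hfr.norm.restrict hf.norm.restrict]
    exact integral_mono hsub.norm.restrict (hfr.norm.add hf.norm).restrict
      fun z => norm_sub_le _ _
  have h3 := h.setIntegral_dilate_le hω hf measurableSet_Iic.compl (S := (Set.Iic (radius j))ᶜ) hr
  rw [← hAc] at h3
  linarith

/-! ### The space `A^1_ω` -/

lemma BergmanSpace.integrable (f : BergmanSpace 1 ω) : Integrable f (weightMeasure ω) :=
  memLp_one_iff_integrable.1 f.2

lemma BergmanSpace.norm_eq (f : BergmanSpace 1 ω) :
    ‖f‖ = ∫ z, ‖f z‖ ∂(weightMeasure ω) := by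
  refine (Lp.norm_toLp (f : ℂ → ℂ) f.2).trans ?_
  rw [eLpNorm_one_eq_lintegral_enorm,
    integral_norm_eq_lintegral_enorm f.integrable.aestronglyMeasurable]

/-- The values of a function in a Bergman space. -/
def BergmanSpace.eval (p : ℝ≥0∞) (ω : ℝ → ℝ) : BergmanSpace p ω →ₗ[ℂ] (ℂ → ℂ) where
  toFun f := f
  map_add' _ _ := rfl
  map_smul' _ _ := rfl

lemma BergmanSpace.hasCoeffs {p : ℝ≥0∞} (f : BergmanSpace p ω) : HasCoeffs (coeff f) f :=
  holo.hasCoeffs f.1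

/-- An integrable power series as an element of `A^1_ω`. -/
def bergmanOfSeries {c : ℕ → ℂ} (hc : Converges c)
    (hi : Integrable (sumSeries c) (weightMeasure ω)) : BergmanSpace 1 ω :=
  ⟨ofSeries c hc, memLp_one_iff_integrable.2 hi⟩

lemma hasCoeffs_bergmanOfSeries {c : ℕ → ℂ} (hc : Converges c)
    (hi : Integrable (sumSeries c) (weightMeasure ω)) :
    HasCoeffs c (bergmanOfSeries hc hi : ℂ → ℂ) := hc.hasCoeffs

lemma converges_of_summable {c : ℕ → ℂ} (h : Summable fun n => ‖c n‖) : Converges c :=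
  fun _ hr => Summable.of_nonneg_of_le (fun n => mul_nonneg (norm_nonneg _) (pow_nonneg hr.1 n))
    (fun _ => mul_le_of_le_one_right (norm_nonneg _) (pow_le_one₀ hr.1 hr.2.le)) h

lemma HasCoeffs.norm_le_of_summable {c : ℕ → ℂ} {f : ℂ → ℂ} (h : HasCoeffs c f)
    (hs : Summable fun n => ‖c n‖) {z : ℂ} (hz : z ∈ disc) : ‖f z‖ ≤ ∑' n, ‖c n‖ := by
  rw [← (h z hz).tsum_eq]
  refine tsum_of_norm_bounded hs.hasSum fun n => ?_
  rw [norm_mul, norm_pow]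
  exact mul_le_of_le_one_right (norm_nonneg _) (pow_le_one₀ (norm_nonneg _) (mem_disc.1 hz).le)

lemma HasCoeffs.integrable_of_summable (hω : IsRadialWeight ω) {c : ℕ → ℂ} {f : ℂ → ℂ}
    (h : HasCoeffs c f) (hs : Summable fun n => ‖c n‖) : Integrable f (weightMeasure ω) :=
  hω.integrable_of_bound h.aestronglyMeasurable _ fun _ hz => h.norm_le_of_summable hs hz

lemma IsRadialWeight.integrable_sumSeries (hω : IsRadialWeight ω) {c : ℕ → ℂ}
    (hs : Summable fun n => ‖c n‖) : Integrable (sumSeries c) (weightMeasure ω) :=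
  (converges_of_summable hs).hasCoeffs.integrable_of_summable hω hs

lemma summable_norm_single (k : ℕ) : Summable fun n => ‖(Pi.single k 1 : ℕ → ℂ) n‖ :=
  summable_of_ne_finset_zero (s := {k}) fun n hn => by
    have : n ≠ k := by simpa using hn
    simp [this]

/-- The monomials in `A^p_ω`. -/
def bergmanMono (hω : IsRadialWeight ω) (p : ℝ≥0∞) (k : ℕ) : BergmanSpace p ω :=
  ⟨monomial k, by
    have := hω.isFiniteMeasure
    have h : HasCoeffs (Pi.single k 1) (monomial k : ℂ → ℂ) :=
      (hasCoeffs_monomial k).converges.hasCoeffs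
    exact MemLp.of_bound h.aestronglyMeasurable _ ((ae_mem_disc ω).mono fun z hz =>
      h.norm_le_of_summable (summable_norm_single k) hz)⟩

lemma bergmanMono_apply (hω : IsRadialWeight ω) (p : ℝ≥0∞) (k : ℕ) {z : ℂ} (hz : z ∈ disc) :
    (bergmanMono hω p k : ℂ → ℂ) z = z ^ k := monomial_apply k hz

lemma norm_bergmanMono (hω : IsRadialWeight ω) (k : ℕ) : ‖bergmanMono hω 1 k‖ = moment ω k := by
  rw [BergmanSpace.norm_eq, moment]
  refine integral_congr_ae ?_
  filter_upwards [ae_mem_disc ω] with z hz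
  rw [bergmanMono_apply hω 1 k hz, norm_pow]

/-- The space `A^1_ω` as a space of holomorphic functions with dilations. -/
def bergmanDilationSpace (hω : IsRadialWeight ω) : DilationSpace (BergmanSpace 1 ω) where
  eval := BergmanSpace.eval 1 ω
  differentiableOn f := f.1.2.1
  mono := bergmanMono hω 1
  eval_mono n _ hz := bergmanMono_apply hω 1 n hz
  bound := moment ω 0
  norm_le f a ha hs := by
    have hfin := hω.isFiniteMeasure
    have hs' := summable_norm_of_succ_mul hs
    rw [BergmanSpace.norm_eq, moment_zero]
    calc ∫ z, ‖f z‖ ∂(weightMeasure ω) ≤ ∫ _z, ∑' n, ‖a n‖ ∂(weightMeasure ω) :=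
          integral_mono_ae f.integrable.norm (integrable_const _)
            ((ae_mem_disc ω).mono fun z hz => ha.norm_le_of_summable hs' hz)
      _ = (weightMeasure ω).real Set.univ * ∑' n, ‖a n‖ := by
          rw [integral_const, smul_eq_mul]
      _ ≤ _ := by
          refine mul_le_mul_of_nonneg_left (hs'.tsum_le_tsum (fun n => ?_) hs) measureReal_nonneg
          exact le_mul_of_one_le_left (norm_nonneg _) (by linarith [n.cast_nonneg (α := ℝ)])
  exists_dilate f := by
    classical
    have hf := f.hasCoeffs
    have hs : ∀ r ∈ Set.Ioo (0 : ℝ) 1, Summable fun n => ‖coeff f n * (r : ℂ) ^ n‖ := fun r hr =>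
      summable_norm_of_succ_mul (hf.converges.summable_dilate hr)
    let D : ℝ → BergmanSpace 1 ω := fun r =>
      if hr : r ∈ Set.Ioo (0 : ℝ) 1 then
        bergmanOfSeries (converges_of_summable (hs r hr)) (hω.integrable_sumSeries (hs r hr))
      else 0
    have hD : ∀ r ∈ Set.Ioo (0 : ℝ) 1, ∀ z ∈ disc, (D r : ℂ → ℂ) z = f (r * z) := by
      intro r hr z hz
      simp only [D, dif_pos hr]
      exact (hasCoeffs_bergmanOfSeries _ _ z hz).unique (hf.dilate ⟨hr.1.le, hr.2.le⟩ z hz)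
    refine ⟨D, hD, ?_⟩
    rw [tendsto_iff_norm_sub_tendsto_zero]
    refine (hf.tendsto_integral_dilate_sub hω f.integrable).congr' ?_
    filter_upwards [Ioo_mem_nhdsLT (zero_lt_one' ℝ)] with r hr
    rw [BergmanSpace.norm_eq]
    refine integral_congr_ae ?_
    filter_upwards [ae_mem_disc ω] with z hz
    rw [← hD r hr z hz]
    rfl

/-! ### The Bloch space -/

lemma Bloch.norm_eq (f : Bloch) : ‖f‖ = (⨆ z : disc, blochQuantity f z) + ‖f 0‖ := rfl

lemma Bloch.hasCoeffs (f : Bloch) : HasCoeffs (coeff f) f := holo.hasCoeffs f.1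

lemma Bloch.blochQuantity_le (f : Bloch) {z : ℂ} (hz : z ∈ disc) : blochQuantity f z ≤ ‖f‖ := by
  have h1 : blochQuantity f z ≤ ⨆ z : disc, blochQuantity f z := le_ciSup f.2 (⟨z, hz⟩ : disc)
  rw [Bloch.norm_eq]
  linarith [norm_nonneg (f 0)]

lemma Bloch.norm_apply_zero_le (f : Bloch) : ‖f 0‖ ≤ ‖f‖ := by
  have h1 : 0 ≤ ⨆ z : disc, blochQuantity f z :=
    Real.iSup_nonneg fun z => blochQuantity_nonneg f z
  rw [Bloch.norm_eq]
  linarith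

lemma Bloch.norm_le (f : Bloch) {B : ℝ} (hB : ∀ z ∈ disc, blochQuantity f z ≤ B) :
    ‖f‖ ≤ B + ‖f 0‖ := by
  rw [Bloch.norm_eq]
  gcongr
  exact ciSup_le fun z => hB z z.2

/-- A holomorphic function with bounded Bloch quantity as an element of the Bloch space. -/
def Bloch.mk (f : holo) (B : ℝ) (hB : ∀ z ∈ disc, blochQuantity f z ≤ B) : Bloch :=
  ⟨f, B, by rintro _ ⟨z, rfl⟩; exact hB z z.2⟩

lemma norm_derivCoeff (a : ℕ → ℂ) (n : ℕ) : ‖derivCoeff a n‖ = ((n : ℝ) + 1) * ‖a (n + 1)‖ := by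
  rw [derivCoeff, norm_mul]
  congr 1
  rw [← Nat.cast_one, ← Nat.cast_add, Complex.norm_natCast]
  push_cast
  rfl

/-- The coefficients of a Bloch function are bounded. -/
lemma Bloch.norm_coeff_le (f : Bloch) {a : ℕ → ℂ} (ha : HasCoeffs a f) (n : ℕ) :
    ‖a n‖ ≤ 6 * ‖f‖ := by
  have hf := norm_nonneg f
  rcases n with _ | n
  · rw [← ha.apply_zero]
    linarith [f.norm_apply_zero_le]
  · have hn : (0 : ℝ) ≤ n := n.cast_nonneg
    -- At this radius 1 - r = 1/(n+2) and r^(-n) ≤ e < 3. Cauchy's estimate for f' and n + 2 ≤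
    -- 2(n+1) then give the constant 6.
    set r : ℝ := ((n : ℝ) + 1) / (n + 2) with hr
    have hr0 : 0 < r := by positivity
    have hr1 : r < 1 := by
      rw [hr, div_lt_one (by positivity)]
      linarith
    have h1 : 1 - r = 1 / ((n : ℝ) + 2) := by
      rw [hr]
      field_simp
      ring
    have hC : ∀ z : ℂ, ‖z‖ = r → ‖deriv f z‖ ≤ ((n : ℝ) + 2) * ‖f‖ := by
      intro z hz
      have h2 := f.blochQuantity_le (mem_disc.2 (hz.trans_lt hr1))
      unfold blochQuantity at h2
      rw [hz] at h2
      have h3 : 1 / ((n : ℝ) + 2) ≤ 1 - r ^ 2 := by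
        rw [← h1]
        nlinarith
      have h4 : ‖deriv f z‖ * (1 / ((n : ℝ) + 2)) ≤ ‖f‖ :=
        (mul_le_mul_of_nonneg_left h3 (norm_nonneg _)).trans h2
      rw [mul_one_div, div_le_iff₀ (by positivity)] at h4
      linarith
    have h5 := ha.deriv.norm_le ⟨hr0, hr1⟩ hC n
    have h6 : 1 ≤ 3 * r ^ n := by
      have h7 : 1 ≤ Real.exp (1 / ((n : ℝ) + 1)) * r := by
        have h8 := Real.add_one_le_exp (1 / ((n : ℝ) + 1))
        have h9 : 1 = (1 / ((n : ℝ) + 1) + 1) * r := by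
          rw [hr]
          field_simp
          ring
        exact h9.le.trans (mul_le_mul_of_nonneg_right h8 hr0.le)
      have h10 := one_le_pow₀ (n := n) h7
      rw [mul_pow, ← Real.exp_nat_mul] at h10
      refine h10.trans (mul_le_mul_of_nonneg_right ?_ (by positivity))
      refine le_trans (Real.exp_le_exp.2 ?_) Real.exp_one_lt_three.le
      rw [mul_one_div, div_le_one (by positivity)]
      linarith
    rw [norm_derivCoeff] at h5
    have ha0 := norm_nonneg (a (n + 1))
    have h12 : ((n : ℝ) + 1) * ‖a (n + 1)‖ ≤ 3 * (((n : ℝ) + 2) * ‖f‖) := by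
      calc ((n : ℝ) + 1) * ‖a (n + 1)‖ ≤ ((n : ℝ) + 1) * ‖a (n + 1)‖ * (3 * r ^ n) :=
            le_mul_of_one_le_right (by positivity) h6
        _ = 3 * (((n : ℝ) + 1) * ‖a (n + 1)‖ * r ^ n) := by ring
        _ ≤ _ := by linarith
    have h13 : ((n : ℝ) + 1) * ‖a (n + 1)‖ ≤ ((n : ℝ) + 1) * (6 * ‖f‖) := by nlinarith
    exact le_of_mul_le_mul_left h13 (by positivity)

lemma HasCoeffs.norm_deriv_le {a : ℕ → ℂ} {f : ℂ → ℂ} (h : HasCoeffs a f)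
    (hs : Summable fun n : ℕ => ((n : ℝ) + 1) * ‖a n‖) {z : ℂ} (hz : z ∈ disc) :
    ‖_root_.deriv f z‖ + ‖a 0‖ ≤ ∑' n : ℕ, ((n : ℝ) + 1) * ‖a n‖ := by
  have hs1 := (summable_nat_add_iff 1).2 hs
  have hle : ∀ n : ℕ, ‖derivCoeff a n‖ ≤ (((n + 1 : ℕ) : ℝ) + 1) * ‖a (n + 1)‖ := by
    intro n
    rw [norm_derivCoeff]
    gcongr
    linarith
  have hsd : Summable fun n => ‖derivCoeff a n‖ :=
    Summable.of_nonneg_of_le (fun n => norm_nonneg _) hle hs1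
  have h1 := (h.deriv.norm_le_of_summable hsd hz).trans (hsd.tsum_le_tsum hle hs1)
  rw [hs.tsum_eq_zero_add]
  simp only [Nat.cast_zero, zero_add, one_mul]
  linarith

lemma blochQuantity_le_norm_deriv (f : ℂ → ℂ) (z : ℂ) : blochQuantity f z ≤ ‖deriv f z‖ :=
  mul_le_of_le_one_right (norm_nonneg _) (by nlinarith [norm_nonneg z])

lemma eventually_mem_disc :
    ∀ᶠ z : ℂ in comap (fun z : ℂ => ‖z‖) (𝓝[<] 1), z ∈ disc :=
  (eventually_mem_nhdsWithin.comap _).mono fun _ hz => mem_disc.2 hz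

/-- A Bloch function with bounded derivative belongs to the little Bloch space. -/
lemma mem_littleBloch_of_norm_deriv_le (f : Bloch) {B : ℝ} (hB : ∀ z ∈ disc, ‖deriv f z‖ ≤ B) :
    f ∈ LittleBloch := by
  have h1 : Tendsto (fun z : ℂ => B * (1 - ‖z‖ ^ 2)) (comap (fun z : ℂ => ‖z‖) (𝓝[<] 1)) (𝓝 0) := by
    have h2 : Tendsto (fun x : ℝ => B * (1 - x ^ 2)) (𝓝[<] 1) (𝓝 (B * (1 - 1 ^ 2))) :=
      ((by fun_prop : Continuous fun x : ℝ => B * (1 - x ^ 2)).tendsto 1).mono_left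
        nhdsWithin_le_nhds
    rw [one_pow, sub_self, mul_zero] at h2
    exact h2.comp tendsto_comap
  refine squeeze_zero' (eventually_mem_disc.mono fun z hz => blochQuantity_nonneg f ⟨z, hz⟩)
    (eventually_mem_disc.mono fun z hz => ?_) h1
  refine mul_le_mul_of_nonneg_right (hB z hz) ?_
  have := mem_disc.1 hz
  nlinarith [norm_nonneg z]

/-- A power series with summable coefficients of the derivative, in the little Bloch space. -/
def littleBlochOfSeries {a : ℕ → ℂ} (hs : Summable fun n : ℕ => ((n : ℝ) + 1) * ‖a n‖) :
    LittleBloch :=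
  have ha : HasCoeffs a (ofSeries a (converges_of_summable (summable_norm_of_succ_mul hs))) :=
    (converges_of_summable (summable_norm_of_succ_mul hs)).hasCoeffs
  have hd : ∀ z ∈ disc, ‖deriv (ofSeries a (converges_of_summable (summable_norm_of_succ_mul hs)) :
      ℂ → ℂ) z‖ ≤ ∑' n : ℕ, ((n : ℝ) + 1) * ‖a n‖ := fun z hz => by
    linarith [ha.norm_deriv_le hs hz, norm_nonneg (a 0)]
  ⟨Bloch.mk (ofSeries a (converges_of_summable (summable_norm_of_succ_mul hs))) _
    fun z hz => (blochQuantity_le_norm_deriv _ z).trans (hd z hz),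
    mem_littleBloch_of_norm_deriv_le _ hd⟩

lemma hasCoeffs_littleBlochOfSeries {a : ℕ → ℂ}
    (hs : Summable fun n : ℕ => ((n : ℝ) + 1) * ‖a n‖) :
    HasCoeffs a ((littleBlochOfSeries hs : Bloch) : ℂ → ℂ) :=
  (converges_of_summable (summable_norm_of_succ_mul hs)).hasCoeffs

lemma summable_succ_mul_norm_single (k : ℕ) :
    Summable fun n : ℕ => ((n : ℝ) + 1) * ‖(Pi.single k 1 : ℕ → ℂ) n‖ :=
  summable_of_ne_finset_zero (s := {k}) fun n hn => by
    have : n ≠ k := by simpa using hn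
    simp [this]

/-- The values of a function in the little Bloch space. -/
def LittleBloch.eval : LittleBloch →ₗ[ℂ] (ℂ → ℂ) where
  toFun f := (f : Bloch)
  map_add' _ _ := rfl
  map_smul' _ _ := rfl

lemma deriv_dilate {a : ℕ → ℂ} {f : ℂ → ℂ} (h : HasCoeffs a f) {r : ℝ}
    (hr : r ∈ Set.Icc (0 : ℝ) 1) {z : ℂ} (hz : z ∈ disc) {g : ℂ → ℂ}
    (hg : ∀ z ∈ disc, g z = f (r * z)) : deriv g z = r * deriv f (r * z) := by
  have hrz : (r : ℂ) * z ∈ disc := by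
    rw [mem_disc] at hz ⊢
    rw [norm_mul, Complex.norm_real, Real.norm_of_nonneg hr.1]
    exact (mul_le_of_le_one_left (norm_nonneg z) hr.2).trans_lt hz
  have heq : g =ᶠ[𝓝 z] fun z => f (r * z) := by
    filter_upwards [isOpen_disc.mem_nhds hz] with w hw using hg w hw
  rw [heq.deriv_eq]
  have h1 : HasDerivAt f (deriv f (r * z)) (r * z) :=
    (h.differentiableOn.differentiableAt (isOpen_disc.mem_nhds hrz)).hasDerivAt
  have h2 : HasDerivAt (fun z : ℂ => (r : ℂ) * z) r z := by
    simpa using (hasDerivAt_id z).const_mul (r : ℂ)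
  exact (h1.comp z h2).deriv.trans (mul_comm _ _)

lemma blochQuantity_dilate_le {a : ℕ → ℂ} {f : ℂ → ℂ} (h : HasCoeffs a f) {r : ℝ}
    (hr : r ∈ Set.Icc (0 : ℝ) 1) {z : ℂ} (hz : z ∈ disc) {g : ℂ → ℂ}
    (hg : ∀ z ∈ disc, g z = f (r * z)) : blochQuantity g z ≤ blochQuantity f (r * z) := by
  have hz1 := mem_disc.1 hz
  have hn : ‖(r : ℂ) * z‖ ≤ ‖z‖ := by
    rw [norm_mul, Complex.norm_real, Real.norm_of_nonneg hr.1]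
    exact mul_le_of_le_one_left (norm_nonneg z) hr.2
  unfold blochQuantity
  rw [deriv_dilate h hr hz hg, norm_mul, Complex.norm_real, Real.norm_of_nonneg hr.1]
  have h0 := norm_nonneg ((r : ℂ) * z)
  refine mul_le_mul (mul_le_of_le_one_left (norm_nonneg _) hr.2) ?_ ?_ (norm_nonneg _)
  · gcongr
  · nlinarith [norm_nonneg z]

/-- The little Bloch space as a space of holomorphic functions with dilations. -/
def littleBlochDilationSpace : DilationSpace LittleBloch where
  eval := LittleBloch.eval
  differentiableOn f := (f : Bloch).1.2.1
  mono n := littleBlochOfSeries (summable_succ_mul_norm_single n)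
  eval_mono n z hz :=
    (hasCoeffs_littleBlochOfSeries (summable_succ_mul_norm_single n) z hz).unique (hasCoeffs_monomial n z hz)
  bound := 1
  norm_le f a ha hs := by
    have ha' : HasCoeffs a (f : Bloch) := ha
    rw [one_mul, Submodule.coe_norm]
    have h1 : ∀ z ∈ disc, blochQuantity (f : Bloch) z ≤
        (∑' n : ℕ, ((n : ℝ) + 1) * ‖a n‖) - ‖a 0‖ := fun z hz => by
      linarith [ha'.norm_deriv_le hs hz, blochQuantity_le_norm_deriv (f : Bloch) z]
    have h2 := (f : Bloch).norm_le h1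
    rw [ha'.apply_zero] at h2
    linarith
  exists_dilate f := by
    classical
    have hf : HasCoeffs (coeff (f : Bloch)) (f : Bloch) := (f : Bloch).hasCoeffs
    let D : ℝ → LittleBloch := fun r =>
      if hr : r ∈ Set.Ioo (0 : ℝ) 1 then littleBlochOfSeries (hf.converges.summable_dilate hr)
      else 0
    have hD : ∀ r ∈ Set.Ioo (0 : ℝ) 1, ∀ z ∈ disc,
        ((D r : Bloch) : ℂ → ℂ) z = (f : Bloch) (r * z) := by
      intro r hr z hz
      simp only [D, dif_pos hr]
      exact (hasCoeffs_littleBlochOfSeries _ z hz).unique (hf.dilate ⟨hr.1.le, hr.2.le⟩ z hz)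
    refine ⟨D, hD, ?_⟩
    rw [Metric.tendsto_nhds]
    intro ε hε
    have hlim : Tendsto (blochQuantity (f : Bloch)) (comap (fun z : ℂ => ‖z‖) (𝓝[<] 1)) (𝓝 0) := f.2
    have hev := hlim.eventually (gt_mem_nhds (by positivity : 0 < ε / 4))
    rw [eventually_comap] at hev
    obtain ⟨R₀, hR₀, hev⟩ := (mem_nhdsLT_iff_exists_Ioo_subset' (zero_lt_one' ℝ)).1 hev
    have hsmall : ∀ z ∈ disc, R₀ < ‖z‖ → blochQuantity (f : Bloch) z < ε / 4 := fun z hz hRz =>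
      hev ⟨hRz, mem_disc.1 hz⟩ z rfl
    obtain ⟨R, hR, hR1⟩ := exists_between (max_lt hR₀ (zero_lt_one' ℝ))
    have hR0 : 0 < R := (le_max_right _ _).trans_lt hR
    have hRR : R₀ < R := (le_max_left _ _).trans_lt hR
    obtain ⟨M, hM0, hM⟩ := hf.deriv.exists_norm_dilate_sub_le ⟨hR0.le, hR1⟩
    set M' := ∑' n, ‖derivCoeff (coeff (f : Bloch)) n‖ * R ^ n with hM'
    have hsmall2 : Tendsto (fun r : ℝ => (M + M') * (1 - r)) (𝓝[<] 1) (𝓝 0) := by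
      have h1 : Tendsto (fun r : ℝ => (M + M') * (1 - r)) (𝓝[<] 1) (𝓝 ((M + M') * (1 - 1))) :=
        ((by fun_prop : Continuous fun r : ℝ => (M + M') * (1 - r)).tendsto 1).mono_left
          nhdsWithin_le_nhds
      simpa using h1
    -- For |z| > R the dilated point rz must also lie in the region where the Bloch quantity of f is
    -- small.
    have hclose : ∀ᶠ r : ℝ in 𝓝[<] 1, R₀ < r * R := by
      have h1 : Tendsto (fun r : ℝ => r * R) (𝓝[<] 1) (𝓝 (1 * R)) :=
        ((by fun_prop : Continuous fun r : ℝ => r * R).tendsto 1).mono_left nhdsWithin_le_nhds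
      rw [one_mul] at h1
      exact h1.eventually (lt_mem_nhds hRR)
    filter_upwards [Ioo_mem_nhdsLT (zero_lt_one' ℝ), hclose,
      hsmall2.eventually (gt_mem_nhds (by positivity : 0 < ε / 2))] with r hr hrR hrM
    have hr' : r ∈ Set.Icc (0 : ℝ) 1 := ⟨hr.1.le, hr.2.le⟩
    rw [dist_eq_norm, Submodule.coe_norm]
    have hzero : ((D r - f : LittleBloch) : Bloch) 0 = 0 := by
      have h1 : ((D r - f : LittleBloch) : Bloch) 0 = (D r : Bloch) 0 - (f : Bloch) 0 := rfl
      rw [h1, hD r hr 0 (by simp [disc]), mul_zero, sub_self]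
    have hq : ∀ z ∈ disc, blochQuantity ((D r - f : LittleBloch) : Bloch) z ≤ ε / 2 := by
      intro z hz
      have hz1 := mem_disc.1 hz
      rcases le_or_gt ‖z‖ R with hzR | hzR
      · refine (blochQuantity_le_norm_deriv _ z).trans (le_trans ?_ hrM.le)
        have h1 : deriv (((D r - f : LittleBloch) : Bloch) : ℂ → ℂ) z =
            deriv ((D r : Bloch) : ℂ → ℂ) z - deriv ((f : Bloch) : ℂ → ℂ) z :=
          deriv_sub (differentiableAt_of_mem (D r : Bloch).1 ⟨z, hz⟩)
            (differentiableAt_of_mem (f : Bloch).1 ⟨z, hz⟩)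
        rw [h1, deriv_dilate hf hr' hz (hD r hr)]
        have h2 : (r : ℂ) * deriv ((f : Bloch) : ℂ → ℂ) (r * z) - deriv ((f : Bloch) : ℂ → ℂ) z =
            (r : ℂ) * (deriv ((f : Bloch) : ℂ → ℂ) (r * z) - deriv ((f : Bloch) : ℂ → ℂ) z) -
              ((1 - r : ℝ) : ℂ) * deriv ((f : Bloch) : ℂ → ℂ) z := by
          push_cast
          ring
        have h3 := hM r hr' z hzR
        have h4 := hf.deriv.norm_le_tsum ⟨hR0.le, hR1⟩ hzR
        rw [h2]
        refine (norm_sub_le _ _).trans ?_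
        rw [norm_mul, norm_mul, Complex.norm_real, Complex.norm_real, Real.norm_of_nonneg hr.1.le,
          Real.norm_of_nonneg (by linarith [hr.2]), add_mul]
        refine add_le_add ((mul_le_of_le_one_left (norm_nonneg _) hr.2.le).trans h3) ?_
        rw [mul_comm]
        exact mul_le_mul_of_nonneg_right h4 (by linarith [hr.2])
      · have h1 : blochQuantity ((D r - f : LittleBloch) : Bloch) z ≤
            blochQuantity (D r : Bloch) z + blochQuantity (f : Bloch) z := by
          have h2 := blochQuantity_add (D r : Bloch).1 (((-1 : ℂ) • (f : Bloch)).1) ⟨z, hz⟩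
          have h3 := blochQuantity_smul (-1) (f : Bloch).1 ⟨z, hz⟩
          have h4 : ((D r - f : LittleBloch) : Bloch) = (D r : Bloch) + (-1 : ℂ) • (f : Bloch) := by
            rw [neg_one_smul, ← sub_eq_add_neg]
            rfl
          rw [norm_neg, norm_one, one_mul] at h3
          rw [h4]
          exact h2.trans (add_le_add le_rfl h3.le)
        have hrz : ‖(r : ℂ) * z‖ = r * ‖z‖ := by
          rw [norm_mul, Complex.norm_real, Real.norm_of_nonneg hr.1.le]
        have hrzd : (r : ℂ) * z ∈ disc := by
          rw [mem_disc, hrz]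
          exact mul_lt_one_of_nonneg_of_lt_one_left hr.1.le hr.2 hz1.le
        have h5 := blochQuantity_dilate_le hf hr' hz (hD r hr)
        have h6 := hsmall _ hrzd (by
          rw [hrz]
          exact hrR.trans (mul_lt_mul_of_pos_left hzR hr.1))
        have h7 := hsmall z hz (hRR.trans hzR)
        linarith
    have := Bloch.norm_le _ hq
    rw [hzero, norm_zero] at this
    linarith

/-! ### The reproducing kernel and the projection -/

/-- The coefficients of the reproducing kernel. -/
def kernelCoeff (ω : ℝ → ℝ) (z : ℂ) (n : ℕ) : ℂ := conj z ^ n / (moment ω (2 * n) : ℂ)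

lemma IsRadialWeight.summable_kernelCoeff (hω : IsRadialWeight ω) {z : ℂ} (hz : z ∈ disc) :
    Summable fun n => ‖kernelCoeff ω z n‖ := by
  have h := hω.converges_div_moment (b := fun _ => 1) (B := 1) (fun _ => by simp) ‖z‖
    ⟨norm_nonneg z, mem_disc.1 hz⟩
  refine h.congr fun n => ?_
  rw [kernelCoeff, norm_div, norm_div, norm_pow, RCLike.norm_conj, norm_one]
  ring

/-- Testing the reproducing property on monomials determines every coefficient; this identifies the
chosen `kernel`. -/
lemma IsReproducingKernel.hasCoeffs (hω : IsRadialWeight ω) {z : ℂ} (hz : z ∈ disc)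
    {k : BergmanSpace 2 ω} (hk : IsReproducingKernel ω z k) : HasCoeffs (kernelCoeff ω z) k := by
  have hfin := hω.isFiniteMeasure
  have hki : Integrable k (weightMeasure ω) := k.2.integrable one_le_two
  have hc := k.hasCoeffs
  have heq : coeff k = kernelCoeff ω z := by
    funext n
    have h1 := hk (bergmanMono hω 2 n)
    rw [bergmanMono_apply hω 2 n hz] at h1
    have h2 : ∫ ζ, (bergmanMono hω 2 n : ℂ → ℂ) ζ * conj (k ζ) ∂(weightMeasure ω) =
        ∫ ζ, ζ ^ n * conj (k ζ) ∂(weightMeasure ω) := by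
      refine integral_congr_ae ?_
      filter_upwards [ae_mem_disc ω] with ζ hζ
      rw [bergmanMono_apply hω 2 n hζ]
    rw [h2, hc.integral_pow_mul_conj hω hki] at h1
    have hm : (moment ω (2 * n) : ℂ) ≠ 0 := by exact_mod_cast (hω.moment_pos _).ne'
    have h3 := congrArg conj h1
    rw [map_mul, Complex.conj_conj, Complex.conj_ofReal, map_pow] at h3
    rw [kernelCoeff, h3]
    field_simp
  exact heq ▸ hc

/-- The candidate series has absolutely summable coefficients, so it is bounded in the disc, lies in
A^2, and can be integrated termwise against any f. -/
lemma IsRadialWeight.exists_isReproducingKernel (hω : IsRadialWeight ω) {z : ℂ} (hz : z ∈ disc) :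
    ∃ k, IsReproducingKernel ω z k := by
  have hfin := hω.isFiniteMeasure
  have hs := hω.summable_kernelCoeff hz
  have hc : HasCoeffs (kernelCoeff ω z) (ofSeries (kernelCoeff ω z) (converges_of_summable hs)) :=
    (converges_of_summable hs).hasCoeffs
  let k : BergmanSpace 2 ω := ⟨ofSeries (kernelCoeff ω z) (converges_of_summable hs),
    MemLp.of_bound hc.aestronglyMeasurable _ ((ae_mem_disc ω).mono fun ζ hζ =>
      hc.norm_le_of_summable hs hζ)⟩
  refine ⟨k, fun f => ?_⟩
  have hf := f.hasCoeffs
  have hfi : Integrable f (weightMeasure ω) := f.2.integrable one_le_two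
  have hck : HasCoeffs (kernelCoeff ω z) k := hc
  have h1 := (hck.hasSum_integral_mul_conj hs hfi).2
  have h2 := h1.map (starRingEnd ℂ) Complex.continuous_conj
  have h3 : conj (∫ ζ, k ζ * conj (f ζ) ∂(weightMeasure ω)) =
      ∫ ζ, f ζ * conj (k ζ) ∂(weightMeasure ω) := by
    rw [← integral_conj]
    refine integral_congr_ae (ae_of_all _ fun ζ => ?_)
    simp only [map_mul, Complex.conj_conj]
    ring
  rw [h3] at h2
  refine (hf z hz).unique (h2.congr_fun fun n => ?_)
  have hm : (moment ω (2 * n) : ℂ) ≠ 0 := by exact_mod_cast (hω.moment_pos _).ne'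
  simp only [Function.comp_apply]
  rw [hf.integral_pow_mul_conj hω hfi, kernelCoeff, map_mul, map_mul, map_div₀, map_pow,
    Complex.conj_conj, Complex.conj_conj, Complex.conj_ofReal]
  field_simp

lemma IsRadialWeight.hasCoeffs_kernel (hω : IsRadialWeight ω) {z : ℂ} (hz : z ∈ disc) :
    HasCoeffs (kernelCoeff ω z) (kernel ω z) := by
  have h := hω.exists_isReproducingKernel hz
  have h1 : IsReproducingKernel ω z (kernel ω z) := by
    rw [kernel, dif_pos h]
    exact h.choose_spec
  exact h1.hasCoeffs hω hz

/-- The power series of the projection. -/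
lemma IsRadialWeight.hasSum_projection (hω : IsRadialWeight ω) {f : ℂ → ℂ}
    (hf : Integrable f (weightMeasure ω)) {z : ℂ} (hz : z ∈ disc) :
    HasSum (fun n => conj (∫ ζ, ζ ^ n * conj (f ζ) ∂(weightMeasure ω)) / moment ω (2 * n) * z ^ n)
      (projection ω f z) := by
  have h1 := ((hω.hasCoeffs_kernel hz).hasSum_integral_mul_conj (hω.summable_kernelCoeff hz) hf).2
  have h2 := h1.map (starRingEnd ℂ) Complex.continuous_conj
  have h3 : conj (∫ ζ, kernel ω z ζ * conj (f ζ) ∂(weightMeasure ω)) = projection ω f z := by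
    rw [← integral_conj, projection]
    refine integral_congr_ae (ae_of_all _ fun ζ => ?_)
    simp only [map_mul, Complex.conj_conj]
    ring
  rw [h3] at h2
  refine h2.congr_fun fun n => ?_
  simp only [Function.comp_apply]
  rw [kernelCoeff, map_mul, map_div₀, map_pow, Complex.conj_conj, Complex.conj_ofReal]
  ring

/-! ### Functionals on `A^1_ω` -/

lemma BergmanSpace.integrable_mul_conj (f : BergmanSpace 1 ω) {h : ℂ → ℂ}
    (hm : AEStronglyMeasurable h (weightMeasure ω)) {B : ℝ}
    (hB : ∀ᵐ z ∂(weightMeasure ω), ‖h z‖ ≤ B) :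
    Integrable (fun z => f z * conj (h z)) (weightMeasure ω) :=
  f.integrable.mul_bdd (c := B) (Complex.continuous_conj.comp_aestronglyMeasurable hm)
    (by filter_upwards [hB] with z hz; simpa using hz)

lemma BergmanSpace.norm_integral_mul_conj_le (f : BergmanSpace 1 ω) {h : ℂ → ℂ}
    (hm : AEStronglyMeasurable h (weightMeasure ω)) {B : ℝ}
    (hB : ∀ᵐ z ∂(weightMeasure ω), ‖h z‖ ≤ B) :
    ‖∫ z, f z * conj (h z) ∂(weightMeasure ω)‖ ≤ B * ‖f‖ := by
  rw [BergmanSpace.norm_eq, ← integral_const_mul]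
  refine (norm_integral_le_integral_norm _).trans
    (integral_mono_ae (f.integrable_mul_conj hm hB).norm (f.integrable.norm.const_mul _) ?_)
  filter_upwards [hB] with z hz
  rw [norm_mul, RCLike.norm_conj, mul_comm]
  exact mul_le_mul_of_nonneg_right hz (norm_nonneg _)

/-- The functional `f ↦ ∫ f conj(h) ω dA` on `A^1_ω` induced by a bounded function. -/
def boundedFunctional (h : ℂ → ℂ) (hm : AEStronglyMeasurable h (weightMeasure ω)) (B : ℝ)
    (hB : ∀ᵐ z ∂(weightMeasure ω), ‖h z‖ ≤ B) : StrongDual ℂ (BergmanSpace 1 ω) :=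
  LinearMap.mkContinuous
    { toFun := fun f => ∫ z, f z * conj (h z) ∂(weightMeasure ω)
      map_add' := fun f g => by
        rw [← integral_add (f.integrable_mul_conj hm hB) (g.integrable_mul_conj hm hB)]
        refine integral_congr_ae (ae_of_all _ fun z => ?_)
        exact add_mul (f z) (g z) (conj (h z))
      map_smul' := fun c f => by
        rw [RingHom.id_apply, smul_eq_mul, ← integral_const_mul]
        refine integral_congr_ae (ae_of_all _ fun z => ?_)
        exact mul_assoc c (f z) (conj (h z)) } B fun f => f.norm_integral_mul_conj_le hm hB

lemma boundedFunctional_apply (h : ℂ → ℂ) (hm : AEStronglyMeasurable h (weightMeasure ω)) (B : ℝ)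
    (hB : ∀ᵐ z ∂(weightMeasure ω), ‖h z‖ ≤ B) (f : BergmanSpace 1 ω) :
    boundedFunctional h hm B hB f = ∫ z, f z * conj (h z) ∂(weightMeasure ω) := rfl

lemma boundedFunctional_mono (hω : IsRadialWeight ω) (h : ℂ → ℂ)
    (hm : AEStronglyMeasurable h (weightMeasure ω)) (B : ℝ)
    (hB : ∀ᵐ z ∂(weightMeasure ω), ‖h z‖ ≤ B) (n : ℕ) :
    boundedFunctional h hm B hB (bergmanMono hω 1 n) =
      ∫ z, z ^ n * conj (h z) ∂(weightMeasure ω) := by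
  rw [boundedFunctional_apply]
  refine integral_congr_ae ?_
  filter_upwards [ae_mem_disc ω] with z hz
  rw [bergmanMono_apply hω 1 n hz]

lemma norm_boundedFunctional_le (h : ℂ → ℂ) (hm : AEStronglyMeasurable h (weightMeasure ω)) {B : ℝ}
    (hB0 : 0 ≤ B) (hB : ∀ᵐ z ∂(weightMeasure ω), ‖h z‖ ≤ B) :
    ‖boundedFunctional h hm B hB‖ ≤ B :=
  ContinuousLinearMap.opNorm_le_bound _ hB0 fun f => f.norm_integral_mul_conj_le hm hB

/-- The coefficients of the function representing a functional. -/
def dualCoeff (hω : IsRadialWeight ω) (L : StrongDual ℂ (BergmanSpace 1 ω)) (n : ℕ) : ℂ :=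
  conj (L (bergmanMono hω 1 n)) / (moment ω (2 * n) : ℂ)

lemma converges_dualCoeff (hω : IsRadialWeight ω) (L : StrongDual ℂ (BergmanSpace 1 ω)) :
    Converges (dualCoeff hω L) := by
  refine hω.converges_div_moment (B := ‖L‖ * moment ω 0) fun n => ?_
  rw [RCLike.norm_conj]
  refine (L.le_opNorm _).trans (mul_le_mul_of_nonneg_left ?_ (norm_nonneg _))
  rw [norm_bergmanMono]
  exact hω.moment_anti (Nat.zero_le n)

lemma conj_dualCoeff_mul (hω : IsRadialWeight ω) (L : StrongDual ℂ (BergmanSpace 1 ω)) (n : ℕ) :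
    conj (dualCoeff hω L n) * moment ω (2 * n) = L (bergmanMono hω 1 n) := by
  have hm : (moment ω (2 * n) : ℂ) ≠ 0 := by exact_mod_cast (hω.moment_pos _).ne'
  rw [dualCoeff, map_div₀, Complex.conj_conj, Complex.conj_ofReal]
  field_simp

/-- The function representing a functional is integrable. -/
lemma integrable_dual (hω : IsRadialWeight ω) (L : StrongDual ℂ (BergmanSpace 1 ω)) :
    Integrable (sumSeries (dualCoeff hω L)) (weightMeasure ω) := by
  have hfin := hω.isFiniteMeasure
  have hc := (converges_dualCoeff hω L).hasCoeffs
  set c := dualCoeff hω L with hcdef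
  refine ⟨hc.aestronglyMeasurable, ?_⟩
  have hm0 := hω.moment_pos 0
  -- The coefficients are such that L(p) = ∫|p|^2 for a partial sum p. With Cauchy–Schwarz, (∫|p|)^2
  -- ≤ m_0 ∫|p|^2 ≤ m_0 ‖L‖ ∫|p|. No doubling is involved.
  have key : ∀ N, ∫ z, ‖partialSum c N z‖ ∂(weightMeasure ω) ≤ ‖L‖ * moment ω 0 := by
    intro N
    set p := partialSum c N with hp
    have hpc : Continuous p := continuous_partialSum c N
    set I := ∫ z, ‖p z‖ ∂(weightMeasure ω) with hI
    set Q := ∫ z, ‖p z‖ ^ 2 ∂(weightMeasure ω) with hQ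
    have hI0 : 0 ≤ I := integral_nonneg fun z => norm_nonneg _
    have hpi := hω.integrable_of_continuous hpc
    have h1 : Q ≤ ‖L‖ * I := by
      let q : BergmanSpace 1 ω := ∑ n ∈ Finset.range N, c n • bergmanMono hω 1 n
      have hq : ∀ z ∈ disc, (q : ℂ → ℂ) z = p z := by
        intro z hz
        have h2 : (q : ℂ → ℂ) = BergmanSpace.eval 1 ω q := rfl
        rw [h2, map_sum, Finset.sum_apply, hp, partialSum]
        refine Finset.sum_congr rfl fun n _ => ?_
        rw [map_smul, Pi.smul_apply, smul_eq_mul]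
        congr 1
        exact bergmanMono_apply hω 1 n hz
      have hqn : ‖q‖ = I := by
        rw [BergmanSpace.norm_eq]
        refine integral_congr_ae ?_
        filter_upwards [ae_mem_disc ω] with z hz
        rw [hq z hz]
      have hLq : L q = (Q : ℂ) := by
        have h2 := hω.setIntegral_norm_sq_partialSum c N (S := Set.univ) MeasurableSet.univ
        have h3 : {z : ℂ | ‖z‖ ∈ Set.univ} = Set.univ := by simp
        rw [h3] at h2
        simp only [Measure.restrict_univ] at h2
        rw [hQ, h2, map_sum]
        push_cast
        refine Finset.sum_congr rfl fun n _ => ?_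
        rw [map_smul, smul_eq_mul, ← conj_dualCoeff_mul, ← mul_assoc, Complex.mul_conj,
          Complex.normSq_eq_norm_sq]
        push_cast
        rfl
      have h4 := L.le_opNorm q
      rw [hLq, hqn, Complex.norm_real] at h4
      exact (le_abs_self _).trans h4
    -- Cauchy–Schwarz, from the nonnegativity of ∫(m_0|p| - I)^2.
    have h2 : I ^ 2 ≤ moment ω 0 * Q := by
      have h3 : 0 ≤ ∫ z, (moment ω 0 * ‖p z‖ - I) ^ 2 ∂(weightMeasure ω) :=
        integral_nonneg fun z => sq_nonneg _
      have h4 : ∀ z, (moment ω 0 * ‖p z‖ - I) ^ 2 =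
          moment ω 0 ^ 2 * ‖p z‖ ^ 2 - 2 * moment ω 0 * I * ‖p z‖ + I ^ 2 := fun z => by ring
      have hpi2 : Integrable (fun z => ‖p z‖ ^ 2) (weightMeasure ω) :=
        hω.integrable_of_continuous (hpc.norm.pow 2)
      simp_rw [h4] at h3
      have h6 : Integrable (fun z => moment ω 0 ^ 2 * ‖p z‖ ^ 2 - 2 * moment ω 0 * I * ‖p z‖)
          (weightMeasure ω) := (hpi2.const_mul _).sub (hpi.norm.const_mul _)
      rw [integral_add h6 (integrable_const _),
        integral_sub (hpi2.const_mul _) (hpi.norm.const_mul _), integral_const_mul,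
        integral_const_mul, integral_const, ← moment_zero, smul_eq_mul] at h3
      have h5 : 0 ≤ moment ω 0 * (moment ω 0 * Q - I ^ 2) := by
        rw [← hI, ← hQ] at h3
        nlinarith
      have := (mul_nonneg_iff_of_pos_left hm0).1 h5
      linarith
    by_contra hc
    push Not at hc
    have hL := norm_nonneg L
    have hIp : 0 < I := lt_of_le_of_lt (by positivity) hc
    have h3 := mul_le_mul_of_nonneg_left h1 hm0.le
    nlinarith
  have h1 := hc.lintegral_le_liminf (ω := ω) 1 Set.univ
  simp only [Measure.restrict_univ, pow_one] at h1
  refine lt_of_le_of_lt (h1.trans (liminf_le_of_frequently_le' (Frequently.of_forall fun N => ?_)))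
    (ENNReal.ofReal_lt_top (r := ‖L‖ * moment ω 0))
  rw [← ofReal_integral_norm_eq_lintegral_enorm
    (hω.integrable_of_continuous (continuous_partialSum c N))]
  exact ENNReal.ofReal_le_ofReal (key N)

/-- The derivative of the function representing a functional. -/
lemma MomentDoubling.exists_norm_deriv_dual_le (hω : IsRadialWeight ω) {K : ℝ}
    (hK : MomentDoubling ω K) :
    ∃ C, 0 < C ∧ ∀ L : StrongDual ℂ (BergmanSpace 1 ω), ∀ z ∈ disc,
      ‖deriv (sumSeries (dualCoeff hω L)) z‖ ≤ C * ‖L‖ / (1 - ‖z‖) := by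
  obtain ⟨C, hC, h⟩ := hK.exists_kernelDeriv_le hω
  refine ⟨C, hC, fun L z hz => ?_⟩
  have hfin := hω.isFiniteMeasure
  have hz1 : 0 < 1 - ‖z‖ := sub_pos.2 (mem_disc.1 hz)
  have hw : conj z ∈ disc := by
    rw [mem_disc, RCLike.norm_conj]
    exact mem_disc.1 hz
  obtain ⟨r, hzr, hr1⟩ := exists_between (mem_disc.1 hz)
  have hr0 : 0 < r := (norm_nonneg z).trans_lt hzr
  -- Coefficients of the conjugate-variable derivative of the kernel at z. The truncated exponent at
  -- n = 0 is harmless because of the factor n.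
  set e : ℕ → ℂ := fun n => (n : ℂ) * conj z ^ (n - 1) / (moment ω (2 * n) : ℂ) with he
  have he1 : ∀ n, e (n + 1) = kernelDerivCoeff ω (conj z) n := by
    intro n
    simp only [he, kernelDerivCoeff]
    push_cast
    rfl
  have hes : Summable fun n : ℕ => ((n : ℝ) + 1) * ‖e n‖ := by
    have hb := (hω.converges_div_moment (b := fun _ => 1) (B := 1) (fun _ => by simp))
    have hb2 : Converges fun n => (n : ℂ) / (moment ω (2 * n) : ℂ) := by
      intro s hs
      refine Summable.of_nonneg_of_le (fun n => mul_nonneg (norm_nonneg _) (pow_nonneg hs.1 n))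
        (fun n => ?_) (hb.succ_mul hs)
      rw [norm_div, norm_div, norm_one, Complex.norm_natCast]
      have h1 := pow_nonneg hs.1 n
      have h2 := norm_nonneg (moment ω (2 * n) : ℂ)
      calc (n : ℝ) / ‖(moment ω (2 * n) : ℂ)‖ * s ^ n
          ≤ ((n : ℝ) + 1) / ‖(moment ω (2 * n) : ℂ)‖ * s ^ n := by
            gcongr
            linarith
        _ = _ := by ring
    have hb3 := (hb2.succ_mul ⟨hr0.le, hr1⟩).mul_right (1 / r)
    refine Summable.of_nonneg_of_le (fun n => by positivity) (fun n => ?_) hb3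
    have h1 : ‖e n‖ ≤ ‖(n : ℂ) / (moment ω (2 * n) : ℂ)‖ * r ^ n * (1 / r) := by
      rcases n with _ | n
      · simp [he]
      · have h2 : ‖e (n + 1)‖ = ‖((n + 1 : ℕ) : ℂ) / (moment ω (2 * (n + 1)) : ℂ)‖ * ‖z‖ ^ n := by
          simp only [he]
          rw [norm_div, norm_mul, norm_pow, RCLike.norm_conj, norm_div, Nat.add_sub_cancel]
          ring
        rw [h2, pow_succ]
        have h3 : ‖z‖ ^ n ≤ r ^ n := pow_le_pow_left₀ (norm_nonneg z) hzr.le n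
        have h4 : r ^ n * r * (1 / r) = r ^ n := by field_simp
        rw [mul_assoc, h4]
        exact mul_le_mul_of_nonneg_left h3 (norm_nonneg _)
    calc ((n : ℝ) + 1) * ‖e n‖ ≤ ((n : ℝ) + 1) *
          (‖(n : ℂ) / (moment ω (2 * n) : ℂ)‖ * r ^ n * (1 / r)) := by gcongr
      _ = _ := by ring
  have hes' := summable_norm_of_succ_mul hes
  let X : BergmanSpace 1 ω :=
    bergmanOfSeries (converges_of_summable hes') (hω.integrable_sumSeries hes')
  have hX : HasCoeffs e X := hasCoeffs_bergmanOfSeries _ _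
  have hLX : HasSum (fun n => e n * L (bergmanMono hω 1 n)) (L X) :=
    (bergmanDilationSpace hω).hasSum_apply hX hes L
  have hHs : Converges (kernelDerivCoeff ω (conj z)) := by
    refine converges_of_summable ?_
    have := (summable_nat_add_iff 1).2 hes'
    exact this.congr fun n => by rw [he1]
  have hH := hHs.hasCoeffs
  have hXn : ‖X‖ ≤ C / (1 - ‖z‖) := by
    have h1 := h _ hw _ hH
    rw [RCLike.norm_conj] at h1
    rw [BergmanSpace.norm_eq, integral_norm_eq_lintegral_enorm X.integrable.aestronglyMeasurable]
    refine ENNReal.toReal_le_of_le_ofReal (by positivity) (le_trans ?_ h1)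
    refine lintegral_mono_ae ?_
    filter_upwards [ae_mem_disc ω] with ζ hζ
    have h2 : (X : ℂ → ℂ) ζ = ζ * sumSeries (kernelDerivCoeff ω (conj z)) ζ := by
      have h3 := (hH ζ hζ).mul_left ζ
      have h4 := hX ζ hζ
      rw [← hasSum_nat_add_iff' 1] at h4
      simp only [Finset.range_one, Finset.sum_singleton, he, Nat.cast_zero, zero_mul, zero_div,
        sub_zero] at h4
      refine h4.unique (h3.congr_fun fun n => ?_)
      rw [← he1, he]
      ring
    rw [h2, enorm_mul]
    refine mul_le_of_le_one_left (zero_le) ?_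
    rw [← ofReal_norm]
    exact ENNReal.ofReal_le_one.2 (mem_disc.1 hζ).le
  -- The derivative of the representative at z is a value of L, so the norm of X controls it.
  have hder : deriv (sumSeries (dualCoeff hω L)) z = conj (L X) := by
    have h1 := (converges_dualCoeff hω L).hasCoeffs.deriv z hz
    have h2 := hLX.map (starRingEnd ℂ) Complex.continuous_conj
    rw [← hasSum_nat_add_iff' 1] at h2
    simp only [Finset.range_one, Finset.sum_singleton, Function.comp_apply] at h2
    have h3 : e 0 = 0 := by simp [he]
    rw [h3, zero_mul, map_zero, sub_zero] at h2
    refine h1.unique (h2.congr_fun fun n => ?_)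
    rw [he1, kernelDerivCoeff, derivCoeff, dualCoeff, map_mul, map_div₀, map_mul, map_pow,
      Complex.conj_conj, Complex.conj_ofReal, map_add, map_one, Complex.conj_natCast]
    ring
  rw [hder, RCLike.norm_conj]
  refine (L.le_opNorm X).trans ?_
  calc ‖L‖ * ‖X‖ ≤ ‖L‖ * (C / (1 - ‖z‖)) := by gcongr
    _ = _ := by ring

/-- The Bloch function representing a functional on `A^1_ω`. -/
lemma MomentDoubling.exists_bloch (hω : IsRadialWeight ω) {K : ℝ} (hK : MomentDoubling ω K) :
    ∃ C, 0 < C ∧ ∀ L : StrongDual ℂ (BergmanSpace 1 ω), ∃ g : Bloch,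
      HasCoeffs (dualCoeff hω L) g ∧ Integrable g (weightMeasure ω) ∧ ‖g‖ ≤ C * ‖L‖ := by
  obtain ⟨C, hC, h⟩ := hK.exists_norm_deriv_dual_le hω
  refine ⟨2 * C + 1, by positivity, fun L => ?_⟩
  have hL := norm_nonneg L
  have hc := converges_dualCoeff hω L
  have hq : ∀ z ∈ disc, blochQuantity (ofSeries _ hc) z ≤ 2 * C * ‖L‖ := by
    intro z hz
    have hz1 := mem_disc.1 hz
    have hz0 := norm_nonneg z
    have h1 : ‖deriv (ofSeries _ hc : ℂ → ℂ) z‖ ≤ C * ‖L‖ / (1 - ‖z‖) := h L z hz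
    unfold blochQuantity
    calc _ ≤ C * ‖L‖ / (1 - ‖z‖) * (1 - ‖z‖ ^ 2) :=
          mul_le_mul_of_nonneg_right h1 (by nlinarith)
      _ = C * ‖L‖ * (1 + ‖z‖) := by
          have : 1 - ‖z‖ ≠ 0 := by linarith
          field_simp
          ring
      _ ≤ C * ‖L‖ * 2 := by gcongr; linarith
      _ = _ := by ring
  refine ⟨Bloch.mk (ofSeries _ hc) _ hq, hc.hasCoeffs, integrable_dual hω L, ?_⟩
  refine (Bloch.norm_le _ hq).trans ?_
  have h0 : ‖(Bloch.mk (ofSeries _ hc) _ hq : ℂ → ℂ) 0‖ ≤ ‖L‖ := by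
    have h1 : (Bloch.mk (ofSeries _ hc) _ hq : ℂ → ℂ) 0 = dualCoeff hω L 0 :=
      hc.hasCoeffs.apply_zero
    have hm := hω.moment_pos 0
    rw [h1, dualCoeff, norm_div, RCLike.norm_conj, Complex.norm_real, mul_zero,
      Real.norm_of_nonneg hm.le, div_le_iff₀ hm]
    have := L.le_opNorm (bergmanMono hω 1 0)
    rwa [norm_bergmanMono] at this
  linarith

/-! ### Bounded functions and the projection -/

lemma HasCoeffs.add {a b : ℕ → ℂ} {f g : ℂ → ℂ} (hf : HasCoeffs a f) (hg : HasCoeffs b g) :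
    HasCoeffs (fun n => a n + b n) fun z => f z + g z := fun z hz =>
  ((hf z hz).add (hg z hz)).congr_fun fun _ => add_mul _ _ _

lemma HasCoeffs.const_mul {a : ℕ → ℂ} {f : ℂ → ℂ} (hf : HasCoeffs a f) (c : ℂ) :
    HasCoeffs (fun n => c * a n) fun z => c * f z := fun z hz =>
  ((hf z hz).mul_left c).congr_fun fun _ => mul_assoc _ _ _

lemma Bloch.ext_of_hasCoeffs {f g : Bloch} {a : ℕ → ℂ} (hf : HasCoeffs a f) (hg : HasCoeffs a g) :
    f = g := Subtype.ext (holo.ext_of_hasCoeffs hf hg)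

lemma BergmanSpace.ext_of_hasCoeffs {p : ℝ≥0∞} {f g : BergmanSpace p ω} {a : ℕ → ℂ}
    (hf : HasCoeffs a f) (hg : HasCoeffs a g) : f = g := Subtype.ext (holo.ext_of_hasCoeffs hf hg)

lemma isFiniteMeasure_area : IsFiniteMeasure area := by
  refine ⟨?_⟩
  rw [area, Measure.smul_apply, Measure.restrict_apply_univ, smul_eq_mul]
  exact ENNReal.mul_lt_top inv_ofReal_pi_ne_top.lt_top
    (by rw [disc, Complex.volume_ball]; exact ENNReal.mul_lt_top (by simp) (by simp))

lemma ae_norm_le_norm (ω : ℝ → ℝ) (f : Lp ℂ ∞ area) :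
    ∀ᵐ z ∂(weightMeasure ω), ‖f z‖ ≤ ‖f‖ := by
  refine (weightMeasure_absolutelyContinuous ω).ae_le ?_
  filter_upwards [ae_le_eLpNormEssSup (f := (f : ℂ → ℂ)) (μ := area)] with z hz
  rw [Lp.norm_def, eLpNorm_exponent_top, ← toReal_enorm]
  refine ENNReal.toReal_mono ?_ hz
  rw [← eLpNorm_exponent_top]
  exact Lp.eLpNorm_ne_top f

lemma aestronglyMeasurable_coe (ω : ℝ → ℝ) (f : Lp ℂ ∞ area) :
    AEStronglyMeasurable f (weightMeasure ω) :=
  (Lp.aestronglyMeasurable f).mono_ac (weightMeasure_absolutelyContinuous ω)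

lemma IsRadialWeight.integrable_coe (hω : IsRadialWeight ω) (f : Lp ℂ ∞ area) :
    Integrable f (weightMeasure ω) := by
  have := hω.isFiniteMeasure
  exact Integrable.of_bound (aestronglyMeasurable_coe ω f) ‖f‖ (ae_norm_le_norm ω f)

/-- The functional on `A^1_ω` induced by an element of `L^∞`. -/
def lpFunctional (ω : ℝ → ℝ) (f : Lp ℂ ∞ area) : StrongDual ℂ (BergmanSpace 1 ω) :=
  boundedFunctional f (aestronglyMeasurable_coe ω f) ‖f‖ (ae_norm_le_norm ω f)

lemma lpFunctional_add (f g : Lp ℂ ∞ area) (q : BergmanSpace 1 ω) :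
    lpFunctional ω (f + g) q = lpFunctional ω f q + lpFunctional ω g q := by
  unfold lpFunctional
  rw [boundedFunctional_apply, boundedFunctional_apply, boundedFunctional_apply,
    ← integral_add (q.integrable_mul_conj (aestronglyMeasurable_coe ω f) (ae_norm_le_norm ω f))
      (q.integrable_mul_conj (aestronglyMeasurable_coe ω g) (ae_norm_le_norm ω g))]
  refine integral_congr_ae ?_
  filter_upwards [(weightMeasure_absolutelyContinuous ω).ae_le (Lp.coeFn_add f g)] with z hz
  rw [hz, Pi.add_apply, map_add, mul_add]

lemma lpFunctional_smul (c : ℂ) (f : Lp ℂ ∞ area) (q : BergmanSpace 1 ω) :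
    lpFunctional ω (c • f) q = conj c * lpFunctional ω f q := by
  unfold lpFunctional
  rw [boundedFunctional_apply, boundedFunctional_apply, ← integral_const_mul]
  refine integral_congr_ae ?_
  filter_upwards [(weightMeasure_absolutelyContinuous ω).ae_le (Lp.coeFn_smul c f)] with z hz
  rw [hz, Pi.smul_apply, smul_eq_mul, map_mul]
  ring

/-- The projection of f is the Bloch representative of the functional induced by f. Both f ↦
functional and functional ↦ representative are conjugate-linear, so the composition is linear. -/
lemma MomentDoubling.exists_projection (hω : IsRadialWeight ω) {K : ℝ} (hK : MomentDoubling ω K) :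
    ∃ T : Lp ℂ ∞ area →L[ℂ] Bloch, ∀ f : Lp ℂ ∞ area, ∀ z ∈ disc, T f z = projection ω f z := by
  obtain ⟨C, hC, h⟩ := hK.exists_bloch hω
  choose g hg _ hgC using h
  refine ⟨LinearMap.mkContinuous
    { toFun := fun f => g (lpFunctional ω f)
      map_add' := fun f₁ f₂ => ?_
      map_smul' := fun c f => ?_ } C fun f => ?_, fun f z hz => ?_⟩
  · refine Bloch.ext_of_hasCoeffs (hg _) (g := g (lpFunctional ω f₁) + g (lpFunctional ω f₂)) ?_
    convert (hg (lpFunctional ω f₁)).add (hg (lpFunctional ω f₂)) using 1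
    · funext n
      rw [dualCoeff, dualCoeff, dualCoeff, lpFunctional_add, map_add, add_div]
    · rfl
  · refine Bloch.ext_of_hasCoeffs (hg _) (g := c • g (lpFunctional ω f)) ?_
    convert (hg (lpFunctional ω f)).const_mul c using 1
    · funext n
      rw [dualCoeff, dualCoeff, lpFunctional_smul, map_mul, Complex.conj_conj, mul_div_assoc]
    · rfl
  · refine (hgC _).trans (mul_le_mul_of_nonneg_left ?_ hC.le)
    exact norm_boundedFunctional_le _ _ (norm_nonneg f) _
  · refine (hg (lpFunctional ω f) z hz).unique
      ((hω.hasSum_projection (hω.integrable_coe f) hz).congr_fun fun n => ?_)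
    rw [dualCoeff, lpFunctional, boundedFunctional_mono]

/-- Test on the unimodular function (z/|z|)^n: the n-th coefficient of its projection is m_n /
m_{2n}, and Bloch coefficients are bounded by 6 times the norm. -/
lemma momentDoubling_of_projection (hω : IsRadialWeight ω)
    (h : ∃ T : Lp ℂ ∞ area →L[ℂ] Bloch, ∀ f : Lp ℂ ∞ area, ∀ z ∈ disc,
      T f z = projection ω f z) : ∃ K, MomentDoubling ω K := by
  obtain ⟨T, hT⟩ := h
  refine ⟨6 * ‖T‖, fun n => ?_⟩
  have := isFiniteMeasure_area
  have hmem : MemLp (phasePow n) ∞ area :=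
    memLp_top_of_bound (measurable_phasePow n).aestronglyMeasurable 1
      (ae_of_all _ (norm_phasePow_le n))
  set f : Lp ℂ ∞ area := hmem.toLp with hf
  have hfeq : (f : ℂ → ℂ) =ᵐ[weightMeasure ω] phasePow n :=
    (weightMeasure_absolutelyContinuous ω).ae_le hmem.coeFn_toLp
  have hfn : ‖f‖ ≤ 1 := by
    have h1 : ∀ᵐ z ∂area, ‖f z‖ ≤ 1 := by
      filter_upwards [hmem.coeFn_toLp] with z hz
      rw [hf, hz]
      exact norm_phasePow_le n z
    simpa using Lp.norm_le_of_ae_bound zero_le_one h1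
  have hc : HasCoeffs (fun k => conj (∫ ζ, ζ ^ k * conj (f ζ) ∂(weightMeasure ω)) /
      moment ω (2 * k)) (T f) := fun z hz => by
    rw [hT f z hz]
    exact hω.hasSum_projection (hω.integrable_coe f) hz
  have h1 := (T f).norm_coeff_le hc n
  have h2 : conj (∫ ζ, ζ ^ n * conj (f ζ) ∂(weightMeasure ω)) = (moment ω n : ℂ) := by
    rw [← integral_conj, ← integral_phasePow_mul_conj_pow]
    refine integral_congr_ae ?_
    filter_upwards [hfeq] with ζ hζ
    rw [hζ, map_mul, Complex.conj_conj, mul_comm]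
  have hm := hω.moment_pos (2 * n)
  simp only [h2] at h1
  rw [norm_div, Complex.norm_real, Complex.norm_real, Real.norm_of_nonneg hm.le,
    Real.norm_of_nonneg (hω.moment_pos n).le, div_le_iff₀ hm] at h1
  refine h1.trans (mul_le_mul_of_nonneg_right ?_ hm.le)
  have h3 := T.le_opNorm f
  have h4 := mul_le_mul_of_nonneg_left hfn (norm_nonneg T)
  linarith

/-! ### The dual of `A^1_ω` -/

lemma MomentDoubling.bergman_dual (hω : IsRadialWeight ω) {K : ℝ} (hK : MomentDoubling ω K) :
    ∃ C : ℝ, 0 < C ∧ ∀ L : StrongDual ℂ (BergmanSpace 1 ω),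
      ∃ g : Bloch, (∀ f : BergmanSpace 1 ω, HasPairing ω f g (L f)) ∧ ‖g‖ ≤ C * ‖L‖ ∧
        ∀ g' : Bloch, (∀ f : BergmanSpace 1 ω, HasPairing ω f g' (L f)) → g' = g := by
  obtain ⟨C, hC, h⟩ := hK.exists_bloch hω
  refine ⟨C, hC, fun L => ?_⟩
  obtain ⟨g, hg, hgi, hgC⟩ := h L
  refine ⟨g, fun f => (bergmanDilationSpace hω).hasPairing hω L hg hgi
    (conj_dualCoeff_mul hω L) f, hgC, fun g' hg' => ?_⟩
  have h1 := (g'.hasCoeffs.eq_of_hasPairing hω (fun n z hz => bergmanMono_apply hω 1 n hz)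
    fun n => hg' (bergmanMono hω 1 n)).2
  refine Bloch.ext_of_hasCoeffs (a := dualCoeff hω L) ?_ hg
  have h2 : coeff g' = dualCoeff hω L := by
    funext n
    have hm : (moment ω (2 * n) : ℂ) ≠ 0 := by exact_mod_cast (hω.moment_pos _).ne'
    rw [dualCoeff, h1 n, map_mul, Complex.conj_conj, Complex.conj_ofReal]
    field_simp
  exact h2 ▸ g'.hasCoeffs

/-- The functional induced by (z/|z|)^n has norm at most 1 and takes the value m_n at z^n, so the
n-th coefficient of its representative has modulus m_n / m_{2n}. -/
lemma momentDoubling_of_bergman_dual (hω : IsRadialWeight ω)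
    (h : ∃ C : ℝ, 0 < C ∧ ∀ L : StrongDual ℂ (BergmanSpace 1 ω),
      ∃ g : Bloch, (∀ f : BergmanSpace 1 ω, HasPairing ω f g (L f)) ∧ ‖g‖ ≤ C * ‖L‖) :
    ∃ K, MomentDoubling ω K := by
  obtain ⟨C, hC, h⟩ := h
  refine ⟨6 * C, fun n => ?_⟩
  have hB : ∀ᵐ z ∂(weightMeasure ω), ‖phasePow n z‖ ≤ 1 := ae_of_all _ (norm_phasePow_le n)
  set L := boundedFunctional (phasePow n) (measurable_phasePow n).aestronglyMeasurable 1 hB with hL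
  obtain ⟨g, hg, hgC⟩ := h L
  have h1 := (g.hasCoeffs.eq_of_hasPairing hω (fun n z hz => bergmanMono_apply hω 1 n hz)
    fun n => hg (bergmanMono hω 1 n)).2 n
  have h2 : L (bergmanMono hω 1 n) = (moment ω n : ℂ) := by
    rw [hL, boundedFunctional_mono, ← Complex.conj_ofReal, ← integral_phasePow_mul_conj_pow,
      ← integral_conj]
    refine integral_congr_ae (ae_of_all _ fun z => ?_)
    simp only [map_mul, Complex.conj_conj]
    ring
  have hm := hω.moment_pos (2 * n)
  have h3 : moment ω n = ‖coeff g n‖ * moment ω (2 * n) := by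
    have h4 := congrArg norm h1
    rwa [h2, norm_mul, RCLike.norm_conj, Complex.norm_real, Complex.norm_real,
      Real.norm_of_nonneg hm.le, Real.norm_of_nonneg (hω.moment_pos n).le] at h4
  rw [h3]
  refine mul_le_mul_of_nonneg_right ?_ hm.le
  have h5 := g.norm_coeff_le g.hasCoeffs n
  have h6 : ‖L‖ ≤ 1 := norm_boundedFunctional_le _ _ zero_le_one _
  have h7 := mul_le_mul_of_nonneg_left h6 hC.le
  linarith

/-! ### The dual of the little Bloch space -/

/-- Linear growth is allowed because the available bound for z^n in the little Bloch space is n + 1.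
-/
lemma IsRadialWeight.converges_div_moment_of_le_succ (hω : IsRadialWeight ω) {b : ℕ → ℂ} {B : ℝ}
    (hb : ∀ n : ℕ, ‖b n‖ ≤ B * ((n : ℝ) + 1)) : Converges fun n => b n / (moment ω (2 * n) : ℂ) := by
  intro r hr
  have h1 := ((hω.converges_div_moment (b := fun _ => 1) (B := 1) (fun _ => by simp)).succ_mul
    hr).mul_left B
  refine Summable.of_nonneg_of_le (fun n => mul_nonneg (norm_nonneg _) (pow_nonneg hr.1 n))
    (fun n => ?_) h1
  have h2 := pow_nonneg hr.1 n
  rw [norm_div, norm_div, norm_one]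
  calc ‖b n‖ / ‖(moment ω (2 * n) : ℂ)‖ * r ^ n
      ≤ B * ((n : ℝ) + 1) / ‖(moment ω (2 * n) : ℂ)‖ * r ^ n := by
        gcongr
        exact hb n
    _ = _ := by ring

lemma littleBlochMono_apply (n : ℕ) {z : ℂ} (hz : z ∈ disc) :
    ((littleBlochDilationSpace.mono n : Bloch) : ℂ → ℂ) z = z ^ n :=
  littleBlochDilationSpace.eval_mono n z hz

/-- The coefficients of the function representing a functional on the little Bloch space. -/
def predualCoeff (ω : ℝ → ℝ) (L : StrongDual ℂ LittleBloch) (n : ℕ) : ℂ :=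
  conj (L (littleBlochDilationSpace.mono n)) / (moment ω (2 * n) : ℂ)

lemma IsRadialWeight.converges_predualCoeff (hω : IsRadialWeight ω) (L : StrongDual ℂ LittleBloch) :
    Converges (predualCoeff ω L) := by
  refine hω.converges_div_moment_of_le_succ
    (B := ‖L‖ * littleBlochDilationSpace.bound) fun n => ?_
  rw [RCLike.norm_conj, mul_assoc]
  exact (L.le_opNorm _).trans
    (mul_le_mul_of_nonneg_left (littleBlochDilationSpace.norm_mono_le n) (norm_nonneg L))

lemma IsRadialWeight.conj_predualCoeff_mul (hω : IsRadialWeight ω) (L : StrongDual ℂ LittleBloch)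
    (n : ℕ) : conj (predualCoeff ω L n) * moment ω (2 * n) =
      L (littleBlochDilationSpace.mono n) := by
  have hm : (moment ω (2 * n) : ℂ) ≠ 0 := by exact_mod_cast (hω.moment_pos _).ne'
  rw [predualCoeff, map_div₀, Complex.conj_conj, Complex.conj_ofReal]
  field_simp

/-- The integral means of the function representing a functional on the little Bloch space. -/
lemma MomentDoubling.exists_integral_dilate_le (hω : IsRadialWeight ω) {K : ℝ}
    (hK : MomentDoubling ω K) :
    ∃ C, 0 < C ∧ ∀ L : StrongDual ℂ LittleBloch, ∀ r ∈ Set.Ioo (0 : ℝ) 1,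
      ∫ z, ‖sumSeries (predualCoeff ω L) (r * z)‖ ∂(weightMeasure ω) ≤ C * ‖L‖ := by
  obtain ⟨C, hC, h⟩ := hK.exists_bloch hω
  refine ⟨C, hC, fun L r hr => ?_⟩
  have hr' : r ∈ Set.Icc (0 : ℝ) 1 := ⟨hr.1.le, hr.2.le⟩
  have hcc := hω.converges_predualCoeff L
  set c := predualCoeff ω L with hcdef
  have hc := hcc.hasCoeffs
  set G : ℂ → ℂ := fun z => sumSeries c (r * z) with hG
  have hGc : HasCoeffs (fun n => c n * (r : ℂ) ^ n) G := hc.dilate hr'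
  -- Pairing G with this function of modulus at most 1 gives the L^1 norm of G.
  set s : ℂ → ℂ := fun z => G z / (‖G z‖ : ℂ) with hs
  have hsm : AEStronglyMeasurable s (weightMeasure ω) := by
    have h1 : AEMeasurable G (weightMeasure ω) := hGc.aestronglyMeasurable.aemeasurable
    exact (h1.div (Complex.continuous_ofReal.measurable.comp_aemeasurable
      h1.norm)).aestronglyMeasurable
  have hs1 : ∀ᵐ z ∂(weightMeasure ω), ‖s z‖ ≤ 1 := ae_of_all _ fun z => by
    simp only [hs]
    rw [norm_div, Complex.norm_real, norm_norm]
    exact div_self_le_one _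
  have hsG : ∀ z, G z * conj (s z) = (‖G z‖ : ℂ) := by
    intro z
    simp only [hs]
    rw [map_div₀, Complex.conj_ofReal, ← mul_div_assoc, Complex.mul_conj,
      Complex.normSq_eq_norm_sq]
    push_cast
    by_cases h0 : (‖G z‖ : ℂ) = 0
    · simp [h0]
    · rw [pow_two, mul_div_assoc, div_self h0, mul_one]
  have hfin := hω.isFiniteMeasure
  have hsi : Integrable s (weightMeasure ω) := Integrable.of_bound hsm 1 hs1
  set Λ := boundedFunctional s hsm 1 hs1 with hΛ
  have hΛ1 : ‖Λ‖ ≤ 1 := norm_boundedFunctional_le _ _ zero_le_one _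
  -- Doubling enters here: the functional given by s has a Bloch representative F of norm at most C.
  obtain ⟨F, hF, -, hFC⟩ := h Λ
  have hcr := hcc.summable_dilate hr
  have hI : HasSum (fun n => c n * (r : ℂ) ^ n * Λ (bergmanMono hω 1 n))
      ((∫ z, ‖G z‖ ∂(weightMeasure ω) : ℝ) : ℂ) := by
    have h1 := (hGc.hasSum_integral_mul_conj (summable_norm_of_succ_mul hcr) hsi).2
    simp_rw [hsG] at h1
    rw [integral_complex_ofReal] at h1
    refine h1.congr_fun fun n => ?_
    rw [hΛ, boundedFunctional_mono]
  have hFr := hF.converges.summable_dilate hr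
  -- F need not be a little Bloch function, but its dilation is. The factor r^n in the coefficients
  -- of G is transferred to F, and dilation does not increase the Bloch norm.
  set x := littleBlochOfSeries hFr with hx
  have hxc : HasCoeffs (fun n => dualCoeff hω Λ n * (r : ℂ) ^ n) (x : Bloch) :=
    hasCoeffs_littleBlochOfSeries hFr
  have hLx := littleBlochDilationSpace.hasSum_apply (x := x) hxc hFr L
  have hLx2 : conj (L x) = ((∫ z, ‖G z‖ ∂(weightMeasure ω) : ℝ) : ℂ) := by
    refine (hLx.map (starRingEnd ℂ) Complex.continuous_conj).unique (hI.congr_fun fun n => ?_)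
    have hm : (moment ω (2 * n) : ℂ) ≠ 0 := by exact_mod_cast (hω.moment_pos _).ne'
    simp only [Function.comp_apply, map_mul, map_pow, Complex.conj_ofReal]
    rw [← hω.conj_predualCoeff_mul L n, ← conj_dualCoeff_mul, map_mul, Complex.conj_conj,
      Complex.conj_ofReal]
    ring
  have hxn : ‖x‖ ≤ ‖F‖ := by
    have hxF : ∀ z ∈ disc, (x : Bloch) z = F (r * z) := fun z hz =>
      (hxc z hz).unique (hF.dilate hr' z hz)
    rw [Submodule.coe_norm, Bloch.norm_eq, Bloch.norm_eq]
    refine add_le_add (ciSup_le fun z => ?_) (le_of_eq ?_)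
    · have hrz : (r : ℂ) * z ∈ disc := by
        rw [mem_disc, norm_mul, Complex.norm_real, Real.norm_of_nonneg hr.1.le]
        exact mul_lt_one_of_nonneg_of_lt_one_left hr.1.le hr.2 (mem_disc.1 z.2).le
      exact (blochQuantity_dilate_le hF hr' z.2 hxF).trans
        (le_ciSup F.2 (⟨(r : ℂ) * z, hrz⟩ : disc))
    · rw [hxF 0 (by simp [disc]), mul_zero]
  have h1 : ∫ z, ‖G z‖ ∂(weightMeasure ω) ≤ ‖L x‖ := by
    rw [← RCLike.norm_conj (L x), hLx2, Complex.norm_real]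
    exact le_abs_self _
  have hL := norm_nonneg L
  calc ∫ z, ‖G z‖ ∂(weightMeasure ω) ≤ ‖L x‖ := h1
    _ ≤ ‖L‖ * ‖x‖ := L.le_opNorm x
    _ ≤ ‖L‖ * (C * 1) := by
      gcongr
      exact hxn.trans (hFC.trans (mul_le_mul_of_nonneg_left hΛ1 hC.le))
    _ = C * ‖L‖ := by ring

/-- A uniform bound for the dilations gives a bound in `A^1_ω`. -/
lemma HasCoeffs.lintegral_le_of_dilate_le (hω : IsRadialWeight ω) {c : ℕ → ℂ} {f : ℂ → ℂ}
    (h : HasCoeffs c f) {B : ℝ} (hB : ∀ r ∈ Set.Ioo (0 : ℝ) 1,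
      ∫ z, ‖f (r * z)‖ ∂(weightMeasure ω) ≤ B) :
    ∫⁻ z, ‖f z‖ₑ ∂(weightMeasure ω) ≤ ENNReal.ofReal B := by
  have h1 : ∫⁻ z, ‖f z‖ₑ ∂(weightMeasure ω) =
      ∫⁻ z, liminf (fun j => ‖f (radius j * z)‖ₑ) atTop ∂(weightMeasure ω) := by
    refine lintegral_congr_ae ?_
    filter_upwards [ae_mem_disc ω] with z hz
    have h2 : Tendsto (fun j => ((radius j : ℝ) : ℂ) * z) atTop (𝓝 z) := by
      have h3 : Tendsto (fun j => ((radius j : ℝ) : ℂ)) atTop (𝓝 ((1 : ℝ) : ℂ)) :=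
        (Complex.continuous_ofReal.tendsto 1).comp tendsto_radius
      simpa using h3.mul_const z
    have h4 : ContinuousAt f z :=
      (h.differentiableOn.differentiableAt (isOpen_disc.mem_nhds hz)).continuousAt
    exact ((h4.tendsto.comp h2).enorm.liminf_eq).symm
  rw [h1]
  refine (lintegral_liminf_le' fun j => ?_).trans
    (liminf_le_of_frequently_le' (Frequently.of_forall fun j => ?_))
  · exact (h.integrable_dilate hω (radius_mem j)).aestronglyMeasurable.enorm
  · rw [← ofReal_integral_norm_eq_lintegral_enorm (h.integrable_dilate hω (radius_mem j))]
    exact ENNReal.ofReal_le_ofReal (hB _ (radius_mem j))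

/-- The dilations of the candidate are bounded in L^1 uniformly in r, so by Fatou the candidate
itself is in A^1 with the same bound. Uniqueness comes from pairing with monomials. -/
lemma MomentDoubling.littleBloch_dual (hω : IsRadialWeight ω) {K : ℝ} (hK : MomentDoubling ω K) :
    ∃ C : ℝ, 0 < C ∧ ∀ L : StrongDual ℂ LittleBloch,
      ∃ g : BergmanSpace 1 ω, (∀ f : LittleBloch, HasPairing ω (f : Bloch) g (L f)) ∧
        ‖g‖ ≤ C * ‖L‖ ∧
        ∀ g' : BergmanSpace 1 ω,
          (∀ f : LittleBloch, HasPairing ω (f : Bloch) g' (L f)) → g' = g := by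
  obtain ⟨C, hC, h⟩ := hK.exists_integral_dilate_le hω
  refine ⟨C, hC, fun L => ?_⟩
  have hcc := hω.converges_predualCoeff L
  have hc := hcc.hasCoeffs
  have hle := hc.lintegral_le_of_dilate_le hω (h L)
  have hi : Integrable (sumSeries (predualCoeff ω L)) (weightMeasure ω) :=
    ⟨hc.aestronglyMeasurable, hle.trans_lt ENNReal.ofReal_lt_top⟩
  have hg : HasCoeffs (predualCoeff ω L) (bergmanOfSeries hcc hi : ℂ → ℂ) :=
    hasCoeffs_bergmanOfSeries hcc hi
  refine ⟨bergmanOfSeries hcc hi, fun f => littleBlochDilationSpace.hasPairing hω L hg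
    (BergmanSpace.integrable _) (hω.conj_predualCoeff_mul L) f, ?_, fun g' hg' => ?_⟩
  · rw [BergmanSpace.norm_eq,
      integral_norm_eq_lintegral_enorm (BergmanSpace.integrable _).aestronglyMeasurable]
    exact ENNReal.toReal_le_of_le_ofReal (by positivity) hle
  · have h1 := (g'.hasCoeffs.eq_of_hasPairing hω (fun n z hz => littleBlochMono_apply n hz)
      fun n => hg' (littleBlochDilationSpace.mono n)).2
    refine BergmanSpace.ext_of_hasCoeffs (a := predualCoeff ω L) ?_ hg
    have h2 : coeff g' = predualCoeff ω L := by
      funext n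
      have hm : (moment ω (2 * n) : ℂ) ≠ 0 := by exact_mod_cast (hω.moment_pos _).ne'
      rw [predualCoeff, h1 n, map_mul, Complex.conj_conj, Complex.conj_ofReal]
      field_simp
    exact h2 ▸ g'.hasCoeffs

/-- The `n`-th Taylor coefficient as a functional on the little Bloch space. -/
def coeffFunctional (n : ℕ) : StrongDual ℂ LittleBloch :=
  LinearMap.mkContinuous
    { toFun := fun f => coeff (f : Bloch) n
      map_add' := fun f g => (((f : Bloch).hasCoeffs.add (g : Bloch).hasCoeffs).eq_coeff n).symm
      map_smul' := fun c f => (((f : Bloch).hasCoeffs.const_mul c).eq_coeff n).symm } 6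
    fun f => (f : Bloch).norm_coeff_le (f : Bloch).hasCoeffs n

lemma norm_coeffFunctional_le (n : ℕ) : ‖coeffFunctional n‖ ≤ 6 :=
  ContinuousLinearMap.opNorm_le_bound _ (by norm_num)
    fun f => (f : Bloch).norm_coeff_le (f : Bloch).hasCoeffs n

lemma coeffFunctional_mono (n : ℕ) : coeffFunctional n (littleBlochDilationSpace.mono n) = 1 := by
  have h := (littleBlochDilationSpace.hasCoeffs_mono n).eq_coeff n
  rw [Pi.single_eq_same] at h
  exact h.symm

/-- Test on the n-th coefficient functional, of norm at most 6 and value 1 at z^n: its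
representative has |b_n| = 1 / m_{2n}, while |b_n| m_n is at most the A^1 norm, hence at most 6C. -/
lemma momentDoubling_of_littleBloch_dual (hω : IsRadialWeight ω)
    (h : ∃ C : ℝ, 0 < C ∧ ∀ L : StrongDual ℂ LittleBloch,
      ∃ g : BergmanSpace 1 ω, (∀ f : LittleBloch, HasPairing ω (f : Bloch) g (L f)) ∧
        ‖g‖ ≤ C * ‖L‖) : ∃ K, MomentDoubling ω K := by
  obtain ⟨C, hC, h⟩ := h
  refine ⟨6 * C, fun n => ?_⟩
  obtain ⟨g, hg, hgC⟩ := h (coeffFunctional n)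
  have h1 := (g.hasCoeffs.eq_of_hasPairing hω (fun n z hz => littleBlochMono_apply n hz)
    fun n => hg (littleBlochDilationSpace.mono n)).2 n
  rw [coeffFunctional_mono] at h1
  have hm := hω.moment_pos (2 * n)
  have h2 : 1 = ‖coeff g n‖ * moment ω (2 * n) := by
    have h3 := congrArg norm h1
    rwa [norm_one, norm_mul, RCLike.norm_conj, Complex.norm_real,
      Real.norm_of_nonneg hm.le] at h3
  have h4 := g.hasCoeffs.norm_mul_moment_le hω g.integrable n
  rw [← BergmanSpace.norm_eq] at h4
  have h5 := mul_le_mul_of_nonneg_left (norm_coeffFunctional_le n) hC.le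
  have h6 : ‖coeff g n‖ * moment ω n ≤ 6 * C := by linarith
  calc moment ω n = ‖coeff g n‖ * moment ω n * moment ω (2 * n) := by
        rw [mul_right_comm, ← h2, one_mul]
    _ ≤ 6 * C * moment ω (2 * n) := mul_le_mul_of_nonneg_right h6 hm.le

end

end Bergman

theorem theorem1 (ω : ℝ → ℝ) (hω : IsRadialWeight ω) :
    [ -- the projection is a bounded operator from `L^∞` to the Bloch space
      ∃ T : Lp ℂ ∞ area →L[ℂ] Bloch, ∀ f : Lp ℂ ∞ area, ∀ z ∈ disc, T f z = projection ω f z,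
      -- the dual of `A^1_ω` is continuously embedded into the Bloch space
      ∃ C : ℝ, 0 < C ∧ ∀ L : StrongDual ℂ (BergmanSpace 1 ω),
        ∃ g : Bloch, (∀ f : BergmanSpace 1 ω, HasPairing ω f g (L f)) ∧ ‖g‖ ≤ C * ‖L‖ ∧
          ∀ g' : Bloch, (∀ f : BergmanSpace 1 ω, HasPairing ω f g' (L f)) → g' = g,
      -- the dual of the little Bloch space is continuously embedded into `A^1_ω`
      ∃ C : ℝ, 0 < C ∧ ∀ L : StrongDual ℂ LittleBloch,
        ∃ g : BergmanSpace 1 ω, (∀ f : LittleBloch, HasPairing ω (f : Bloch) g (L f)) ∧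
          ‖g‖ ≤ C * ‖L‖ ∧
          ∀ g' : BergmanSpace 1 ω,
            (∀ f : LittleBloch, HasPairing ω (f : Bloch) g' (L f)) → g' = g,
      -- the tail integral is doubling
      TailDoubling ω ].TFAE := by
  tfae_have 4 → 1 := fun h => by
    obtain ⟨K, hK⟩ := h.momentDoubling hω
    exact hK.exists_projection hω
  tfae_have 4 → 2 := fun h => by
    obtain ⟨K, hK⟩ := h.momentDoubling hω
    exact hK.bergman_dual hω
  tfae_have 4 → 3 := fun h => by
    obtain ⟨K, hK⟩ := h.momentDoubling hω
    exact hK.littleBloch_dual hω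
  tfae_have 1 → 4 := fun h => by
    obtain ⟨K, hK⟩ := momentDoubling_of_projection hω h
    exact hK.tailDoubling hω
  tfae_have 2 → 4 := fun h => by
    obtain ⟨C, hC, h⟩ := h
    obtain ⟨K, hK⟩ := momentDoubling_of_bergman_dual hω ⟨C, hC, fun L => by
      obtain ⟨g, hg, hgC, -⟩ := h L
      exact ⟨g, hg, hgC⟩⟩
    exact hK.tailDoubling hω
  tfae_have 3 → 4 := fun h => by
    obtain ⟨C, hC, h⟩ := h
    obtain ⟨K, hK⟩ := momentDoubling_of_littleBloch_dual hω ⟨C, hC, fun L => by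
      obtain ⟨g, hg, hgC, -⟩ := h L
      exact ⟨g, hg, hgC⟩⟩
    exact hK.tailDoubling hω
  tfae_finish
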